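/- Let $f\in C^2(\mathbb R)$ be strictly concave and let $h:\mathbb R\to\mathbb R$ be piecewise $C^1$ with compact support (off a finite set $h$ is $C^1$, and at the exceptional points $h$ and $h'$ have finite one-sided limits). Assume that for every $t\ge 0$ the function $x_t(\xi)=\xi+f'(h(\xi))\,t$, $\xi\in\mathbb R$, has only finitely many local extrema. **Notation.** Let $\gamma_0\subset\mathbb R^2$ be the graph of $h$ together with the vertical segments joining the one-sided limits at its discontinuities, let $\gamma_t=G_t(\gamma_0)$ with $G_t(x,y)=(x+f'(y)t,\,y)$, and let $\hat\Gamma=\{(x,t,y): t\ge 0,\ (x,y)\in\gamma_t\}$. *The class $\Upsilon$.* A function $u:\mathbb R\times[0,\infty)\to\mathbb R$ belongs to $\Upsilon=\Upsilon(f,h)$ if $u(x,0)=h(x)$ for all $x$; the graph of $u$ is contained in $\hat\Gamma$; the boundary of the graph (its frontier relative to $\hat\Gamma$) is a finite union of $C^1$-curves (images of intervals under $C^1$-maps) whose projections to the $(x,t)$-plane meet every line $t=t_0$ in only finitely many points; and $\int_{\mathbb R}u(x,t)\,dx$ exists and is continuous in $t\ge0$. *The integral conservation law.* $u$ solves it if,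 for all $a<b$ and $t>0$ such that $u$ is continuous at $(a,t)$ and at $(b,t)$, $$\frac{d}{dt}\int_a^b u(x,t)\,dx=f(u(a,t))-f(u(b,t)),$$ where $u(\cdot,t)$ is integrable on bounded intervals. We say that $u$ *jumps only upwards* if $u^-<u^+$ for the one-sided limits of $u(\cdot,t)$ at each of its jumps, for every $t>0$. *The equal-area construction.* Parametrize the continuous curve formed by the graph of $h$ and the vertical segments at its jumps (disregarding a value of $h$ at a discontinuity that is not between the one-sided limits) injectively, continuously and piecewise $C^1$ from left to right by $s\mapsto(X(s),Y(s))$, and put $x(s)=X(s)+f'(Y(s))\,t$, so that $s\mapsto(x(s),Y(s))$ runs through the corresponding part of $\gamma_t$. For $t>0$ choose finitely many pairwise disjoint parameter intervals $[a_i,b_i]$, $a_i<b_i$, such that * $x(a_i)=x(b_i)=:c_i$ (vertical cut), and the lobes that the line $x=c_i$ cuts off from the arc over $[a_i,b_i]$ on its right and on its left have equal total areas, where left lobes compensate right lobes that precede them: whenever the arc from $a_i$ onwards meets the line, the right lobes so far have at least as much area as the left lobes so far; * after removing the arcs over all $(a_i,b_i)$, the rest of the curve is the graph of a function over all of $\mathbb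 R$, except that over $c_i$ there are the two end points of the cut ($x$ is strictly increasing on the remaining parameters apart from $x(a_i)=x(b_i)$). Then $u(\cdot,t)$ is the function with this graph, with either of the two end values at each $c_i$; and $u(\cdot,0)=h$. **Theorem.** 1. The equal-area construction can be carried out for every $t>0$. 2. Every function $u$ obtained by it solves the integral conservation law and jumps only upwards. 3. If $u$ has only finitely many shocks (the points $(x,t)$, $t>0$, at which $u(\cdot,t)$ is discontinuous form finitely many pairwise disjoint graphs $x=s(t)$ of continuous functions over intervals of times), then $u\in\Upsilon$. 4. $u$ is the unique solution: if $v\in\Upsilon$ solves the integral conservation law and jumps only upwards, then for every $t\ge 0$ we have $v(x,t)=u(x,t)$ for almost all $x$. -/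

import Mathlib

open Set Filter Topology MeasureTheory

noncomputable section

namespace EqualArea

/-- `h` is piecewise `C¹`: off a finite set it is continuously differentiable, and at the
exceptional points both `h` and `h'` have finite one-sided limits. -/
def PiecewiseC1 (h : ℝ → ℝ) : Prop :=
  ∃ S : Finset ℝ, (∀ x, x ∉ S → ContDiffAt ℝ 1 h x) ∧
    ∀ x ∈ S,
      (∃ l, Tendsto h (𝓝[<] x) (𝓝 l)) ∧ (∃ r, Tendsto h (𝓝[>] x) (𝓝 r)) ∧
      (∃ l, Tendsto (deriv h) (𝓝[<] x) (𝓝 l)) ∧ (∃ r, Tendsto (deriv h) (𝓝[>] x) (𝓝 r))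

/-! ### The characteristic surface -/

/-- The continuous curve consisting of the graph of `h` off its discontinuities and of the
vertical segments joining the one-sided limits of `h` at each of its discontinuities. -/
def completedGraph (h : ℝ → ℝ) : Set (ℝ × ℝ) :=
  {p | p.2 ∈ uIcc (Function.leftLim h p.1) (Function.rightLim h p.1)}

/-- The curve `γ₀`: the graph of `h` together with the vertical segments at its jumps.  (It is
`completedGraph h`, unless the value of `h` at a discontinuity is not between the one-sided
limits.) -/
def initialCurve (h : ℝ → ℝ) : Set (ℝ × ℝ) :=
  {p | p.2 = h p.1} ∪ completedGraph h

/-- The plane transformation `G_t (x, y) = (x + f'(y) t, y)`. -/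
def shear (f : ℝ → ℝ) (t : ℝ) (p : ℝ × ℝ) : ℝ × ℝ :=
  (p.1 + deriv f p.2 * t, p.2)

/-- The curve `γ_t = G_t (γ₀)`. -/
def curveAt (f h : ℝ → ℝ) (t : ℝ) : Set (ℝ × ℝ) :=
  shear f t '' initialCurve h

/-- The bounding characteristic surface: all `(x, t, y)` with `t ≥ 0` and `(x, y) ∈ γ_t`. -/
def boundingSurface (f h : ℝ → ℝ) : Set (ℝ × ℝ × ℝ) :=
  {p | 0 ≤ p.2.1 ∧ (p.1, p.2.2) ∈ curveAt f h p.2.1}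

/-! ### The class `Υ(f, h)`

A function on `ℝ × [0, ∞)` is represented by `u : ℝ → ℝ → ℝ`, `u x t`; only its values for
`t ≥ 0` matter. -/

/-- The graph `{(x, t, u(x, t)) | t ≥ 0}`. -/
def graphOf (u : ℝ → ℝ → ℝ) : Set (ℝ × ℝ × ℝ) :=
  {p | 0 ≤ p.2.1 ∧ p.2.2 = u p.1 p.2.1}

/-- The boundary of the graph of `u`, as a part of the bounding characteristic surface: the
frontier of the graph relative to that surface. -/
def graphBoundary (f h : ℝ → ℝ) (u : ℝ → ℝ → ℝ) : Set (ℝ × ℝ × ℝ) :=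
  ((↑) : boundingSurface f h → ℝ × ℝ × ℝ) ''
    frontier (((↑) : boundingSurface f h → ℝ × ℝ × ℝ) ⁻¹' graphOf u)

/-- A `C¹`-curve in space: the image of an interval (of any kind) under a `C¹`-map. -/
def IsC1Curve (A : Set (ℝ × ℝ × ℝ)) : Prop :=
  ∃ (I : Set ℝ) (c : ℝ → ℝ × ℝ × ℝ),
    I.OrdConnected ∧ I.Nonempty ∧ ContDiffOn ℝ 1 c I ∧ A = c '' I

/-- Membership in the class `Υ(f, h)`. -/
structure MemUpsilon (f h : ℝ → ℝ) (u : ℝ → ℝ → ℝ) : Prop where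
  initial : ∀ x, u x 0 = h x
  surface : graphOf u ⊆ boundingSurface f h
  boundary : ∃ 𝒞 : Set (Set (ℝ × ℝ × ℝ)), 𝒞.Finite ∧
    (∀ A ∈ 𝒞, IsC1Curve A ∧
      ∀ t₀ : ℝ, ((fun p : ℝ × ℝ × ℝ => (p.1, p.2.1)) '' A ∩ {q | q.2 = t₀}).Finite) ∧
    graphBoundary f h u = ⋃₀ 𝒞
  integrable : ∀ t, 0 ≤ t → Integrable (fun x => u x t)
  continuous_integral : ContinuousOn (fun t => ∫ x, u x t) (Ici 0)

/-! ### The integral conservation law, shocks -/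

/-- `d/dt ∫_a^b u(x,t) dx = f(u(a,t)) - f(u(b,t))` for all `a < b` and `t > 0` such that `u` is
continuous at `(a,t)` and at `(b,t)`. -/
structure SolvesIntegralLaw (f : ℝ → ℝ) (u : ℝ → ℝ → ℝ) : Prop where
  intervalIntegrable : ∀ t, 0 < t → ∀ a b, IntervalIntegrable (fun x => u x t) volume a b
  hasDerivAt : ∀ a b t, a < b → 0 < t →
    ContinuousAt (fun p : ℝ × ℝ => u p.1 p.2) (a, t) →
    ContinuousAt (fun p : ℝ × ℝ => u p.1 p.2) (b, t) →
    HasDerivAt (fun τ => ∫ x in a..b, u x τ) (f (u a t) - f (u b t)) t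

/-- At every shock `u` jumps upwards: `u⁻ < u⁺`. -/
def JumpsUpward (u : ℝ → ℝ → ℝ) : Prop :=
  ∀ x t l r, 0 < t → Tendsto (fun z => u z t) (𝓝[<] x) (𝓝 l) →
    Tendsto (fun z => u z t) (𝓝[>] x) (𝓝 r) → l ≠ r → l < r

/-- The set of all `(x, t)`, `t > 0`, at which `u(·, t)` is discontinuous. -/
def shockSet (u : ℝ → ℝ → ℝ) : Set (ℝ × ℝ) :=
  {q | 0 < q.2 ∧ ¬ ContinuousAt (fun z => u z q.2) q.1}

/-- `u` has only finitely many shocks: the discontinuities of `u` form finitely many pairwise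
disjoint continuous shock paths `x = s(t)`, each over an interval of times. -/
def FinitelyManyShocks (u : ℝ → ℝ → ℝ) : Prop :=
  ∃ (n : ℕ) (I : Fin n → Set ℝ) (s : Fin n → ℝ → ℝ),
    (∀ i, (I i).OrdConnected ∧ ContinuousOn (s i) (I i)) ∧
    Pairwise (fun i j => Disjoint ((fun t => (s i t, t)) '' I i) ((fun t => (s j t, t)) '' I j)) ∧
    shockSet u = ⋃ i, (fun t => (s i t, t)) '' I i

/-! ### The equal-area method -/

/-- `s ↦ (X s, Y s)` runs once through the completed graph of `h`, from left to right,
continuously and piecewise `C¹`. -/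
structure IsParametrization (h X Y : ℝ → ℝ) : Prop where
  continuous_fst : Continuous X
  continuous_snd : Continuous Y
  piecewise_fst : PiecewiseC1 X
  piecewise_snd : PiecewiseC1 Y
  monotone_fst : Monotone X
  injective : Function.Injective fun s => (X s, Y s)
  range_eq : (range fun s => (X s, Y s)) = completedGraph h

/-- The signed area (by Green's formula) enclosed by the arc `s ↦ (x s, y s)`, `a ≤ s ≤ b`, closed
by the line segment from its end point to its initial point. -/
def signedArea (x y : ℝ → ℝ) (a b : ℝ) : ℝ :=
  (1 / 2) * (∫ s in a..b, (x s * deriv y s - y s * deriv x s)) +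
    (1 / 2) * (x b * y a - x a * y b)

/-- `C` is a finite system of vertical cuts of the curve `s ↦ (x s, y s)` by the equal-area
principle.  A pair `(a, b) ∈ C` stands for the cut along the vertical line through the curve
points with parameters `a < b`; the arc over `(a, b)` is removed.  Lobes to the right of that line
count positively in `signedArea`, lobes to the left negatively. -/
structure IsEqualAreaCut (x y : ℝ → ℝ) (C : Finset (ℝ × ℝ)) : Prop where
  lt : ∀ p ∈ C, p.1 < p.2
  disjoint : ∀ p ∈ C, ∀ q ∈ C, p ≠ q → Disjoint (Icc p.1 p.2) (Icc q.1 q.2)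
  /-- the cuts are vertical -/
  vertical : ∀ p ∈ C, x p.1 = x p.2
  /-- the lobes cut off on the two sides of the line have equal areas -/
  equal_area : ∀ p ∈ C, signedArea x y p.1 p.2 = 0
  /-- as in an `S`-curve, left lobes compensate right lobes that precede them: whenever the removed
  arc meets the line, the right lobes so far have at least the area of the left lobes so far -/
  right_first : ∀ p ∈ C, ∀ s ∈ Icc p.1 p.2, x s = x p.1 → 0 ≤ signedArea x y p.1 s
  /-- what remains is the graph of a function, except for the two end points of every cut -/
  graph : ∀ s s', s < s' → (∀ p ∈ C, s ∉ Ioo p.1 p.2) → (∀ p ∈ C, s' ∉ Ioo p.1 p.2) →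
    (s, s') ∉ C → x s < x s'

/-- The function `w` is obtained by the equal-area method from the curve `γ_t`: its graph consists
of points of `γ_t` that are not removed by the cuts (at a cut, `w` takes the value at one of the two
end points). -/
def IsEqualAreaProfile (f h : ℝ → ℝ) (t : ℝ) (w : ℝ → ℝ) : Prop :=
  ∃ (X Y : ℝ → ℝ) (C : Finset (ℝ × ℝ)), IsParametrization h X Y ∧
    IsEqualAreaCut (fun s => X s + deriv f (Y s) * t) Y C ∧
    ∀ z, ∃ s, (∀ p ∈ C, s ∉ Ioo p.1 p.2) ∧ X s + deriv f (Y s) * t = z ∧ Y s = w z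

/-- `u` is obtained by the equal-area method: it starts from `h`, and for every `t > 0` the
function `u(·, t)` results from equal-area cuts of `γ_t`. -/
structure IsEqualAreaSolution (f h : ℝ → ℝ) (u : ℝ → ℝ → ℝ) : Prop where
  initial : ∀ x, u x 0 = h x
  profile : ∀ t, 0 < t → IsEqualAreaProfile f h t fun x => u x t

end EqualArea

end

/-! The solution has a variational description. For a bound `K` of the data, `lag f K w t` is the
minimum over `|y| ≤ K` of `y w - t (f y - f 0)`, and the Hopf–Lax function `U(z, t) = max_X
(∫_{-∞}^X h + lag(z - X, t))` is a potential of the solution: where the maximizing foot `X` is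
unique, `U` is differentiable with `U_x = u` and `U_t = -(f(u) - f(0))`, `u` being the minimizing
slope of the optimal path (`hasFDerivAt_hopfLax`). The first-order conditions say that optimal paths
are characteristics that issue from the completed graph of `h`. They do not cross (`isOpt_mono`),
and an optimal path is the only optimal one at its earlier points (`isOpt_unique_of_lt`).

Equal areas: by Green's formula (`signedArea_eq`) the signed area of an arc of `γ_t` with both ends
on a vertical line is the difference of the values transported along the characteristics of its
ends. So an equal-area cut joins two equally good competitors, and the condition on preceding right
lobes says that no point of the arc on the line is better. Hence whatever equal-area cuts leave over
is optimal (`alive_of_remaining`); conversely, cutting from the first to the last optimal parameter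
over each point is an equal-area construction (`Folding.isEqualAreaCut`), with finitely many cuts by
Rolle's theorem. The integral law is the time derivative of `U(b, t) - U(a, t)`, and jumps go
upwards because optimal feet increase with the end point.

Uniqueness: let `V(x, τ)` be the integral of `v(·, τ)` over `(-∞, x]` and consider `τ ↦ max_x (V(x,
τ) + lag(z - x, T - τ))`. A maximizer cannot sit at an upward jump, so it lies on one of the
finitely many characteristics through `(z, T)`. For almost every `z` all of these meet points of
continuity of `v` at almost all times, and there the derivative of the maximum vanishes. The maximum
is Lipschitz in `τ`, hence constant; it is `U(z, T)` at `τ = 0` and `V(z, T)` at `τ = T`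
(`primitive_eq_hopfLax`).

The class `Υ`: at positive times the boundary of the graph consists of the points at which a
characteristic is absorbed. If there are finitely many shocks, then shocks start, and three or more
characteristics meet, at finitely many times only, and finitely many characteristics end at each
time (`finite_dies`). All others are absorbed in pairs, and comparing the expansions of `U` from the
two sides makes the time of absorption a `C¹` function of the parameter (`contDiffOn_deathTime`). At
time zero the boundary is, up to finitely many points, made of the vertical segments at the downward
jumps of `h`. -/

namespace EqualArea
open Function

/-! ### Piecewise `C¹` data and the primitive of `h` -/

namespace PiecewiseC1

variable {h : ℝ → ℝ}

theorem exists_tendsto (hh : PiecewiseC1 h) (x : ℝ) :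
    (∃ l, Tendsto h (𝓝[<] x) (𝓝 l)) ∧ (∃ r, Tendsto h (𝓝[>] x) (𝓝 r)) ∧
      (∃ l, Tendsto (deriv h) (𝓝[<] x) (𝓝 l)) ∧ (∃ r, Tendsto (deriv h) (𝓝[>] x) (𝓝 r)) := by
  obtain ⟨S, hS, hS'⟩ := hh
  by_cases hx : x ∈ S
  · exact hS' x hx
  · have hc := hS x hx
    have h1 : ContinuousAt h x := hc.continuousAt
    have h2 : ContinuousAt (deriv h) x := by
      obtain ⟨u, hu, hcu⟩ := hc.contDiffOn (m := 1) le_rfl (by simp)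
      obtain ⟨v, hvu, hvo, hxv⟩ := mem_nhds_iff.1 hu
      exact ((hcu.mono hvu).continuousOn_deriv_of_isOpen hvo le_rfl).continuousAt
        (hvo.mem_nhds hxv)
    exact ⟨⟨_, h1.tendsto.mono_left nhdsWithin_le_nhds⟩, ⟨_, h1.tendsto.mono_left nhdsWithin_le_nhds⟩,
      ⟨_, h2.tendsto.mono_left nhdsWithin_le_nhds⟩, ⟨_, h2.tendsto.mono_left nhdsWithin_le_nhds⟩⟩

theorem tendsto_leftLim (hh : PiecewiseC1 h) (x : ℝ) :
    Tendsto h (𝓝[<] x) (𝓝 (leftLim h x)) := by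
  obtain ⟨l, hl⟩ := (hh.exists_tendsto x).1
  rwa [leftLim_eq_of_tendsto hl]

theorem tendsto_rightLim (hh : PiecewiseC1 h) (x : ℝ) :
    Tendsto h (𝓝[>] x) (𝓝 (rightLim h x)) := by
  obtain ⟨l, hl⟩ := (hh.exists_tendsto x).2.1
  rwa [rightLim_eq_of_tendsto hl]

theorem measurable_of_finite {S : Finset ℝ} (hS : ∀ x, x ∉ S → ContinuousAt h x) :
    Measurable h := by
  refine measurable_of_isOpen fun U hU => ?_
  have hc : ContinuousOn h (↑S : Set ℝ)ᶜ := fun x hx => (hS x (by simpa using hx)).continuousWithinAt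
  have h1 := hc.isOpen_inter_preimage S.finite_toSet.isClosed.isOpen_compl hU
  have : h ⁻¹' U = ((↑S : Set ℝ)ᶜ ∩ h ⁻¹' U) ∪ (↑S ∩ h ⁻¹' U) := by
    rw [← union_inter_distrib_right, compl_union_self, univ_inter]
  rw [this]
  exact h1.measurableSet.union (S.finite_toSet.inter_of_left _).measurableSet

theorem measurable (hh : PiecewiseC1 h) : Measurable h := by
  obtain ⟨S, hS, -⟩ := hh
  exact measurable_of_finite fun x hx => (hS x hx).continuousAt

theorem eventually_bound {g : ℝ → ℝ} {x : ℝ} (hl : ∃ l, Tendsto g (𝓝[<] x) (𝓝 l))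
    (hr : ∃ r, Tendsto g (𝓝[>] x) (𝓝 r)) : ∃ C, ∀ᶠ z in 𝓝 x, |g z| ≤ C := by
  obtain ⟨l, hl⟩ := hl
  obtain ⟨r, hr⟩ := hr
  refine ⟨max (max (|l| + 1) (|r| + 1)) |g x|, ?_⟩
  have h1 : ∀ᶠ z in 𝓝[<] x, |g z| ≤ |l| + 1 :=
    (hl.abs.eventually (gt_mem_nhds (lt_add_one _))).mono fun z hz => le_of_lt hz
  have h2 : ∀ᶠ z in 𝓝[>] x, |g z| ≤ |r| + 1 :=
    (hr.abs.eventually (gt_mem_nhds (lt_add_one _))).mono fun z hz => le_of_lt hz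
  rw [eventually_nhdsWithin_iff] at h1 h2
  filter_upwards [h1, h2] with z hz1 hz2
  rcases lt_trichotomy z x with h | h | h
  · exact (hz1 h).trans ((le_max_left _ _).trans (le_max_left _ _))
  · rw [h]; exact le_max_right _ _
  · exact (hz2 h).trans ((le_max_right _ _).trans (le_max_left _ _))

theorem bounded_on_compact {g : ℝ → ℝ} (hg : ∀ x, ∃ C, ∀ᶠ z in 𝓝 x, |g z| ≤ C) {s : Set ℝ}
    (hs : IsCompact s) : ∃ C, ∀ z ∈ s, |g z| ≤ C := by
  refine hs.induction_on (p := fun s => ∃ C, ∀ z ∈ s, |g z| ≤ C) ⟨0, by simp⟩ ?_ ?_ ?_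
  · rintro s t hst ⟨C, hC⟩
    exact ⟨C, fun z hz => hC z (hst hz)⟩
  · rintro s t ⟨C, hC⟩ ⟨D, hD⟩
    refine ⟨max C D, fun z hz => ?_⟩
    rcases hz with hz | hz
    · exact (hC z hz).trans (le_max_left _ _)
    · exact (hD z hz).trans (le_max_right _ _)
  · intro x _
    obtain ⟨C, hC⟩ := hg x
    exact ⟨{z | |g z| ≤ C}, mem_nhdsWithin_of_mem_nhds hC, C, fun z hz => hz⟩

theorem bounded (hh : PiecewiseC1 h) (hs : HasCompactSupport h) : ∃ C, ∀ z, |h z| ≤ C := by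
  obtain ⟨C, hC⟩ := bounded_on_compact
    (fun x => eventually_bound (hh.exists_tendsto x).1 (hh.exists_tendsto x).2.1) hs
  refine ⟨max C 0, fun z => ?_⟩
  by_cases hz : z ∈ tsupport h
  · exact (hC z hz).trans (le_max_left _ _)
  · simp [image_eq_zero_of_notMem_tsupport hz]

theorem intervalIntegrable_deriv (hh : PiecewiseC1 h) (a b : ℝ) :
    IntervalIntegrable (deriv h) volume a b := by
  obtain ⟨C, hC⟩ := bounded_on_compact (fun x => eventually_bound (hh.exists_tendsto x).2.2.1
    (hh.exists_tendsto x).2.2.2) (isCompact_uIcc (a := a) (b := b))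
  refine (intervalIntegrable_const (c := C)).mono_fun (measurable_deriv h).aestronglyMeasurable ?_
  refine (ae_restrict_iff' measurableSet_uIoc).2 (Eventually.of_forall fun x hx => ?_)
  exact (hC x (uIoc_subset_uIcc hx)).trans (le_abs_self C)

end PiecewiseC1

/-- The standing assumptions, together with a bound `K` for `h`. -/
structure Admissible (f h : ℝ → ℝ) (K : ℝ) : Prop where
  smooth : ContDiff ℝ 2 f
  concave : StrictConcaveOn ℝ univ f
  piecewise : PiecewiseC1 h
  support : HasCompactSupport h
  -- The margin 1 keeps the values on the initial curve strictly inside `[-K, K]`, so that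
  -- minimizers on the curve are interior; it also gives `1 ≤ K`, which makes the action coercive.
  bound : ∀ x, |h x| ≤ K - 1

/-- `x ↦ ∫_{-∞}^x h`. -/
noncomputable def primitive (h : ℝ → ℝ) (x : ℝ) : ℝ := ∫ y in Iic x, h y

theorem exists_admissible {f h : ℝ → ℝ} (hf : ContDiff ℝ 2 f) (hc : StrictConcaveOn ℝ univ f)
    (hh : PiecewiseC1 h) (hs : HasCompactSupport h) : ∃ K, Admissible f h K := by
  obtain ⟨C, hC⟩ := hh.bounded hs
  exact ⟨C + 1, hf, hc, hh, hs, by simpa using hC⟩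

namespace Admissible

variable {f h : ℝ → ℝ} {K : ℝ}

theorem one_le (H : Admissible f h K) : 1 ≤ K := by
  have := (abs_nonneg _).trans (H.bound 0); linarith

theorem abs_leftLim_le (H : Admissible f h K) (x : ℝ) : |leftLim h x| ≤ K - 1 :=
  le_of_tendsto (H.piecewise.tendsto_leftLim x).abs (Eventually.of_forall H.bound)

theorem abs_rightLim_le (H : Admissible f h K) (x : ℝ) : |rightLim h x| ≤ K - 1 :=
  le_of_tendsto (H.piecewise.tendsto_rightLim x).abs (Eventually.of_forall H.bound)

theorem abs_le_of_mem (H : Admissible f h K) {p : ℝ × ℝ} (hp : p ∈ completedGraph h) :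
    |p.2| ≤ K - 1 := by
  have h1 := H.abs_leftLim_le p.1
  have h2 := H.abs_rightLim_le p.1
  rw [abs_le] at *
  have := uIcc_subset_Icc (mem_Icc.2 h1) (mem_Icc.2 h2) hp
  exact this

theorem abs_le_of_mem_initialCurve (H : Admissible f h K) {p : ℝ × ℝ} (hp : p ∈ initialCurve h) :
    |p.2| ≤ K - 1 := by
  rcases hp with hp | hp
  · have : p.2 = h p.1 := hp
    rw [this]; exact H.bound _
  · exact H.abs_le_of_mem hp

theorem differentiable (H : Admissible f h K) : Differentiable ℝ f :=
  H.smooth.differentiable (by norm_num)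

theorem hasDerivAt (H : Admissible f h K) (x : ℝ) : HasDerivAt f (deriv f x) x :=
  (H.differentiable x).hasDerivAt

theorem continuous (H : Admissible f h K) : Continuous f := H.smooth.continuous

theorem contDiff_deriv (H : Admissible f h K) : ContDiff ℝ 1 (deriv f) := by
  have := H.smooth
  rw [show (2 : WithTop ℕ∞) = 1 + 1 by norm_num, contDiff_succ_iff_deriv] at this
  exact this.2.2

theorem continuous_deriv (H : Admissible f h K) : Continuous (deriv f) :=
  H.contDiff_deriv.continuous

theorem strictAnti_deriv (H : Admissible f h K) : StrictAnti (deriv f) := by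
  have := H.concave.strictAntiOn_deriv fun x _ => H.differentiable x
  exact fun x y hxy => this (mem_univ _) (mem_univ _) hxy

theorem deriv_injective (H : Admissible f h K) : Injective (deriv f) := H.strictAnti_deriv.injective

/-- The graph of `f` lies strictly below its tangents. -/
theorem lt_tangent (H : Admissible f h K) {x y : ℝ} (hxy : y ≠ x) :
    f y < f x + deriv f x * (y - x) := by
  rcases lt_or_gt_of_ne hxy with h | h
  · have := H.concave.deriv_lt_slope (mem_univ y) (mem_univ x) h (H.differentiable x)
    rw [slope_def_field, lt_div_iff₀ (by linarith)] at this
    linarith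
  · have := H.concave.slope_lt_deriv (mem_univ x) (mem_univ y) h (H.differentiable x)
    rw [slope_def_field, div_lt_iff₀ (by linarith)] at this
    linarith

theorem le_tangent (H : Admissible f h K) (x y : ℝ) : f y ≤ f x + deriv f x * (y - x) := by
  rcases eq_or_ne y x with rfl | h
  · simp
  · exact (H.lt_tangent h).le

theorem integrable (H : Admissible f h K) : Integrable h := by
  refine (integrableOn_iff_integrable_of_support_subset (subset_tsupport h)).1 ?_
  refine Measure.integrableOn_of_bounded (M := K - 1) H.support.isCompact.measure_lt_top.ne
    H.piecewise.measurable.aestronglyMeasurable (Eventually.of_forall fun x => H.bound x)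

theorem primitive_sub (H : Admissible f h K) (x y : ℝ) :
    primitive h y - primitive h x = ∫ z in x..y, h z :=
  intervalIntegral.integral_Iic_sub_Iic H.integrable.integrableOn H.integrable.integrableOn

theorem abs_primitive_sub_le (H : Admissible f h K) (x y : ℝ) :
    |primitive h y - primitive h x| ≤ (K - 1) * |y - x| := by
  rw [H.primitive_sub]
  exact intervalIntegral.norm_integral_le_of_norm_le_const (f := h) (C := K - 1) fun z _ => H.bound z

theorem lipschitz_primitive (H : Admissible f h K) :
    LipschitzWith (K - 1).toNNReal (primitive h) := by
  refine LipschitzWith.of_dist_le_mul fun x y => ?_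
  rw [Real.dist_eq, Real.dist_eq, Real.coe_toNNReal _ (by linarith [H.one_le])]
  exact H.abs_primitive_sub_le y x

theorem continuous_primitive (H : Admissible f h K) : Continuous (primitive h) :=
  H.lipschitz_primitive.continuous

theorem primitive_eq (H : Admissible f h K) (c : ℝ) :
    primitive h = fun y => primitive h c + ∫ z in c..y, h z := by
  funext y; rw [← H.primitive_sub]; ring

theorem hasDerivWithinAt_primitive_right (H : Admissible f h K) (x : ℝ) :
    HasDerivWithinAt (primitive h) (rightLim h x) (Ici x) x := by
  rw [H.primitive_eq x]
  refine HasDerivWithinAt.const_add _ ?_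
  refine intervalIntegral.integral_hasDerivWithinAt_of_tendsto_ae_right (t := Ioi x)
    H.integrable.intervalIntegrable
    (H.piecewise.measurable.stronglyMeasurable.stronglyMeasurableAtFilter) ?_
  exact (H.piecewise.tendsto_rightLim x).mono_left inf_le_left

theorem hasDerivWithinAt_primitive_left (H : Admissible f h K) (x : ℝ) :
    HasDerivWithinAt (primitive h) (leftLim h x) (Iic x) x := by
  rw [H.primitive_eq x]
  refine HasDerivWithinAt.const_add _ ?_
  refine intervalIntegral.integral_hasDerivWithinAt_of_tendsto_ae_right (t := Iic x)
    H.integrable.intervalIntegrable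
    (H.piecewise.measurable.stronglyMeasurable.stronglyMeasurableAtFilter) ?_
  refine (H.piecewise.tendsto_leftLim x).mono_left ?_
  -- The fundamental theorem on `Iic x` needs the limit along `𝓝[≤] x ⊓ ae volume`; discarding the
  -- null set `{x}` leaves `𝓝[<] x`.
  have : ae (volume : Measure ℝ) ≤ 𝓟 {x}ᶜ := by
    rw [le_principal_iff, mem_ae_iff, compl_compl]; simp
  calc 𝓝[≤] x ⊓ ae volume ≤ 𝓝[≤] x ⊓ 𝓟 {x}ᶜ := inf_le_inf_left _ this
    _ = 𝓝[<] x := by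
      rw [nhdsWithin, inf_assoc, inf_principal, nhdsWithin]
      congr 2
      ext z; simp [lt_iff_le_and_ne]

theorem exists_support (H : Admissible f h K) : ∃ R, 0 < R ∧ ∀ x, R ≤ |x| → h x = 0 := by
  obtain ⟨R, hR⟩ := H.support.isCompact.isBounded.subset_ball_lt 0 0
  refine ⟨R, hR.1, fun x hx => image_eq_zero_of_notMem_tsupport fun hx' => ?_⟩
  have := hR.2 hx'
  rw [mem_ball_zero_iff, Real.norm_eq_abs] at this
  linarith

theorem leftLim_eq_of_continuousAt {x : ℝ} (hx : ContinuousAt h x) : leftLim h x = h x :=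
  leftLim_eq_of_tendsto (hx.tendsto.mono_left nhdsWithin_le_nhds)

theorem rightLim_eq_of_continuousAt {x : ℝ} (hx : ContinuousAt h x) : rightLim h x = h x :=
  rightLim_eq_of_tendsto (hx.tendsto.mono_left nhdsWithin_le_nhds)

theorem snd_eq_of_continuousAt {p : ℝ × ℝ} (hp : p ∈ completedGraph h)
    (hc : ContinuousAt h p.1) : p.2 = h p.1 := by
  have : p.2 ∈ uIcc (leftLim h p.1) (rightLim h p.1) := hp
  rw [leftLim_eq_of_continuousAt hc, rightLim_eq_of_continuousAt hc, uIcc_self] at this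
  exact this

theorem hasDerivAt_primitive (H : Admissible f h K) {x : ℝ} (hx : ContinuousAt h x) :
    HasDerivAt (primitive h) (h x) x := by
  have h1 := H.hasDerivWithinAt_primitive_left x
  have h2 := H.hasDerivWithinAt_primitive_right x
  rw [leftLim_eq_of_continuousAt hx] at h1
  rw [rightLim_eq_of_continuousAt hx] at h2
  have := h1.union h2
  rwa [Iic_union_Ici, hasDerivWithinAt_univ] at this

/-- Outside some interval the completed graph is the axis, and the primitive is constant. -/
theorem exists_far (H : Admissible f h K) : ∃ R, 0 < R ∧
    (∀ p ∈ initialCurve h, R < |p.1| → p.2 = 0) ∧ (∀ x, x ≤ -R → primitive h x = 0) ∧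
      (∀ x, R ≤ x → primitive h x = ∫ y, h y) := by
  obtain ⟨R, hR, hz⟩ := H.exists_support
  refine ⟨R, hR, fun p hp hpR => ?_, fun x hx => ?_, fun x hx => ?_⟩
  · have hev : h =ᶠ[𝓝 p.1] fun _ => 0 := by
      filter_upwards [(isOpen_lt continuous_const continuous_abs).mem_nhds hpR] with z hz'
      exact hz z (le_of_lt hz')
    have hc : ContinuousAt h p.1 := continuousAt_const.congr hev.symm
    rcases hp with hp | hp
    · have : p.2 = h p.1 := hp
      rw [this, hz _ hpR.le]
    · rw [snd_eq_of_continuousAt hp hc, hz _ hpR.le]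
  · refine setIntegral_eq_zero_of_forall_eq_zero fun y hy => hz y ?_
    have : y ≤ x := hy
    rw [abs_of_neg (by linarith)]; linarith
  · refine setIntegral_eq_integral_of_forall_compl_eq_zero fun y hy => hz y ?_
    have : x < y := by simpa using hy
    rw [abs_of_pos (by linarith)]; linarith

theorem abs_primitive_le (H : Admissible f h K) (x : ℝ) : |primitive h x| ≤ ∫ y, |h y| := by
  refine (abs_integral_le_integral_abs).trans ?_
  exact setIntegral_le_integral H.integrable.abs (Eventually.of_forall fun _ => abs_nonneg _)

end Admissible

attribute [irreducible] primitive

end EqualArea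

/-! ### The Lagrangian and its minimizing slope -/

namespace EqualArea
open Function

/-- Increments squeezed between linear expressions with convergent slopes are approximately
linear. -/
theorem isLittleO_of_sandwich {α : Type*} {l : Filter α} {F a b y₁ y₂ : α → ℝ} {φ : ℝ → ℝ} {y : ℝ}
    (hφ : ContinuousAt φ y) (h₁ : Tendsto y₁ l (𝓝 y)) (h₂ : Tendsto y₂ l (𝓝 y))
    (hu : ∀ᶠ i in l, F i ≤ y₁ i * a i - φ (y₁ i) * b i)
    (hl : ∀ᶠ i in l, y₂ i * a i - φ (y₂ i) * b i ≤ F i) :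
    (fun i => F i - (y * a i - φ y * b i)) =o[l] fun i => (a i, b i) := by
  rw [Asymptotics.isLittleO_iff]
  intro c hc
  have hc4 : 0 < c / 2 := by positivity
  have e₁ := (Metric.tendsto_nhds.1 h₁) _ hc4
  have e₂ := (Metric.tendsto_nhds.1 h₂) _ hc4
  have e₃ := (Metric.tendsto_nhds.1 (hφ.tendsto.comp h₁)) _ hc4
  have e₄ := (Metric.tendsto_nhds.1 (hφ.tendsto.comp h₂)) _ hc4
  filter_upwards [hu, hl, e₁, e₂, e₃, e₄] with i hu hl e₁ e₂ e₃ e₄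
  simp only [Real.dist_eq, comp_apply] at e₁ e₂ e₃ e₄
  have n1 : |a i| ≤ ‖(a i, b i)‖ := norm_fst_le (a i, b i)
  have n2 : |b i| ≤ ‖(a i, b i)‖ := norm_snd_le (a i, b i)
  have key : ∀ Y Z : ℝ, |Y| < c / 2 → |Z| < c / 2 → |Y * a i - Z * b i| ≤ c * ‖(a i, b i)‖ := by
    intro Y Z hY hZ
    calc |Y * a i - Z * b i| ≤ |Y * a i| + |Z * b i| := abs_sub _ _
      _ = |Y| * |a i| + |Z| * |b i| := by rw [abs_mul, abs_mul]
      _ ≤ c / 2 * ‖(a i, b i)‖ + c / 2 * ‖(a i, b i)‖ := by gcongr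
      _ = c * ‖(a i, b i)‖ := by ring
  have k1 := abs_le.1 (key _ _ e₁ e₃)
  have k2 := abs_le.1 (key _ _ e₂ e₄)
  rw [Real.norm_eq_abs, abs_le]
  constructor
  · linarith [k2.1]
  · linarith [k1.2]

/-- A function of two variables squeezed between linear functions with convergent slopes is
differentiable. -/
theorem hasFDerivAt_of_sandwich {F : ℝ × ℝ → ℝ} {φ : ℝ → ℝ} {p : ℝ × ℝ} {y : ℝ}
    {y₁ y₂ : ℝ × ℝ → ℝ} (hφ : ContinuousAt φ y) (h₁ : Tendsto y₁ (𝓝 p) (𝓝 y))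
    (h₂ : Tendsto y₂ (𝓝 p) (𝓝 y))
    (hu : ∀ᶠ q in 𝓝 p, F q - F p ≤ y₁ q * (q.1 - p.1) - φ (y₁ q) * (q.2 - p.2))
    (hl : ∀ᶠ q in 𝓝 p, y₂ q * (q.1 - p.1) - φ (y₂ q) * (q.2 - p.2) ≤ F q - F p) :
    HasFDerivAt F (y • ContinuousLinearMap.fst ℝ ℝ ℝ - φ y • ContinuousLinearMap.snd ℝ ℝ ℝ) p := by
  rw [hasFDerivAt_iff_isLittleO]
  exact isLittleO_of_sandwich hφ h₁ h₂ hu hl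

/-- A bounded real function on a filter has a convergent restriction. -/
theorem exists_tendsto_of_bounded {α : Type*} {l : Filter α} [l.NeBot] {u : α → ℝ} {R : ℝ}
    (hb : ∀ᶠ a in l, |u a| ≤ R) :
    ∃ g ≤ l, g.NeBot ∧ ∃ y, |y| ≤ R ∧ Tendsto u g (𝓝 y) := by
  obtain ⟨y, hy, hcl⟩ := (isCompact_Icc (a := -R) (b := R)) (f := map u l)
    (by rw [le_principal_iff]; exact hb.mono fun a ha => abs_le.1 ha)
  refine ⟨l ⊓ comap u (𝓝 y), inf_le_left, ?_, y, abs_le.2 hy,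
    (tendsto_comap.mono_left inf_le_right)⟩
  rw [← map_neBot_iff (f := u), Filter.push_pull, inf_comm]
  exact hcl

/-- A bounded real function converges if it has only one limit along finer filters. -/
theorem tendsto_of_unique_limit {α : Type*} {l : Filter α} {u : α → ℝ} {R y : ℝ}
    (hb : ∀ᶠ a in l, |u a| ≤ R)
    (h : ∀ g ≤ l, g.NeBot → ∀ y', |y'| ≤ R → Tendsto u g (𝓝 y') → y' = y) :
    Tendsto u l (𝓝 y) := by
  rw [tendsto_iff_forall_eventually_mem]
  intro s hs
  by_contra hcon
  have : (l ⊓ 𝓟 {a | u a ∉ s}).NeBot := by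
    exact frequently_mem_iff_neBot.1 (not_eventually.1 hcon)
  obtain ⟨g, hg, hne, y', hy', hlim⟩ := exists_tendsto_of_bounded
    (hb.filter_mono (inf_le_left : l ⊓ 𝓟 {a | u a ∉ s} ≤ l))
  obtain rfl := h g (hg.trans inf_le_left) hne y' hy' hlim
  have h1 : ∀ᶠ a in g, u a ∈ s := hlim hs
  have h2 : ∀ᶠ a in g, u a ∉ s := le_principal_iff.1 (hg.trans inf_le_right)
  obtain ⟨a, ha, ha'⟩ := (h1.and h2).exists
  exact ha' ha

/-- The Lagrangian `min_{|y| ≤ K} (y w - t (f y - f 0))`. -/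
noncomputable def lag (f : ℝ → ℝ) (K w t : ℝ) : ℝ :=
  sInf ((fun y => y * w - t * (f y - f 0)) '' Icc (-K) K)

/-- A minimizer in the definition of the Lagrangian. -/
noncomputable def slopeOf (f : ℝ → ℝ) (K w t : ℝ) : ℝ :=
  Classical.epsilon fun y => y ∈ Icc (-K) K ∧ lag f K w t = y * w - t * (f y - f 0)

namespace Admissible

variable {f h : ℝ → ℝ} {K : ℝ}

theorem slopeOf_spec (H : Admissible f h K) (w t : ℝ) :
    slopeOf f K w t ∈ Icc (-K) K ∧
      lag f K w t = slopeOf f K w t * w - t * (f (slopeOf f K w t) - f 0) := by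
  have hc : ContinuousOn (fun y => y * w - t * (f y - f 0)) (Icc (-K) K) := by
    have := H.continuous
    fun_prop
  have hne : (Icc (-K) K).Nonempty := nonempty_Icc.2 (by linarith [H.one_le])
  obtain ⟨y, hy, hmin, -⟩ := isCompact_Icc.exists_sInf_image_eq_and_le hne hc
  exact Classical.epsilon_spec
    (p := fun y => y ∈ Icc (-K) K ∧ lag f K w t = y * w - t * (f y - f 0)) ⟨y, hy, hmin⟩

theorem slopeOf_mem (H : Admissible f h K) (w t : ℝ) : slopeOf f K w t ∈ Icc (-K) K :=
  (H.slopeOf_spec w t).1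

theorem lag_eq (H : Admissible f h K) (w t : ℝ) :
    lag f K w t = slopeOf f K w t * w - t * (f (slopeOf f K w t) - f 0) :=
  (H.slopeOf_spec w t).2

theorem lag_le (H : Admissible f h K) (w t : ℝ) {y : ℝ} (hy : y ∈ Icc (-K) K) :
    lag f K w t ≤ y * w - t * (f y - f 0) := by
  have hc : ContinuousOn (fun y => y * w - t * (f y - f 0)) (Icc (-K) K) := by
    have := H.continuous
    fun_prop
  exact csInf_le (isCompact_Icc.image_of_continuousOn hc).bddBelow ⟨y, hy, rfl⟩

/-- For `t > 0` the minimized function is strictly convex in `y`: at the midpoint of two distinct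
minimizers the tangent inequality would produce a smaller value. -/
theorem eq_slopeOf (H : Admissible f h K) {w t y : ℝ} (ht : 0 < t) (hy : y ∈ Icc (-K) K)
    (hle : y * w - t * (f y - f 0) ≤ lag f K w t) : y = slopeOf f K w t := by
  by_contra hne
  set y' := slopeOf f K w t
  have hy' := H.slopeOf_mem w t
  have hm : (1 / 2 : ℝ) * y + (1 / 2) * y' ∈ Icc (-K) K := by
    constructor <;> linarith [hy.1, hy.2, hy'.1, hy'.2]
  have h1 := H.lag_le w t hm
  have h2 := H.lt_tangent (x := (1 / 2 : ℝ) * y + (1 / 2) * y') (y := y)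
    (fun h => hne (by linarith))
  have h2' := H.lt_tangent (x := (1 / 2 : ℝ) * y + (1 / 2) * y') (y := y')
    (fun h => hne (by linarith))
  have h4 := mul_lt_mul_of_pos_left (add_lt_add h2 h2') ht
  have h3 := H.lag_eq w t
  change lag f K w t = y' * w - t * (f y' - f 0) at h3
  nlinarith

/-- On a characteristic, `w = f'(y) t`, the tangent inequality at `y` says that `y` itself is the
minimizer. -/
theorem lag_char (H : Admissible f h K) {t y : ℝ} (ht : 0 ≤ t) (hy : y ∈ Icc (-K) K) :
    lag f K (deriv f y * t) t = t * (y * deriv f y - (f y - f 0)) := by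
  refine le_antisymm ((H.lag_le _ t hy).trans (by linarith)) ?_
  rw [H.lag_eq]
  set y' := slopeOf f K (deriv f y * t) t
  have := mul_le_mul_of_nonneg_left (H.le_tangent y y') ht
  linarith

theorem slopeOf_char (H : Admissible f h K) {t y : ℝ} (ht : 0 < t) (hy : y ∈ Icc (-K) K) :
    slopeOf f K (deriv f y * t) t = y := by
  refine (H.eq_slopeOf ht hy ?_).symm
  rw [H.lag_char ht.le hy]; linarith

/-- Stationarity at an interior minimizer. It turns optimal paths back into characteristics. -/
theorem eq_of_abs_slopeOf_lt (H : Admissible f h K) {w t : ℝ} (hs : |slopeOf f K w t| < K) :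
    w = deriv f (slopeOf f K w t) * t := by
  set y := slopeOf f K w t with hy
  have hd : HasDerivAt (fun y => y * w - t * (f y - f 0)) (1 * w - t * deriv f y) y :=
    ((hasDerivAt_id y).mul_const w).sub (((H.hasDerivAt y).sub_const _).const_mul t)
  have hmin : IsLocalMin (fun y => y * w - t * (f y - f 0)) y := by
    have : ∀ᶠ z in 𝓝 y, |z| < K :=
      continuous_abs.continuousAt.eventually (gt_mem_nhds hs)
    filter_upwards [this] with z hz
    have h1 := H.lag_le w t (y := z) (by rw [mem_Icc]; exact abs_le.1 hz.le)
    rwa [H.lag_eq] at h1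
  have := hmin.hasDerivAt_eq_zero hd
  linarith

/-- The minimizer at `(w, t)` is a competitor at `(w', t')`. This supergradient bound, and its
mirror image below, give continuity, differentiability and the non-crossing of paths. -/
theorem lag_sub_le (H : Admissible f h K) (w t w' t' : ℝ) :
    lag f K w' t' - lag f K w t ≤
      slopeOf f K w t * (w' - w) - (f (slopeOf f K w t) - f 0) * (t' - t) := by
  have h1 := H.lag_le w' t' (H.slopeOf_mem w t)
  have h2 := H.lag_eq w t
  linarith

theorem le_lag_sub (H : Admissible f h K) (w t w' t' : ℝ) :
    slopeOf f K w' t' * (w' - w) - (f (slopeOf f K w' t') - f 0) * (t' - t) ≤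
      lag f K w' t' - lag f K w t := by
  have := H.lag_sub_le w' t' w t
  linarith

theorem exists_flux_bound (H : Admissible f h K) :
    ∃ C, 0 ≤ C ∧ (∀ y, |y| ≤ K → |f y - f 0| ≤ C) ∧ ∀ y, |y| ≤ K → |deriv f y| ≤ C := by
  obtain ⟨C, hC⟩ := (isCompact_Icc (a := -K) (b := K)).exists_bound_of_continuousOn
    (f := fun y => f y - f 0) (by have := H.continuous; fun_prop)
  obtain ⟨D, hD⟩ := (isCompact_Icc (a := -K) (b := K)).exists_bound_of_continuousOn
    (f := deriv f) H.continuous_deriv.continuousOn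
  refine ⟨max (max C D) 0, le_max_right _ _, fun y hy => ?_, fun y hy => ?_⟩
  · exact (hC y (abs_le.1 hy)).trans ((le_max_left _ _).trans (le_max_left _ _))
  · exact (hD y (abs_le.1 hy)).trans ((le_max_right _ _).trans (le_max_left _ _))

theorem abs_slopeOf_le (H : Admissible f h K) (w t : ℝ) : |slopeOf f K w t| ≤ K :=
  abs_le.2 (H.slopeOf_mem w t)

theorem abs_lag_sub_le (H : Admissible f h K) {C : ℝ}
    (hC : ∀ y, |y| ≤ K → |f y - f 0| ≤ C) (w t w' t' : ℝ) :
    |lag f K w' t' - lag f K w t| ≤ K * |w' - w| + C * |t' - t| := by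
  have key : ∀ w t w' t' : ℝ, lag f K w' t' - lag f K w t ≤ K * |w' - w| + C * |t' - t| := by
    intro w t w' t'
    refine (H.lag_sub_le w t w' t').trans ?_
    have h1 : slopeOf f K w t * (w' - w) ≤ K * |w' - w| := by
      refine (le_abs_self _).trans ?_
      rw [abs_mul]; gcongr; exact H.abs_slopeOf_le w t
    have h2 : -((f (slopeOf f K w t) - f 0) * (t' - t)) ≤ C * |t' - t| := by
      refine (neg_le_abs _).trans ?_
      rw [abs_mul]; gcongr; exact hC _ (H.abs_slopeOf_le w t)
    linarith
  rw [abs_le]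
  constructor
  · have := key w' t' w t
    rw [abs_sub_comm w, abs_sub_comm t] at this
    linarith
  · exact key w t w' t'

/-- Test with the end point `±K` of sign opposite to `w`. The decay in `w` makes optimal feet exist.
-/
theorem lag_le_neg (H : Admissible f h K) {C : ℝ}
    (hC : ∀ y, |y| ≤ K → |f y - f 0| ≤ C) (w t : ℝ) : lag f K w t ≤ -K * |w| + C * |t| := by
  have hK := H.one_le
  have key : ∀ y, |y| = K → y * w = -K * |w| → lag f K w t ≤ -K * |w| + C * |t| := by
    intro y hy hyw
    refine (H.lag_le w t (y := y) (abs_le.1 hy.le)).trans ?_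
    have : -(t * (f y - f 0)) ≤ C * |t| := by
      refine (neg_le_abs _).trans ?_
      rw [abs_mul, mul_comm]; gcongr; exact hC _ hy.le
    linarith
  rcases le_total 0 w with hw | hw
  · exact key (-K) (by rw [abs_neg, abs_of_pos (by linarith)]) (by rw [abs_of_nonneg hw])
  · exact key K (abs_of_pos (by linarith)) (by rw [abs_of_nonpos hw]; ring)

theorem continuous_lag (H : Admissible f h K) : Continuous fun p : ℝ × ℝ => lag f K p.1 p.2 := by
  obtain ⟨C, hC0, hC, -⟩ := H.exists_flux_bound
  refine continuous_iff_continuousAt.2 fun p => ?_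
  rw [ContinuousAt, tendsto_iff_dist_tendsto_zero]
  refine squeeze_zero (fun _ => dist_nonneg)
    (g := fun q : ℝ × ℝ => K * |q.1 - p.1| + C * |q.2 - p.2|)
    (fun q => H.abs_lag_sub_le hC _ _ _ _) ?_
  have : Continuous fun q : ℝ × ℝ => K * |q.1 - p.1| + C * |q.2 - p.2| := by fun_prop
  simpa using this.tendsto p

/-- A limit of minimizers is a minimizer, and for `t > 0` there is only one. -/
theorem continuousAt_slopeOf (H : Admissible f h K) {w t : ℝ} (ht : 0 < t) :
    ContinuousAt (fun p : ℝ × ℝ => slopeOf f K p.1 p.2) (w, t) := by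
  have key : ∀ g ≤ 𝓝 (w, t), g.NeBot → ∀ y, |y| ≤ K →
      Tendsto (fun p : ℝ × ℝ => slopeOf f K p.1 p.2) g (𝓝 y) → y = slopeOf f K w t := by
    intro g hg _ y hy hlim
    have h1 : Tendsto (fun p : ℝ × ℝ => lag f K p.1 p.2) g (𝓝 (lag f K w t)) :=
      (H.continuous_lag.tendsto (w, t)).mono_left hg
    have hw : Tendsto (fun p : ℝ × ℝ => p.1) g (𝓝 w) :=
      (continuous_fst.tendsto (w, t)).mono_left hg
    have ht' : Tendsto (fun p : ℝ × ℝ => p.2) g (𝓝 t) :=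
      (continuous_snd.tendsto (w, t)).mono_left hg
    have hf : Tendsto (fun p : ℝ × ℝ => f (slopeOf f K p.1 p.2)) g (𝓝 (f y)) :=
      (H.continuous.tendsto y).comp hlim
    have h2 : Tendsto (fun p : ℝ × ℝ => lag f K p.1 p.2) g (𝓝 (y * w - t * (f y - f 0))) := by
      have := (hlim.mul hw).sub (ht'.mul (hf.sub_const (f 0)))
      refine this.congr fun p => ?_
      rw [H.lag_eq p.1 p.2]
    have h3 := tendsto_nhds_unique h2 h1
    exact H.eq_slopeOf ht (abs_le.1 hy) h3.le
  have hb : ∀ᶠ p : ℝ × ℝ in 𝓝 (w, t), |slopeOf f K p.1 p.2| ≤ K :=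
    Eventually.of_forall fun p => H.abs_slopeOf_le _ _
  exact tendsto_of_unique_limit hb key

theorem tendsto_slopeOf (H : Admissible f h K) {w t : ℝ} (ht : 0 < t) {α : Type*} {l : Filter α}
    {u v : α → ℝ} (hu : Tendsto u l (𝓝 w)) (hv : Tendsto v l (𝓝 t)) :
    Tendsto (fun a => slopeOf f K (u a) (v a)) l (𝓝 (slopeOf f K w t)) := by
  have h1 : Tendsto (fun p : ℝ × ℝ => slopeOf f K p.1 p.2) (𝓝 (w, t)) (𝓝 (slopeOf f K w t)) :=
    H.continuousAt_slopeOf ht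
  have h2 := h1.comp (hu.prodMk_nhds hv)
  rwa [comp_def] at h2

theorem hasFDerivAt_lag (H : Admissible f h K) {w t : ℝ} (ht : 0 < t) :
    HasFDerivAt (fun p : ℝ × ℝ => lag f K p.1 p.2)
      (slopeOf f K w t • ContinuousLinearMap.fst ℝ ℝ ℝ -
        (f (slopeOf f K w t) - f 0) • ContinuousLinearMap.snd ℝ ℝ ℝ) (w, t) := by
  refine hasFDerivAt_of_sandwich (φ := fun y => f y - f 0) (y₁ := fun _ => slopeOf f K w t)
    (y₂ := fun q => slopeOf f K q.1 q.2) ?_ tendsto_const_nhds (H.continuousAt_slopeOf ht) ?_ ?_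
  · exact (H.continuous.sub continuous_const).continuousAt
  · exact Eventually.of_forall fun q => H.lag_sub_le _ _ _ _
  · exact Eventually.of_forall fun q => H.le_lag_sub _ _ _ _

end Admissible

attribute [irreducible] slopeOf lag

end EqualArea

/-! ### The Hopf–Lax function and its optimal paths -/

namespace EqualArea
open Function

theorem nonpos_of_isMax_right {φ : ℝ → ℝ} {d x : ℝ} (hd : HasDerivWithinAt φ d (Ici x) x)
    (hmax : ∀ y, φ y ≤ φ x) : d ≤ 0 := by
  have h1 := hasDerivWithinAt_iff_tendsto_slope' (by simp) |>.1 (hasDerivWithinAt_Ioi_iff_Ici.2 hd)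
  refine le_of_tendsto h1 (eventually_mem_nhdsWithin.mono fun y hy => ?_)
  rw [slope_def_field]
  exact div_nonpos_of_nonpos_of_nonneg (by linarith [hmax y]) (by linarith [mem_Ioi.1 hy])

theorem nonneg_of_isMax_left {φ : ℝ → ℝ} {d x : ℝ} (hd : HasDerivWithinAt φ d (Iic x) x)
    (hmax : ∀ y, φ y ≤ φ x) : 0 ≤ d := by
  have h1 := hasDerivWithinAt_iff_tendsto_slope' (by simp) |>.1 (hasDerivWithinAt_Iio_iff_Iic.2 hd)
  refine ge_of_tendsto h1 (eventually_mem_nhdsWithin.mono fun y hy => ?_)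
  rw [slope_def_field]
  exact div_nonneg_of_nonpos (by linarith [hmax y]) (by linarith [mem_Iio.1 hy])

/-- The action of the straight path from `(X, 0)` to `(z, t)`. -/
noncomputable def action (f h : ℝ → ℝ) (K X z t : ℝ) : ℝ := primitive h X + lag f K (z - X) t

/-- The Hopf–Lax value function. -/
noncomputable def hopfLax (f h : ℝ → ℝ) (K z t : ℝ) : ℝ := sSup (range fun X => action f h K X z t)

/-- `X` is the foot of an optimal path to `(z, t)`. -/
def IsOpt (f h : ℝ → ℝ) (K X z t : ℝ) : Prop := ∀ X', action f h K X' z t ≤ action f h K X z t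

/-- The value transported along the characteristic that starts at a point of the initial curve. -/
noncomputable def charValue (f h : ℝ → ℝ) (t : ℝ) (p : ℝ × ℝ) : ℝ :=
  primitive h p.1 + t * (p.2 * deriv f p.2 - (f p.2 - f 0))

/-- The characteristic that starts at `p` is still optimal at time `t`. -/
def Alive (f h : ℝ → ℝ) (K : ℝ) (p : ℝ × ℝ) (t : ℝ) : Prop :=
  IsOpt f h K p.1 (p.1 + deriv f p.2 * t) t

variable {f h : ℝ → ℝ} {K X z t : ℝ}

theorem IsOpt.hopfLax_eq (hX : IsOpt f h K X z t) : hopfLax f h K z t = action f h K X z t :=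
  IsLUB.csSup_eq ⟨by rintro _ ⟨X', rfl⟩; exact hX X', fun _ hb => hb ⟨X, rfl⟩⟩ (range_nonempty _)

namespace Admissible

theorem continuous_action (H : Admissible f h K) :
    Continuous fun q : ℝ × ℝ × ℝ => action f h K q.1 q.2.1 q.2.2 := by
  have h1 := H.continuous_primitive
  have h2 : Continuous fun q : ℝ × ℝ × ℝ => lag f K (q.2.1 - q.1) q.2.2 :=
    H.continuous_lag.comp (by fun_prop : Continuous fun q : ℝ × ℝ × ℝ => (q.2.1 - q.1, q.2.2))
  unfold action
  fun_prop

theorem exists_max_add_lag (H : Admissible f h K) {U : ℝ → ℝ} (hU : Continuous U) {D : ℝ}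
    (hD : ∀ x, U x ≤ D) (z t : ℝ) :
    ∃ X, ∀ X', U X' + lag f K (z - X') t ≤ U X + lag f K (z - X) t := by
  obtain ⟨C, hC0, hC, -⟩ := H.exists_flux_bound
  have hK := H.one_le
  have hc : Continuous fun X => U X + lag f K (z - X) t :=
    hU.add (H.continuous_lag.comp (by fun_prop : Continuous fun X : ℝ => (z - X, t)))
  have htop : Tendsto (fun X => D - |z - X| + C * |t|) (cocompact ℝ) atBot := by
    refine tendsto_atBot_add_const_right _ _ (tendsto_const_nhds.add_atBot ?_)
    refine tendsto_neg_atTop_atBot.comp ?_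
    have : Tendsto (fun X : ℝ => ‖X - z‖) (cocompact ℝ) atTop :=
      tendsto_norm_cocompact_atTop.comp (Homeomorph.subRight z).isClosedEmbedding.tendsto_cocompact
    exact this.congr fun X => by rw [Real.norm_eq_abs, abs_sub_comm]
  have hle : ∀ X, U X + lag f K (z - X) t ≤ D - |z - X| + C * |t| := by
    intro X
    have h1 := H.lag_le_neg hC (z - X) t
    have h3 : |z - X| ≤ K * |z - X| := le_mul_of_one_le_left (abs_nonneg _) hK
    linarith [hD X]
  exact hc.exists_forall_ge (tendsto_atBot_mono hle htop)

theorem exists_isOpt (H : Admissible f h K) (z t : ℝ) : ∃ X, IsOpt f h K X z t :=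
  H.exists_max_add_lag H.continuous_primitive (fun X => le_of_abs_le (H.abs_primitive_le X)) z t

theorem action_le (H : Admissible f h K) (X z t : ℝ) :
    action f h K X z t ≤ hopfLax f h K z t := by
  obtain ⟨X₀, h₀⟩ := H.exists_isOpt z t
  rw [h₀.hopfLax_eq]
  exact h₀ X

theorem isOpt_iff (H : Admissible f h K) :
    IsOpt f h K X z t ↔ action f h K X z t = hopfLax f h K z t :=
  ⟨fun hX => hX.hopfLax_eq.symm, fun hX X' => hX ▸ H.action_le X' z t⟩

theorem isOpt_of_le (H : Admissible f h K) (hle : hopfLax f h K z t ≤ action f h K X z t) :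
    IsOpt f h K X z t := H.isOpt_iff.2 (le_antisymm (H.action_le _ _ _) hle)

theorem abs_hopfLax_sub_le (H : Admissible f h K) {C : ℝ}
    (hC : ∀ y, |y| ≤ K → |f y - f 0| ≤ C) (z t z' t' : ℝ) :
    |hopfLax f h K z' t' - hopfLax f h K z t| ≤ K * |z' - z| + C * |t' - t| := by
  have key : ∀ z t z' t' : ℝ,
      hopfLax f h K z' t' - hopfLax f h K z t ≤ K * |z' - z| + C * |t' - t| := by
    intro z t z' t'
    obtain ⟨X, hX⟩ := H.exists_isOpt z' t'
    have h1 := H.action_le X z t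
    have h2 := le_of_abs_le (H.abs_lag_sub_le hC (z - X) t (z' - X) t')
    rw [hX.hopfLax_eq]
    unfold action at *
    rw [sub_sub_sub_cancel_right] at h2
    linarith
  rw [abs_le]
  constructor
  · have := key z' t' z t
    rw [abs_sub_comm z, abs_sub_comm t] at this
    linarith
  · exact key z t z' t'

theorem continuous_hopfLax (H : Admissible f h K) :
    Continuous fun p : ℝ × ℝ => hopfLax f h K p.1 p.2 := by
  obtain ⟨C, hC0, hC, -⟩ := H.exists_flux_bound
  refine continuous_iff_continuousAt.2 fun p => ?_
  rw [ContinuousAt, tendsto_iff_dist_tendsto_zero]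
  refine squeeze_zero (fun _ => dist_nonneg)
    (g := fun q : ℝ × ℝ => K * |q.1 - p.1| + C * |q.2 - p.2|)
    (fun q => H.abs_hopfLax_sub_le hC _ _ _ _) ?_
  have : Continuous fun q : ℝ × ℝ => K * |q.1 - p.1| + C * |q.2 - p.2| := by fun_prop
  simpa using this.tendsto p

theorem isClosed_isOpt (H : Admissible f h K) :
    IsClosed {q : ℝ × ℝ × ℝ | IsOpt f h K q.1 q.2.1 q.2.2} := by
  simp_rw [H.isOpt_iff]
  exact isClosed_eq H.continuous_action
    (H.continuous_hopfLax.comp (by fun_prop : Continuous fun q : ℝ × ℝ × ℝ => (q.2.1, q.2.2)))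

theorem isOpt_of_tendsto (H : Admissible f h K) {α : Type*} {l : Filter α} [l.NeBot]
    {u v w : α → ℝ} (hu : Tendsto u l (𝓝 X)) (hv : Tendsto v l (𝓝 z)) (hw : Tendsto w l (𝓝 t))
    (ho : ∃ᶠ a in l, IsOpt f h K (u a) (v a) (w a)) : IsOpt f h K X z t :=
  H.isClosed_isOpt.mem_of_frequently_of_tendsto (x := (X, z, t)) (f := fun a => (u a, v a, w a))
    ho (hu.prodMk_nhds (hv.prodMk_nhds hw))

/-- First-order conditions at an optimal foot point. -/
theorem slopeOf_mem_of_isOpt (H : Admissible f h K) (ht : 0 < t) (hX : IsOpt f h K X z t) :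
    rightLim h X ≤ slopeOf f K (z - X) t ∧ slopeOf f K (z - X) t ≤ leftLim h X := by
  set y := slopeOf f K (z - X) t
  have hl : HasDerivAt (fun X => lag f K (z - X) t) (-y) X := by
    have h1 := (H.hasFDerivAt_lag (w := z - X) ht)
    have h2 : HasDerivAt (fun X : ℝ => (z - X, t)) (-1, 0) X :=
      ((hasDerivAt_id X).const_sub z).prodMk (hasDerivAt_const X t)
    have h3 := h1.comp_hasDerivAt X h2
    have h4 : (slopeOf f K (z - X) t • ContinuousLinearMap.fst ℝ ℝ ℝ -
        (f (slopeOf f K (z - X) t) - f 0) • ContinuousLinearMap.snd ℝ ℝ ℝ) (-1, 0) = -y := by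
      simp [y]
    rw [h4] at h3
    exact h3
  constructor
  · have hd : HasDerivWithinAt (fun X => action f h K X z t) (rightLim h X + -y) (Ici X) X :=
      (H.hasDerivWithinAt_primitive_right X).add hl.hasDerivWithinAt
    have := nonpos_of_isMax_right hd hX
    linarith
  · have hd : HasDerivWithinAt (fun X => action f h K X z t) (leftLim h X + -y) (Iic X) X :=
      (H.hasDerivWithinAt_primitive_left X).add hl.hasDerivWithinAt
    have := nonneg_of_isMax_left hd hX
    linarith

/-- The first-order conditions exclude upward jumps of `h` at an optimal foot, and at a downward
jump they place the slope on the vertical segment. -/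
theorem mem_completedGraph_of_isOpt (H : Admissible f h K) (ht : 0 < t)
    (hX : IsOpt f h K X z t) : (X, slopeOf f K (z - X) t) ∈ completedGraph h :=
  mem_uIcc.2 (Or.inr (H.slopeOf_mem_of_isOpt ht hX))

theorem eq_add_of_isOpt (H : Admissible f h K) (ht : 0 < t) (hX : IsOpt f h K X z t) :
    z = X + deriv f (slopeOf f K (z - X) t) * t := by
  have h1 := H.abs_le_of_mem (H.mem_completedGraph_of_isOpt ht hX)
  have := H.eq_of_abs_slopeOf_lt (w := z - X) (t := t) (by linarith [h1])
  linarith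

theorem mem_Icc_of_mem (H : Admissible f h K) {p : ℝ × ℝ} (hp : p ∈ initialCurve h) :
    p.2 ∈ Icc (-K) K := by
  have := H.abs_le_of_mem_initialCurve hp
  exact abs_le.1 (by linarith)

theorem action_char (H : Admissible f h K) {p : ℝ × ℝ} (hp : p ∈ initialCurve h) (ht : 0 ≤ t) :
    action f h K p.1 (p.1 + deriv f p.2 * t) t = charValue f h t p := by
  unfold action charValue
  rw [add_sub_cancel_left, H.lag_char ht (H.mem_Icc_of_mem hp)]

theorem slopeOf_char' (H : Admissible f h K) {p : ℝ × ℝ} (hp : p ∈ initialCurve h) (ht : 0 < t) :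
    slopeOf f K (p.1 + deriv f p.2 * t - p.1) t = p.2 := by
  rw [add_sub_cancel_left, H.slopeOf_char ht (H.mem_Icc_of_mem hp)]

theorem alive_of_isOpt (H : Admissible f h K) (ht : 0 < t) (hX : IsOpt f h K X z t) :
    Alive f h K (X, slopeOf f K (z - X) t) t := by
  unfold Alive
  rwa [← H.eq_add_of_isOpt ht hX]

/-- Optimal paths do not cross. -/
theorem isOpt_mono (H : Admissible f h K) {X' z' : ℝ} (ht : 0 < t) (hX : IsOpt f h K X z t)
    (hX' : IsOpt f h K X' z' t) (hz : z < z') : X ≤ X' := by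
  by_contra! hlt
  have h1 := hX X'
  have h2 := hX' X
  unfold action at h1 h2
  set y₂ := slopeOf f K (z - X') t with hy₂
  set y₃ := slopeOf f K (z' - X) t with hy₃
  have a1 := H.lag_sub_le (z - X') t (z - X) t
  have a2 := H.lag_sub_le (z' - X) t (z' - X') t
  have b1 := H.lag_sub_le (z' - X) t (z - X) t
  have b2 := H.lag_sub_le (z - X') t (z' - X') t
  rw [← hy₂] at a1 b2
  rw [← hy₃] at a2 b1
  -- Add the two optimality inequalities: with the bounds `a1`, `a2` they give `y₂ ≤ y₃`, with `b1`,
  -- `b2` they give `y₃ ≤ y₂`.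
  have hyy : y₂ = y₃ := by
    rcases lt_trichotomy y₂ y₃ with h | h | h
    · nlinarith
    · exact h
    · nlinarith
  -- All inequalities have become equalities, so `y₂` is minimizing for both crossing paths as well.
  -- They would have the same speed `f'(y₂)`, which is impossible for paths that cross.
  have e1 : y₂ = slopeOf f K (z - X) t := by
    refine H.eq_slopeOf ht (H.slopeOf_mem _ _) ?_
    have := H.lag_eq (z - X') t
    rw [← hy₂] at this
    rw [← hyy] at a2 b1
    linarith
  have e2 : y₂ = slopeOf f K (z' - X') t := by
    refine H.eq_slopeOf ht (H.slopeOf_mem _ _) ?_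
    have := H.lag_eq (z - X') t
    rw [← hy₂] at this
    rw [← hyy] at a2 b1
    linarith
  have c1 := H.eq_add_of_isOpt ht hX
  have c2 := H.eq_add_of_isOpt ht hX'
  rw [← e1] at c1
  rw [← e2] at c2
  linarith

/-- An optimal path is the only optimal path at each of its interior points. -/
theorem isOpt_unique_of_lt (H : Admissible f h K) {y t' X' : ℝ} (ht' : 0 < t') (htt : t' < t)
    (hX : IsOpt f h K X (X + deriv f y * t) t) (hy : (X, y) ∈ initialCurve h)
    (hX' : IsOpt f h K X' (X + deriv f y * t') t') : X' = X := by
  have hyK := H.mem_Icc_of_mem hy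
  set z := X + deriv f y * t with hz
  set z' := X + deriv f y * t' with hz'
  have e0 := hX X'
  have e1 := hX' X
  unfold action at e0 e1
  have v1 : lag f K (z - X) t = t * (y * deriv f y - (f y - f 0)) := by
    rw [hz, add_sub_cancel_left, H.lag_char (by linarith) hyK]
  have v2 : lag f K (z' - X) t' = t' * (y * deriv f y - (f y - f 0)) := by
    rw [hz', add_sub_cancel_left, H.lag_char (by linarith) hyK]
  have v3 : lag f K (z - z') (t - t') = (t - t') * (y * deriv f y - (f y - f 0)) := by
    rw [← H.lag_char (by linarith) hyK]; congr 1; rw [hz, hz']; ring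
  -- `y₀` belongs to the direct path from `X'` to `(z, t)` and is tested on both pieces of the
  -- broken path via `(z', t')`. Optimality leaves no slack, so it minimizes on both pieces; the
  -- second piece runs along the given characteristic, whence `y₀ = y`.
  set y₀ := slopeOf f K (z - X') t with hy₀
  have m0 := H.slopeOf_mem (z - X') t
  have w0 := H.lag_eq (z - X') t
  have w1 := H.lag_le (z' - X') t' m0
  have w2 := H.lag_le (z - z') (t - t') m0
  rw [← hy₀] at w0 w1 w2 m0
  have r1 : y₀ = slopeOf f K (z' - X') t' := H.eq_slopeOf ht' m0 (by linarith)
  have r2 : y₀ = y := by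
    rw [H.eq_slopeOf (w := z - z') (t := t - t') (by linarith) m0 (by linarith)]
    rw [show z - z' = deriv f y * (t - t') by rw [hz, hz']; ring]
    exact H.slopeOf_char (by linarith) hyK
  have := H.eq_add_of_isOpt ht' hX'
  rw [← r1, r2] at this
  linarith

/-- Some foot is optimal at the earlier point, and by `isOpt_unique_of_lt` it must be `p.1`. -/
theorem alive_of_lt (H : Admissible f h K) {p : ℝ × ℝ} (hp : p ∈ initialCurve h) {t' : ℝ}
    (ht' : 0 < t') (htt : t' < t) (ha : Alive f h K p t) : Alive f h K p t' := by
  obtain ⟨X', hX'⟩ := H.exists_isOpt (p.1 + deriv f p.2 * t') t'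
  obtain rfl := H.isOpt_unique_of_lt (y := p.2) ht' htt ha hp hX'
  exact hX'

theorem abs_sub_le_of_isOpt (H : Admissible f h K) {C : ℝ} (hC : ∀ y, |y| ≤ K → |deriv f y| ≤ C)
    (ht : 0 < t) (hX : IsOpt f h K X z t) : |z - X| ≤ C * t := by
  have := H.eq_add_of_isOpt ht hX
  have h1 : z - X = deriv f (slopeOf f K (z - X) t) * t := by linarith
  rw [h1, abs_mul, abs_of_pos ht]
  gcongr
  exact hC _ (H.abs_slopeOf_le _ _)

/-- Optimal feet converge to the optimal foot where it is unique. -/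
theorem tendsto_of_unique (H : Admissible f h K) {α : Type*} {l : Filter α}
    {u v w : α → ℝ} (ht : 0 < t) (hun : ∀ X', IsOpt f h K X' z t → X' = X)
    (hv : Tendsto v l (𝓝 z)) (hw : Tendsto w l (𝓝 t))
    (ho : ∀ᶠ a in l, IsOpt f h K (u a) (v a) (w a)) : Tendsto u l (𝓝 X) := by
  obtain ⟨C, hC0, -, hC⟩ := H.exists_flux_bound
  have hb : ∀ᶠ a in l, |u a| ≤ |z| + 1 + C * (t + 1) := by
    filter_upwards [ho, hv.abs.eventually (gt_mem_nhds (lt_add_one |z|)),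
      hw.eventually (gt_mem_nhds (lt_add_one t)), hw.eventually (lt_mem_nhds ht)]
      with a h1 h2 h3 h4
    have h5 := H.abs_sub_le_of_isOpt hC h4 h1
    have h6 : C * w a ≤ C * (t + 1) := by gcongr
    have h7 : |u a| ≤ |v a| + |v a - u a| := by
      have := abs_sub (v a) (v a - u a)
      simpa using this
    linarith
  refine tendsto_of_unique_limit hb fun g hg _ y _ hy => hun y ?_
  exact H.isOpt_of_tendsto hy (hv.mono_left hg) (hw.mono_left hg) (ho.filter_mono hg).frequently

/-- The upper bound compares with the optimal feet of nearby points, the lower bound keeps the foot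
`X`; the slopes of both converge because optimal feet tend to the unique one. -/
theorem hasFDerivAt_hopfLax (H : Admissible f h K) (ht : 0 < t) (hX : IsOpt f h K X z t)
    (hun : ∀ X', IsOpt f h K X' z t → X' = X) :
    HasFDerivAt (fun p : ℝ × ℝ => hopfLax f h K p.1 p.2)
      (slopeOf f K (z - X) t • ContinuousLinearMap.fst ℝ ℝ ℝ -
        (f (slopeOf f K (z - X) t) - f 0) • ContinuousLinearMap.snd ℝ ℝ ℝ) (z, t) := by
  choose u hu using fun p : ℝ × ℝ => H.exists_isOpt p.1 p.2
  have e1 : Tendsto (fun p : ℝ × ℝ => p.1) (𝓝 (z, t)) (𝓝 z) := continuous_fst.tendsto (z, t)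
  have e2 : Tendsto (fun p : ℝ × ℝ => p.2) (𝓝 (z, t)) (𝓝 t) := continuous_snd.tendsto (z, t)
  have hlim : Tendsto u (𝓝 (z, t)) (𝓝 X) :=
    H.tendsto_of_unique ht hun e1 e2 (Eventually.of_forall hu)
  have s1 : Tendsto (fun q : ℝ × ℝ => slopeOf f K (z - u q) t) (𝓝 (z, t))
      (𝓝 (slopeOf f K (z - X) t)) :=
    H.tendsto_slopeOf ht (tendsto_const_nhds.sub hlim) tendsto_const_nhds
  have s2 : Tendsto (fun q : ℝ × ℝ => slopeOf f K (q.1 - X) q.2) (𝓝 (z, t))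
      (𝓝 (slopeOf f K (z - X) t)) := H.tendsto_slopeOf ht (e1.sub tendsto_const_nhds) e2
  refine hasFDerivAt_of_sandwich (φ := fun y => f y - f 0)
    (y₁ := fun q => slopeOf f K (z - u q) t) (y₂ := fun q => slopeOf f K (q.1 - X) q.2)
    (H.continuous.sub continuous_const).continuousAt s1 s2
    (Eventually.of_forall fun q => ?_) (Eventually.of_forall fun q => ?_)
  · have h1 := H.action_le (u q) z t
    have h2 := H.lag_sub_le (z - u q) t (q.1 - u q) q.2
    simp only [(hu q).hopfLax_eq]
    unfold action at *
    rw [sub_sub_sub_cancel_right] at h2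
    linarith
  · have h1 := H.action_le X q.1 q.2
    have h2 := H.le_lag_sub (z - X) t (q.1 - X) q.2
    simp only [hX.hopfLax_eq]
    unfold action at *
    rw [sub_sub_sub_cancel_right] at h2
    linarith

/-- Optimal paths have bounded speed, so far away their feet lie outside the support of `h`. There
the slope is 0, and by the normalization `f y - f 0` such a path costs nothing. -/
theorem exists_hopfLax_far (H : Admissible f h K) (T : ℝ) : ∃ R, 0 < R ∧
    (∀ t, 0 < t → t ≤ T → ∀ z, z ≤ -R → hopfLax f h K z t = 0) ∧
    (∀ t, 0 < t → t ≤ T → ∀ z, R ≤ z → hopfLax f h K z t = ∫ y, h y) ∧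
    (∀ t, 0 < t → t ≤ T → ∀ z X, R ≤ |z| → IsOpt f h K X z t → slopeOf f K (z - X) t = 0) := by
  obtain ⟨R, hR, h1, h2, h3⟩ := H.exists_far
  obtain ⟨C, hC0, -, hC⟩ := H.exists_flux_bound
  have key : ∀ t, 0 < t → t ≤ T → ∀ z X, R + 1 + C * |T| ≤ |z| → IsOpt f h K X z t →
      R < |X| ∧ slopeOf f K (z - X) t = 0 ∧ |z - X| ≤ C * |T| := by
    intro t ht htT z X hz hX
    have e1 := H.abs_sub_le_of_isOpt hC ht hX
    have e2 : C * t ≤ C * |T| := by gcongr; exact htT.trans (le_abs_self T)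
    have e3 : |z| ≤ |z - X| + |X| := by
      have := abs_add_le (z - X) X; simpa using this
    have e4 : R < |X| := by linarith
    exact ⟨e4, h1 _ (Or.inr (H.mem_completedGraph_of_isOpt ht hX)) e4, by linarith⟩
  have hval : ∀ t, ∀ z X, IsOpt f h K X z t → slopeOf f K (z - X) t = 0 →
      hopfLax f h K z t = primitive h X := by
    intro t z X hX h0
    rw [hX.hopfLax_eq, action, H.lag_eq, h0]; ring
  have hp : 0 ≤ C * |T| := by positivity
  refine ⟨R + 1 + C * |T|, by positivity, fun t ht htT z hz => ?_, fun t ht htT z hz => ?_,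
    fun t ht htT z X hz hX => (key t ht htT z X hz hX).2.1⟩
  · obtain ⟨X, hX⟩ := H.exists_isOpt z t
    obtain ⟨-, k2, k3⟩ := key t ht htT z X (by linarith [neg_le_abs z]) hX
    rw [hval t z X hX k2, h2]
    have := abs_le.1 k3
    linarith
  · obtain ⟨X, hX⟩ := H.exists_isOpt z t
    obtain ⟨-, k2, k3⟩ := key t ht htT z X (by linarith [le_abs_self z]) hX
    rw [hval t z X hX k2, h3]
    have := abs_le.1 k3
    linarith

end Admissible

attribute [irreducible] hopfLax

end EqualArea

/-! ### Parametrized curves, signed area, and optimality of equal-area cuts -/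

namespace EqualArea
open Function

namespace PiecewiseC1

variable {h : ℝ → ℝ}

theorem eventually_contDiffAt (hh : PiecewiseC1 h) (x : ℝ) :
    ∀ᶠ z in 𝓝[≠] x, ContDiffAt ℝ 1 h z := by
  obtain ⟨S, hS, -⟩ := hh
  have : ∀ᶠ z in 𝓝[≠] x, z ∉ (S : Set ℝ) := by
    have h1 : ((S : Set ℝ) \ {x})ᶜ ∈ 𝓝 x :=
      (S.finite_toSet.subset sdiff_subset).isClosed.isOpen_compl.mem_nhds (by simp)
    filter_upwards [mem_nhdsWithin_of_mem_nhds h1, self_mem_nhdsWithin] with z hz hz'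
    intro hzS
    exact hz ⟨hzS, hz'⟩
  exact this.mono fun z hz => hS z (by simpa using hz)

theorem eventually_continuousAt_left (hh : PiecewiseC1 h) (x : ℝ) :
    ∀ᶠ z in 𝓝[<] x, ContinuousAt h z :=
  ((hh.eventually_contDiffAt x).filter_mono (nhdsWithin_mono _ fun _ hz => ne_of_lt hz)).mono
    fun _ hz => hz.continuousAt

theorem eventually_continuousAt_right (hh : PiecewiseC1 h) (x : ℝ) :
    ∀ᶠ z in 𝓝[>] x, ContinuousAt h z :=
  ((hh.eventually_contDiffAt x).filter_mono (nhdsWithin_mono _ fun _ hz => ne_of_gt hz)).mono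
    fun _ hz => hz.continuousAt

end PiecewiseC1

/-- The position at time `t` of the curve point with parameter `s`. -/
noncomputable def position (f X Y : ℝ → ℝ) (t s : ℝ) : ℝ := X s + deriv f (Y s) * t

namespace IsParametrization

variable {f h X Y : ℝ → ℝ} {K t : ℝ}

theorem mem (P : IsParametrization h X Y) (s : ℝ) : (X s, Y s) ∈ completedGraph h := by
  rw [← P.range_eq]; exact ⟨s, rfl⟩

theorem mem_initialCurve (P : IsParametrization h X Y) (s : ℝ) : (X s, Y s) ∈ initialCurve h :=
  Or.inr (P.mem s)

theorem exists_eq (P : IsParametrization h X Y) {p : ℝ × ℝ} (hp : p ∈ completedGraph h) :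
    ∃ s, X s = p.1 ∧ Y s = p.2 := by
  rw [← P.range_eq] at hp
  obtain ⟨s, rfl⟩ := hp
  exact ⟨s, rfl, rfl⟩

theorem exists_fst_eq (P : IsParametrization h X Y) (ξ : ℝ) : ∃ s, X s = ξ := by
  obtain ⟨s, hs, -⟩ := P.exists_eq (p := (ξ, leftLim h ξ)) left_mem_uIcc
  exact ⟨s, hs⟩

theorem eq_of_eq (P : IsParametrization h X Y) {s s' : ℝ} (hX : X s = X s') (hY : Y s = Y s') :
    s = s' := P.injective (Prod.ext hX hY)

theorem lt_of_fst_lt (P : IsParametrization h X Y) {s s' : ℝ} (hX : X s < X s') : s < s' :=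
  P.monotone_fst.reflect_lt hX

/-- At equal positions the point that started further right is not faster, and `f'` is strictly
decreasing. -/
theorem snd_lt_snd (P : IsParametrization h X Y) (H : Admissible f h K) {s s' : ℝ} (ht : 0 < t)
    (hs : s < s') (hx : position f X Y t s = position f X Y t s') : Y s < Y s' := by
  unfold position at hx
  have h1 := P.monotone_fst hs.le
  have h2 : deriv f (Y s') * t ≤ deriv f (Y s) * t := by linarith
  have h3 := H.strictAnti_deriv.le_iff_ge.1 (le_of_mul_le_mul_right h2 ht)
  refine lt_of_le_of_ne h3 fun h4 => hs.ne (P.eq_of_eq ?_ h4)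
  rw [h4] at hx; linarith

/-- The curve enters the vertical line over `ξ` at the left limit of `h`. -/
theorem exists_first (P : IsParametrization h X Y) (H : Admissible f h K) (ξ : ℝ) :
    ∃ α, X α = ξ ∧ Y α = leftLim h ξ ∧ ∀ s, X s = ξ → α ≤ s := by
  have hcl : IsClosed {s | X s = ξ} := isClosed_eq P.continuous_fst continuous_const
  obtain ⟨s₀, hs₀⟩ := P.exists_fst_eq (ξ - 1)
  have hbdd : BddBelow {s | X s = ξ} :=
    ⟨s₀, fun s hs => (P.lt_of_fst_lt (by rw [hs₀, show X s = ξ from hs]; linarith)).le⟩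
  have hα : X (sInf {s | X s = ξ}) = ξ := hcl.csInf_mem (P.exists_fst_eq ξ) hbdd
  set α := sInf {s | X s = ξ} with hαdef
  have hmin : ∀ s, X s = ξ → α ≤ s := fun s hs => csInf_le hbdd hs
  refine ⟨α, hα, ?_, hmin⟩
  have hlt : ∀ u ∈ Iio α, X u < ξ := by
    intro u hu
    refine lt_of_le_of_ne (hα ▸ P.monotone_fst (le_of_lt hu)) fun h => ?_
    exact absurd (hmin u h) (not_le.2 hu)
  have hX : Tendsto X (𝓝[<] α) (𝓝[<] ξ) := by
    refine tendsto_nhdsWithin_iff.2 ⟨?_, eventually_mem_nhdsWithin.mono hlt⟩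
    exact hα ▸ (P.continuous_fst.tendsto α).mono_left nhdsWithin_le_nhds
  have h1 : Tendsto (fun u => h (X u)) (𝓝[<] α) (𝓝 (leftLim h ξ)) :=
    (H.piecewise.tendsto_leftLim ξ).comp hX
  have h2 : Tendsto Y (𝓝[<] α) (𝓝 (Y α)) :=
    (P.continuous_snd.tendsto α).mono_left nhdsWithin_le_nhds
  refine tendsto_nhds_unique h2 (h1.congr' ?_)
  filter_upwards [hX.eventually (H.piecewise.eventually_continuousAt_left ξ)] with u hu
  exact (Admissible.snd_eq_of_continuousAt (P.mem u) hu).symm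

/-- Downward jumps are traversed downwards. -/
theorem lt_of_snd_lt (P : IsParametrization h X Y) (H : Admissible f h K) {s s' : ℝ}
    (hX : X s = X s') (hY : Y s' < Y s) (hl : Y s ≤ leftLim h (X s)) : s < s' := by
  by_contra! hle
  obtain ⟨α, hα, hYα, hmin⟩ := P.exists_first H (X s)
  have h1 : α ≤ s' := hmin s' hX.symm
  obtain ⟨u, hu, hYu⟩ := intermediate_value_Icc' h1 P.continuous_snd.continuousOn
    (show Y s ∈ Icc (Y s') (Y α) from ⟨hY.le, hYα ▸ hl⟩)
  have hXu : X u = X s :=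
    le_antisymm (hX ▸ P.monotone_fst hu.2) (hα ▸ P.monotone_fst hu.1)
  have := P.eq_of_eq hXu hYu
  have h2 : s = s' := le_antisymm (this ▸ hu.2) hle
  rw [h2] at hY
  exact lt_irrefl _ hY

theorem exists_alive (P : IsParametrization h X Y) (H : Admissible f h K) (ht : 0 < t) (z : ℝ) :
    ∃ s, position f X Y t s = z ∧ Alive f h K (X s, Y s) t := by
  obtain ⟨ξ, hξ⟩ := H.exists_isOpt z t
  obtain ⟨s, hs, hs'⟩ := P.exists_eq (H.mem_completedGraph_of_isOpt ht hξ)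
  simp only at hs hs'
  refine ⟨s, ?_, ?_⟩
  · rw [position, hs, hs']
    exact (H.eq_add_of_isOpt ht hξ).symm
  · rw [hs, hs']
    exact H.alive_of_isOpt ht hξ

theorem slopeOf_eq (P : IsParametrization h X Y) (H : Admissible f h K) (ht : 0 < t) (s : ℝ) :
    slopeOf f K (position f X Y t s - X s) t = Y s :=
  H.slopeOf_char' (P.mem_initialCurve s) ht

/-- Non-crossing settles different feet. Over a common foot the point further right is faster, so it
has the smaller ordinate, and a downward jump is traversed downwards. -/
theorem lt_of_position_lt (P : IsParametrization h X Y) (H : Admissible f h K) (ht : 0 < t)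
    {s s' : ℝ} (hs : Alive f h K (X s, Y s) t) (hs' : Alive f h K (X s', Y s') t)
    (hx : position f X Y t s < position f X Y t s') : s < s' := by
  rcases (H.isOpt_mono ht hs hs' hx).lt_or_eq with h1 | h1
  · exact P.lt_of_fst_lt h1
  · simp only at h1
    have h2 : Y s' < Y s := by
      unfold position at hx
      rw [h1] at hx
      exact H.strictAnti_deriv.lt_iff_gt.1 (lt_of_mul_lt_mul_right (by linarith) ht.le)
    refine P.lt_of_snd_lt H h1 h2 ?_
    have := (H.slopeOf_mem_of_isOpt ht hs).2
    exact (P.slopeOf_eq H ht s) ▸ this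

/-- The transported value is the action of the characteristic, so among the curve points over one
position the optimal ones are those of largest `charValue`. -/
theorem alive_of_le (P : IsParametrization h X Y) (H : Admissible f h K) (ht : 0 < t)
    {s s' : ℝ} (hs : Alive f h K (X s, Y s) t)
    (hx : position f X Y t s' = position f X Y t s)
    (hle : charValue f h t (X s, Y s) ≤ charValue f h t (X s', Y s')) :
    Alive f h K (X s', Y s') t := by
  have e1 := H.action_char (P.mem_initialCurve s) ht.le
  have e2 := H.action_char (P.mem_initialCurve s') ht.le
  refine H.isOpt_of_le ?_
  rw [e2]
  refine le_trans ?_ hle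
  rw [← e1, ← IsOpt.hopfLax_eq hs]
  exact (congrArg (fun z => hopfLax f h K z t) hx).le

theorem charValue_le (P : IsParametrization h X Y) (H : Admissible f h K) (ht : 0 < t)
    {s s' : ℝ} (hs : Alive f h K (X s, Y s) t)
    (hx : position f X Y t s' = position f X Y t s) :
    charValue f h t (X s', Y s') ≤ charValue f h t (X s, Y s) := by
  have e1 := H.action_char (P.mem_initialCurve s) ht.le
  have e2 := H.action_char (P.mem_initialCurve s') ht.le
  rw [← e1, ← e2]
  have := hs (X s')
  simp only at this ⊢
  rwa [show X s' + deriv f (Y s') * t = X s + deriv f (Y s) * t from hx]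

theorem continuous_position (P : IsParametrization h X Y) (H : Admissible f h K) :
    Continuous fun q : ℝ × ℝ => position f X Y q.2 q.1 := by
  unfold position
  have h1 := P.continuous_fst
  have h2 := H.continuous_deriv.comp P.continuous_snd
  exact (h1.comp _root_.continuous_fst).add ((h2.comp _root_.continuous_fst).mul _root_.continuous_snd)

theorem continuous_position_left (P : IsParametrization h X Y) (H : Admissible f h K) (t : ℝ) :
    Continuous (position f X Y t) :=
  (P.continuous_position H).comp (by fun_prop : Continuous fun s : ℝ => (s, t))

theorem continuous_charValue (P : IsParametrization h X Y) (H : Admissible f h K) (t : ℝ) :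
    Continuous fun s => charValue f h t (X s, Y s) := by
  unfold charValue
  have h0 := H.continuous_primitive.comp P.continuous_fst
  have h1 := P.continuous_snd
  have h2 := H.continuous_deriv.comp P.continuous_snd
  have h3 := H.continuous.comp P.continuous_snd
  exact h0.add (continuous_const.mul ((h1.mul h2).sub (h3.sub continuous_const)))

/-- Between two parameters of one level the monotone function `X` is constant, whereas a nonzero
derivative would make it leave the level at once. -/
theorem subsingleton_level (P : IsParametrization h X Y) (ξ : ℝ) :
    {s | X s = ξ ∧ deriv X s ≠ 0}.Subsingleton := by
  have key : ∀ s s', X s = ξ → X s' = ξ → deriv X s ≠ 0 → ¬ s < s' := by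
    intro s s' hs hs' hd hlt
    have h1 := (differentiableAt_of_deriv_ne_zero hd).hasDerivAt.eventually_ne (c := ξ) hd
    have h2 : ∀ᶠ u in 𝓝[>] s, X u ≠ ξ := h1.filter_mono (nhdsWithin_mono _ fun _ hz => ne_of_gt hz)
    obtain ⟨u, hu, hu'⟩ := (h2.and (Ioo_mem_nhdsGT hlt)).exists
    exact hu (le_antisymm (hs' ▸ P.monotone_fst hu'.2.le) (hs ▸ P.monotone_fst hu'.1.le))
  rintro s ⟨hs, hd⟩ s' ⟨hs', hd'⟩
  exact le_antisymm (not_lt.1 (key s' s hs' hs hd')) (not_lt.1 (key s s' hs hs' hd))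

/-- The signed area of an arc of the moved curve in terms of the transported value. -/
theorem signedArea_eq (P : IsParametrization h X Y) (H : Admissible f h K) (t a b : ℝ) :
    signedArea (fun s => X s + deriv f (Y s) * t) Y a b =
      (charValue f h t (X a, Y a) - charValue f h t (X b, Y b)) +
        (1 / 2) * ((position f X Y t b - position f X Y t a) * (Y a + Y b)) := by
  obtain ⟨SX, hSX, -⟩ := P.piecewise_fst
  obtain ⟨SY, hSY, -⟩ := P.piecewise_snd
  obtain ⟨S, hS, -⟩ := id H.piecewise
  have hda : ∀ y, HasDerivAt (deriv f) (deriv (deriv f) y) y := fun y =>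
    (H.contDiff_deriv.differentiable (by norm_num) y).hasDerivAt
  have hX' : ∀ s, s ∉ SX → HasDerivAt X (deriv X s) s := fun s hs =>
    ((hSX s hs).differentiableAt (by norm_num)).hasDerivAt
  have hY' : ∀ s, s ∉ SY → HasDerivAt Y (deriv Y s) s := fun s hs =>
    ((hSY s hs).differentiableAt (by norm_num)).hasDerivAt
  have hx' : ∀ s, s ∉ SX → s ∉ SY → HasDerivAt (fun s => X s + deriv f (Y s) * t)
      (deriv X s + deriv (deriv f) (Y s) * deriv Y s * t) s := fun s h1 h2 =>
    (hX' s h1).add (((hda (Y s)).comp s (hY' s h2)).mul_const t)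
  -- Over an exceptional abscissa of `h` the primitive need not be differentiable, but if `X' = 0`
  -- its Lipschitz bound still gives derivative 0 to the composite. Only countably many parameters
  -- are left out.
  set E : Set ℝ := (SX ∪ SY) ∪ ⋃ ξ ∈ S, {s | X s = ξ ∧ deriv X s ≠ 0} with hE
  have hEc : E.Countable := by
    refine ((SX.finite_toSet.union SY.finite_toSet).countable).union ?_
    exact S.countable_toSet.biUnion fun ξ _ => (P.subsingleton_level ξ).countable
  set x : ℝ → ℝ := fun s => X s + deriv f (Y s) * t with hxdef
  set x' : ℝ → ℝ := fun s => deriv X s + deriv (deriv f) (Y s) * deriv Y s * t with hx'def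
  have hcx : Continuous x := P.continuous_position_left H t
  -- The integrand of Green's formula has the explicit antiderivative `x Y - 2 charValue`.
  have hd : ∀ s ∈ Ioo (min a b) (max a b) \ E,
      HasDerivAt (fun s => x s * Y s - 2 * charValue f h t (X s, Y s))
        (x s * deriv Y s - Y s * x' s) s := by
    rintro s ⟨-, hs⟩
    simp only [hE, mem_union, Finset.mem_coe, not_or, mem_iUnion, mem_ofPred_eq, not_exists,
      not_and, not_not] at hs
    obtain ⟨⟨h1, h2⟩, h3⟩ := hs
    have hU : HasDerivAt (fun s => primitive h (X s)) (Y s * deriv X s) s := by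
      by_cases hXs : X s ∈ S
      · rw [h3 _ hXs rfl, mul_zero]
        have h4 := hX' s h1
        rw [h3 _ hXs rfl] at h4
        rw [hasDerivAt_iff_isLittleO] at h4 ⊢
        simp only [smul_zero, sub_zero] at h4 ⊢
        refine Asymptotics.IsBigO.trans_isLittleO ?_ h4
        exact Asymptotics.IsBigO.of_bound (K - 1)
          (Eventually.of_forall fun u => H.abs_primitive_sub_le (X s) (X u))
      · have hc := (hS _ hXs).continuousAt
        have := Admissible.snd_eq_of_continuousAt (P.mem s) hc
        simp only at this
        rw [this]
        exact (H.hasDerivAt_primitive hc).comp s (hX' s h1)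
    have hYs := hY' s h2
    have hA := (hda (Y s)).comp s hYs
    have hF := (H.hasDerivAt (Y s)).comp s hYs
    have hxs := hx' s h1 h2
    have := (hxs.mul hYs).sub ((hU.add (((hYs.mul hA).sub (hF.sub_const (f 0))).const_mul t)).const_mul 2)
    refine this.congr_deriv ?_
    simp only [hx'def, comp_apply]
    ring
  have hcont : Continuous fun s => x s * Y s - 2 * charValue f h t (X s, Y s) :=
    (hcx.mul P.continuous_snd).sub (continuous_const.mul (P.continuous_charValue H t))
  have hi : IntervalIntegrable (fun s => x s * deriv Y s - Y s * x' s) volume a b := by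
    have i1 := P.piecewise_fst.intervalIntegrable_deriv a b
    have i2 := P.piecewise_snd.intervalIntegrable_deriv a b
    have c1 : Continuous fun s => deriv (deriv f) (Y s) :=
      (H.contDiff_deriv.continuous_deriv le_rfl).comp P.continuous_snd
    refine (i2.continuousOn_mul hcx.continuousOn).sub
      (IntervalIntegrable.continuousOn_mul ?_ P.continuous_snd.continuousOn)
    exact i1.add ((i2.continuousOn_mul c1.continuousOn).mul_const t)
  have hint := integral_eq_of_hasDerivAt_off_countable _ _ hEc hcont.continuousOn hd hi
  have hcongr : ∫ s in a..b, (x s * deriv Y s - Y s * deriv x s) =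
      ∫ s in a..b, (x s * deriv Y s - Y s * x' s) := by
    refine intervalIntegral.integral_congr_ae ?_
    have : ∀ᵐ s, s ∉ ((SX ∪ SY : Set ℝ)) :=
      (SX.finite_toSet.union SY.finite_toSet).countable.ae_notMem volume
    filter_upwards [this] with s hs _
    simp only [mem_union, Finset.mem_coe, not_or] at hs
    rw [(hx' s hs.1 hs.2).deriv]
  unfold signedArea
  rw [hcongr, hint]
  simp only [position, hxdef]
  ring

end IsParametrization

namespace IsEqualAreaCut

variable {f h X Y : ℝ → ℝ} {K t : ℝ} {C : Finset (ℝ × ℝ)}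

theorem remaining_left {x y : ℝ → ℝ} (hC : IsEqualAreaCut x y C) {p : ℝ × ℝ} (hp : p ∈ C) :
    ∀ q ∈ C, p.1 ∉ Ioo q.1 q.2 := by
  intro q hq hm
  rcases eq_or_ne p q with rfl | hne
  · exact lt_irrefl _ hm.1
  · exact (disjoint_left.1 (hC.disjoint p hp q hq hne)) (left_mem_Icc.2 (hC.lt p hp).le)
      (Ioo_subset_Icc_self hm)

theorem remaining_right {x y : ℝ → ℝ} (hC : IsEqualAreaCut x y C) {p : ℝ × ℝ} (hp : p ∈ C) :
    ∀ q ∈ C, p.2 ∉ Ioo q.1 q.2 := by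
  intro q hq hm
  rcases eq_or_ne p q with rfl | hne
  · exact lt_irrefl _ hm.2
  · exact (disjoint_left.1 (hC.disjoint p hp q hq hne)) (right_mem_Icc.2 (hC.lt p hp).le)
      (Ioo_subset_Icc_self hm)

theorem charValue_eq (P : IsParametrization h X Y) (H : Admissible f h K)
    (hC : IsEqualAreaCut (fun s => X s + deriv f (Y s) * t) Y C) {p : ℝ × ℝ} (hp : p ∈ C) :
    charValue f h t (X p.1, Y p.1) = charValue f h t (X p.2, Y p.2) := by
  have h1 := hC.equal_area p hp
  rw [P.signedArea_eq H] at h1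
  have h2 : position f X Y t p.1 = position f X Y t p.2 := hC.vertical p hp
  rw [h2] at h1
  linarith

theorem charValue_le (P : IsParametrization h X Y) (H : Admissible f h K)
    (hC : IsEqualAreaCut (fun s => X s + deriv f (Y s) * t) Y C) {p : ℝ × ℝ} (hp : p ∈ C)
    {s : ℝ} (hs : s ∈ Icc p.1 p.2) (hx : position f X Y t s = position f X Y t p.1) :
    charValue f h t (X s, Y s) ≤ charValue f h t (X p.1, Y p.1) := by
  have h1 := hC.right_first p hp s hs hx
  rw [P.signedArea_eq H, hx] at h1
  linarith

/-- Take the leftmost offending cut and an alive `c` on its line. If `c` lies in this cut, the area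
conditions make the right end of the cut alive, against the order of alive positions. Otherwise `c`
lies inside an earlier cut and to the right of its line, so that cut offends too. -/
theorem not_right (P : IsParametrization h X Y) (H : Admissible f h K) (ht : 0 < t)
    (hC : IsEqualAreaCut (fun s => X s + deriv f (Y s) * t) Y C) :
    ∀ p ∈ C, ∀ s ∈ Ioo p.1 p.2, Alive f h K (X s, Y s) t →
      ¬ position f X Y t p.1 < position f X Y t s := by
  classical
  by_contra! hcon
  obtain ⟨p₀, hp₀, s₀, hs₀⟩ := hcon
  set B := C.filter fun p => ∃ s ∈ Ioo p.1 p.2, Alive f h K (X s, Y s) t ∧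
    position f X Y t p.1 < position f X Y t s with hB
  obtain ⟨p, hpB, hmin⟩ := B.exists_min_image (fun p => p.1)
    ⟨p₀, Finset.mem_filter.2 ⟨hp₀, s₀, hs₀⟩⟩
  obtain ⟨hp, s, hs, hal, hlt⟩ := Finset.mem_filter.1 hpB
  obtain ⟨c, hc, hca⟩ := P.exists_alive H ht (position f X Y t p.1)
  have hcs : c < s := P.lt_of_position_lt H ht hca hal (hc ▸ hlt)
  rcases le_or_gt p.1 c with h1 | h1
  · have e1 := charValue_le P H hC hp ⟨h1, (hcs.trans hs.2).le⟩ hc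
    rw [charValue_eq P H hC hp] at e1
    have e0 : position f X Y t p.2 = position f X Y t p.1 := (hC.vertical p hp).symm
    have e2 := P.alive_of_le H ht hca (s' := p.2) (by rw [hc]; exact e0) e1
    exact absurd (P.lt_of_position_lt H ht e2 hal (by rw [e0]; exact hlt)) (not_lt.2 hs.2.le)
  · have hin : ∃ q ∈ C, c ∈ Ioo q.1 q.2 := by
      by_contra! hno
      have : (c, p.1) ∈ C := by
        by_contra hnot
        have := hC.graph c p.1 h1 hno (hC.remaining_left hp) hnot
        exact absurd hc this.ne
      have hne : (c, p.1) ≠ p := fun h => by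
        have h2 := congrArg Prod.fst h
        simp only at h2
        exact h1.ne h2
      exact disjoint_left.1 (hC.disjoint _ this p hp hne) (right_mem_Icc.2 h1.le)
        (left_mem_Icc.2 (hC.lt p hp).le)
    obtain ⟨q, hq, hcq⟩ := hin
    have hqp : q ≠ p := by rintro rfl; exact absurd hcq.1 (not_lt.2 h1.le)
    have hq2 : q.2 < p.1 := by
      by_contra! hle
      exact disjoint_left.1 (hC.disjoint q hq p hp hqp) ⟨(hcq.1.trans h1).le, hle⟩
        (left_mem_Icc.2 (hC.lt p hp).le)
    have hnot : (q.2, p.1) ∉ C := fun hmem => by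
      have hne : (q.2, p.1) ≠ p := fun h => by
        have h2 := congrArg Prod.fst h
        simp only at h2
        exact hq2.ne h2
      exact disjoint_left.1 (hC.disjoint _ hmem p hp hne) (right_mem_Icc.2 hq2.le)
        (left_mem_Icc.2 (hC.lt p hp).le)
    have hlt' : position f X Y t q.2 < position f X Y t p.1 :=
      hC.graph q.2 p.1 hq2 (hC.remaining_right hq) (hC.remaining_left hp) hnot
    have hv : position f X Y t q.1 = position f X Y t q.2 := hC.vertical q hq
    have := hmin q (Finset.mem_filter.2 ⟨hq, c, hcq, hca, by rw [hv, hc]; exact hlt'⟩)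
    linarith [hC.lt q hq]

/-- The mirror image of `not_right`: the rightmost offending cut, with its left end made alive. -/
theorem not_left (P : IsParametrization h X Y) (H : Admissible f h K) (ht : 0 < t)
    (hC : IsEqualAreaCut (fun s => X s + deriv f (Y s) * t) Y C) :
    ∀ p ∈ C, ∀ s ∈ Ioo p.1 p.2, Alive f h K (X s, Y s) t →
      ¬ position f X Y t s < position f X Y t p.1 := by
  classical
  by_contra! hcon
  obtain ⟨p₀, hp₀, s₀, hs₀⟩ := hcon
  set B := C.filter fun p => ∃ s ∈ Ioo p.1 p.2, Alive f h K (X s, Y s) t ∧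
    position f X Y t s < position f X Y t p.1 with hB
  obtain ⟨p, hpB, hmax⟩ := B.exists_max_image (fun p => p.2)
    ⟨p₀, Finset.mem_filter.2 ⟨hp₀, s₀, hs₀⟩⟩
  obtain ⟨hp, s, hs, hal, hlt⟩ := Finset.mem_filter.1 hpB
  obtain ⟨c, hc, hca⟩ := P.exists_alive H ht (position f X Y t p.1)
  have hcs : s < c := P.lt_of_position_lt H ht hal hca (hc ▸ hlt)
  have e0 : position f X Y t p.1 = position f X Y t p.2 := hC.vertical p hp
  rcases le_or_gt c p.2 with h1 | h1
  · have e1 := charValue_le P H hC hp ⟨(hs.1.trans hcs).le, h1⟩ hc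
    have e2 := P.alive_of_le H ht hca (s' := p.1) hc.symm e1
    exact absurd (P.lt_of_position_lt H ht hal e2 hlt) (not_lt.2 hs.1.le)
  · have hin : ∃ q ∈ C, c ∈ Ioo q.1 q.2 := by
      by_contra! hno
      have : (p.2, c) ∈ C := by
        by_contra hnot
        have := hC.graph p.2 c h1 (hC.remaining_right hp) hno hnot
        exact absurd (hc.trans e0) this.ne'
      have hne : (p.2, c) ≠ p := fun h => by
        have h2 := congrArg Prod.snd h
        simp only at h2
        exact h1.ne' h2
      exact disjoint_left.1 (hC.disjoint _ this p hp hne) (left_mem_Icc.2 h1.le)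
        (right_mem_Icc.2 (hC.lt p hp).le)
    obtain ⟨q, hq, hcq⟩ := hin
    have hqp : q ≠ p := by rintro rfl; exact absurd hcq.2 (not_lt.2 h1.le)
    have hq2 : p.2 < q.1 := by
      by_contra! hle
      exact disjoint_left.1 (hC.disjoint q hq p hp hqp) ⟨hle, (h1.trans hcq.2).le⟩
        (right_mem_Icc.2 (hC.lt p hp).le)
    have hnot : (p.2, q.1) ∉ C := fun hmem => by
      have hne : (p.2, q.1) ≠ p := fun h => by
        have h2 := congrArg Prod.snd h
        simp only at h2
        exact hq2.ne' h2
      exact disjoint_left.1 (hC.disjoint _ hmem p hp hne) (left_mem_Icc.2 hq2.le)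
        (right_mem_Icc.2 (hC.lt p hp).le)
    have hlt' : position f X Y t p.2 < position f X Y t q.1 :=
      hC.graph p.2 q.1 hq2 (hC.remaining_right hp) (hC.remaining_left hq) hnot
    have := hmax q (Finset.mem_filter.2 ⟨hq, c, hcq, hca, by rw [hc, e0]; exact hlt'⟩)
    linarith [hC.lt q hq]

/-- The points that remain after equal-area cuts are optimal. -/
theorem alive_of_remaining (P : IsParametrization h X Y) (H : Admissible f h K) (ht : 0 < t)
    (hC : IsEqualAreaCut (fun s => X s + deriv f (Y s) * t) Y C) {s : ℝ}
    (hs : ∀ p ∈ C, s ∉ Ioo p.1 p.2) : Alive f h K (X s, Y s) t := by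
  -- Two different remaining parameters at one position must be the ends of a cut, and these have
  -- equal transported values.
  have key : ∀ c, (∀ p ∈ C, c ∉ Ioo p.1 p.2) → position f X Y t c = position f X Y t s →
      Alive f h K (X c, Y c) t → Alive f h K (X s, Y s) t := by
    intro c hno hc hca
    rcases lt_trichotomy c s with h1 | rfl | h1
    · have hmem : (c, s) ∈ C := by
        by_contra hnot
        exact absurd hc (hC.graph c s h1 hno hs hnot).ne
      exact P.alive_of_le H ht hca hc.symm (charValue_eq P H hC hmem).le
    · exact hca
    · have hmem : (s, c) ∈ C := by
        by_contra hnot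
        exact absurd hc (hC.graph s c h1 hs hno hnot).ne'
      exact P.alive_of_le H ht hca hc.symm (charValue_eq P H hC hmem).ge
  obtain ⟨c, hc, hca⟩ := P.exists_alive H ht (position f X Y t s)
  by_cases hno : ∀ p ∈ C, c ∉ Ioo p.1 p.2
  · exact key c hno hc hca
  · push Not at hno
    obtain ⟨p, hp, hcp⟩ := hno
    -- An alive point inside a cut lies on the line of the cut, where the left end is at least as
    -- good and can replace it.
    have e1 : position f X Y t c = position f X Y t p.1 :=
      le_antisymm (not_lt.1 (not_right P H ht hC p hp c hcp hca))
        (not_lt.1 (not_left P H ht hC p hp c hcp hca))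
    have e2 := charValue_le P H hC hp (Ioo_subset_Icc_self hcp) e1
    exact key p.1 (hC.remaining_left hp) (e1 ▸ hc) (P.alive_of_le H ht hca e1.symm e2)

end IsEqualAreaCut

variable {f h : ℝ → ℝ} {K : ℝ}

/-- `u` is the field of slopes of optimal paths at all positive times. -/
def IsOptField (f h : ℝ → ℝ) (K : ℝ) (u : ℝ → ℝ → ℝ) : Prop :=
  ∀ t, 0 < t → ∀ z, ∃ X, IsOpt f h K X z t ∧ u z t = slopeOf f K (z - X) t

theorem IsEqualAreaSolution.isOptField {u : ℝ → ℝ → ℝ} (hu : IsEqualAreaSolution f h u)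
    (H : Admissible f h K) : IsOptField f h K u := by
  intro t ht z
  obtain ⟨X, Y, C, P, hC, hw⟩ := hu.profile t ht
  obtain ⟨s, hs, hz, hY⟩ := hw z
  have ha := IsEqualAreaCut.alive_of_remaining P H ht hC hs
  refine ⟨X s, ?_, ?_⟩
  · rw [← hz]; exact ha
  · have h1 : slopeOf f K (z - X s) t = Y s := hz ▸ P.slopeOf_eq H ht s
    exact h1 ▸ hY.symm

end EqualArea

/-! ### An explicit parametrization, with a unit parameter interval for every jump -/

namespace EqualArea
open Function

/-! ### A parametrization of the completed graph -/

/-- The parameter at which the vertical line over `x` is reached. -/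
noncomputable def arrival (D : Finset ℝ) (x : ℝ) : ℝ := x + (D.filter (· < x)).card

/-- The parameter at which the vertical line over `x` is left. -/
noncomputable def departure (D : Finset ℝ) (x : ℝ) : ℝ := x + (D.filter (· ≤ x)).card

section ArrivalDeparture

variable {D : Finset ℝ} {x x' s : ℝ}

theorem departure_eq_of_notMem (hx : x ∉ D) : departure D x = arrival D x := by
  unfold departure arrival
  congr 3
  ext y
  simp only [Finset.mem_filter, and_congr_right_iff]
  exact fun hy => ⟨fun h => lt_of_le_of_ne h fun e => hx (e ▸ hy), le_of_lt⟩

theorem departure_eq_of_mem (hx : x ∈ D) : departure D x = arrival D x + 1 := by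
  unfold departure arrival
  have : D.filter (· ≤ x) = insert x (D.filter (· < x)) := by
    ext y
    simp only [Finset.mem_filter, Finset.mem_insert, le_iff_lt_or_eq]
    constructor
    · rintro ⟨h1, h2 | h2⟩
      · exact Or.inr ⟨h1, h2⟩
      · exact Or.inl h2
    · rintro (h | h)
      · exact ⟨h ▸ hx, Or.inr h⟩
      · exact ⟨h.1, Or.inl h.2⟩
  rw [this, Finset.card_insert_of_notMem (by simp)]
  push_cast; ring

theorem arrival_le_departure (D : Finset ℝ) (x : ℝ) : arrival D x ≤ departure D x := by
  by_cases hx : x ∈ D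
  · rw [departure_eq_of_mem hx]; linarith
  · rw [departure_eq_of_notMem hx]

theorem departure_lt_arrival (h : x < x') : departure D x < arrival D x' := by
  unfold departure arrival
  have : (D.filter (· ≤ x)).card ≤ (D.filter (· < x')).card :=
    Finset.card_le_card fun y hy => by
      rw [Finset.mem_filter] at hy ⊢; exact ⟨hy.1, hy.2.trans_lt h⟩
  have : ((D.filter (· ≤ x)).card : ℝ) ≤ (D.filter (· < x')).card := by exact_mod_cast this
  linarith

theorem eventually_left (D : Finset ℝ) (x : ℝ) :
    ∀ᶠ z in 𝓝[<] x, z ∉ D ∧ arrival D z = arrival D x - (x - z) := by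
  have h1 : ∀ᶠ z in 𝓝[<] x, ∀ η ∈ D, η < x → η < z := by
    rw [Filter.eventually_all_finset]
    intro η _
    by_cases h : η < x
    · exact (eventually_gt_nhds h).filter_mono nhdsWithin_le_nhds |>.mono fun z hz _ => hz
    · exact Eventually.of_forall fun z h' => absurd h' h
  filter_upwards [h1, self_mem_nhdsWithin] with z hz hzx
  have hzx : z < x := hzx
  refine ⟨fun hzD => lt_irrefl _ (hz z hzD hzx), ?_⟩
  unfold arrival
  have : D.filter (· < z) = D.filter (· < x) := by
    ext η
    simp only [Finset.mem_filter, and_congr_right_iff]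
    exact fun hη => ⟨fun h => h.trans hzx, hz η hη⟩
  rw [this]; ring

theorem eventually_right (D : Finset ℝ) (x : ℝ) :
    ∀ᶠ z in 𝓝[>] x, z ∉ D ∧ arrival D z = departure D x + (z - x) := by
  have h1 : ∀ᶠ z in 𝓝[>] x, ∀ η ∈ D, x < η → z < η := by
    rw [Filter.eventually_all_finset]
    intro η _
    by_cases h : x < η
    · exact (eventually_lt_nhds h).filter_mono nhdsWithin_le_nhds |>.mono fun z hz _ => hz
    · exact Eventually.of_forall fun z h' => absurd h' h
  filter_upwards [h1, self_mem_nhdsWithin] with z hz hzx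
  have hzx : x < z := hzx
  refine ⟨fun hzD => lt_irrefl _ (hz z hzD hzx), ?_⟩
  unfold arrival departure
  have : D.filter (· < z) = D.filter (· ≤ x) := by
    ext η
    simp only [Finset.mem_filter, and_congr_right_iff]
    exact fun hη => ⟨fun h => le_of_not_gt fun h' => lt_asymm h (hz η hη h'), fun h => h.trans_lt hzx⟩
  rw [this]; ring

/-- `arrival` increases with slope 1 off `D` and jumps by 1 at each point of `D`, exactly from
`arrival` to `departure`. The supremum of the abscissas reached by parameter `s` is the one sought.
-/
theorem exists_between (D : Finset ℝ) (s : ℝ) : ∃ x, arrival D x ≤ s ∧ s ≤ departure D x := by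
  set B := {x | arrival D x ≤ s}
  have hne : B.Nonempty := by
    refine ⟨s - D.card, ?_⟩
    have : ((D.filter (· < s - D.card)).card : ℝ) ≤ D.card := by
      exact_mod_cast Finset.card_filter_le _ _
    change s - D.card + ((D.filter (· < s - D.card)).card : ℝ) ≤ s
    linarith
  have hbdd : BddAbove B := by
    refine ⟨s, fun x hx => ?_⟩
    have hx : x + ((D.filter (· < x)).card : ℝ) ≤ s := hx
    have : (0 : ℝ) ≤ (D.filter (· < x)).card := Nat.cast_nonneg _
    linarith
  refine ⟨sSup B, ?_, ?_⟩
  · by_contra! hlt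
    have h1 : ∀ᶠ z in 𝓝[<] sSup B, sSup B - (arrival D (sSup B) - s) < z :=
      (eventually_gt_nhds (by linarith)).filter_mono nhdsWithin_le_nhds
    obtain ⟨z, ⟨hz1, -, hz2⟩, hz3⟩ :=
      ((h1.and (eventually_left D (sSup B))).and self_mem_nhdsWithin).exists
    obtain ⟨x, hxB, hx⟩ := exists_lt_of_lt_csSup hne (show z < sSup B from hz3)
    have h2 := (arrival_le_departure D z).trans (departure_lt_arrival (D := D) hx).le
    have h3 : arrival D x ≤ s := hxB
    linarith
  · by_contra! hlt
    have h1 : ∀ᶠ z in 𝓝[>] sSup B, z < sSup B + (s - departure D (sSup B)) :=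
      (eventually_lt_nhds (by linarith)).filter_mono nhdsWithin_le_nhds
    obtain ⟨z, ⟨hz1, -, hz2⟩, hz3⟩ :=
      ((h1.and (eventually_right D (sSup B))).and self_mem_nhdsWithin).exists
    have : z ∈ B := by change arrival D z ≤ s; linarith
    exact absurd (le_csSup hbdd this) (not_le.2 hz3)

end ArrivalDeparture

/-- The abscissa of the curve point with parameter `s`. -/
noncomputable def paramX (D : Finset ℝ) (s : ℝ) : ℝ := (exists_between D s).choose

/-- The ordinate of the curve point with parameter `s`. -/
noncomputable def paramY (h : ℝ → ℝ) (D : Finset ℝ) (s : ℝ) : ℝ :=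
  leftLim h (paramX D s) +
    (rightLim h (paramX D s) - leftLim h (paramX D s)) * (s - arrival D (paramX D s))

section Param

variable {D : Finset ℝ} {x s s₀ : ℝ} {h : ℝ → ℝ}

theorem paramX_spec (D : Finset ℝ) (s : ℝ) :
    arrival D (paramX D s) ≤ s ∧ s ≤ departure D (paramX D s) := (exists_between D s).choose_spec

theorem paramX_eq_iff : paramX D s = x ↔ arrival D x ≤ s ∧ s ≤ departure D x := by
  constructor
  · rintro rfl; exact paramX_spec D s
  · rintro ⟨h1, h2⟩
    obtain ⟨h3, h4⟩ := paramX_spec D s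
    rcases lt_trichotomy (paramX D s) x with h | h | h
    · have := departure_lt_arrival (D := D) h; linarith
    · exact h
    · have := departure_lt_arrival (D := D) h; linarith

theorem monotone_paramX (D : Finset ℝ) : Monotone (paramX D) := by
  intro s s' hs
  by_contra! hlt
  have := departure_lt_arrival (D := D) hlt
  have h1 := paramX_spec D s
  have h2 := paramX_spec D s'
  linarith

theorem paramY_of_eq (hx : paramX D s = x) :
    paramY h D s = leftLim h x + (rightLim h x - leftLim h x) * (s - arrival D x) := by
  rw [paramY, hx]

theorem tendsto_right_aux (x s₀ : ℝ) : Tendsto (fun s => x + (s - s₀)) (𝓝[>] s₀) (𝓝[>] x) := by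
  refine tendsto_nhdsWithin_iff.2 ⟨?_, eventually_mem_nhdsWithin.mono fun s hs => ?_⟩
  · have : Continuous fun s => x + (s - s₀) := by fun_prop
    have := this.tendsto s₀
    rw [sub_self, add_zero] at this
    exact this.mono_left nhdsWithin_le_nhds
  · have : s₀ < s := hs
    simp only [mem_Ioi]; linarith

theorem tendsto_left_aux (x s₀ : ℝ) : Tendsto (fun s => x + (s - s₀)) (𝓝[<] s₀) (𝓝[<] x) := by
  refine tendsto_nhdsWithin_iff.2 ⟨?_, eventually_mem_nhdsWithin.mono fun s hs => ?_⟩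
  · have : Continuous fun s => x + (s - s₀) := by fun_prop
    have := this.tendsto s₀
    rw [sub_self, add_zero] at this
    exact this.mono_left nhdsWithin_le_nhds
  · have : s < s₀ := hs
    simp only [mem_Iio]; linarith

/-- To the right of any parameter the curve is vertical or a graph. -/
theorem right_germ (hh : PiecewiseC1 h) (hD : ∀ x, x ∉ D → leftLim h x = rightLim h x) (s₀ : ℝ) :
    (paramX D s₀ ∈ D ∧ ∀ᶠ s in 𝓝[>] s₀, paramX D s = paramX D s₀ ∧ paramY h D s =
      paramY h D s₀ + (rightLim h (paramX D s₀) - leftLim h (paramX D s₀)) * (s - s₀)) ∨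
    (paramY h D s₀ = rightLim h (paramX D s₀) ∧
      ∀ᶠ s in 𝓝[>] s₀, paramX D s = paramX D s₀ + (s - s₀) ∧
        paramY h D s = h (paramX D s) ∧ ContDiffAt ℝ 1 h (paramX D s)) := by
  obtain ⟨h1, h2⟩ := paramX_spec D s₀
  set x := paramX D s₀ with hx
  rcases h2.lt_or_eq with h2 | h2
  · left
    constructor
    · by_contra hxD
      rw [departure_eq_of_notMem hxD] at h2
      linarith
    · have : ∀ᶠ s in 𝓝[>] s₀, s < departure D x :=
        (eventually_lt_nhds h2).filter_mono nhdsWithin_le_nhds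
      filter_upwards [this, self_mem_nhdsWithin] with s hs hs'
      have hs' : s₀ < s := hs'
      have e : paramX D s = x := paramX_eq_iff.2 ⟨h1.trans hs'.le, hs.le⟩
      refine ⟨e, ?_⟩
      rw [paramY_of_eq e, paramY_of_eq hx.symm]; ring
  · right
    constructor
    · rw [paramY_of_eq hx.symm]
      by_cases hxD : x ∈ D
      · rw [h2, departure_eq_of_mem hxD]; ring
      · rw [hD x hxD]; ring
    · have t1 := tendsto_right_aux x s₀
      have t2 : ∀ᶠ z in 𝓝[>] x, ContDiffAt ℝ 1 h z := (hh.eventually_contDiffAt x).filter_mono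
        (nhdsWithin_mono _ fun _ hz => ne_of_gt hz)
      filter_upwards [t1.eventually (eventually_right D x), t1.eventually t2] with s hs hs'
      have e : paramX D s = x + (s - s₀) := by
        refine paramX_eq_iff.2 ⟨by rw [hs.2]; linarith, ?_⟩
        rw [departure_eq_of_notMem hs.1, hs.2]; linarith
      rw [e]
      refine ⟨rfl, ?_, hs'⟩
      rw [paramY_of_eq e, ← hD _ hs.1, sub_self, zero_mul, add_zero]
      exact Admissible.leftLim_eq_of_continuousAt hs'.continuousAt

/-- To the left of any parameter the curve is vertical or a graph. -/
theorem left_germ (hh : PiecewiseC1 h) (hD : ∀ x, x ∉ D → leftLim h x = rightLim h x) (s₀ : ℝ) :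
    (paramX D s₀ ∈ D ∧ ∀ᶠ s in 𝓝[<] s₀, paramX D s = paramX D s₀ ∧ paramY h D s =
      paramY h D s₀ + (rightLim h (paramX D s₀) - leftLim h (paramX D s₀)) * (s - s₀)) ∨
    (paramY h D s₀ = leftLim h (paramX D s₀) ∧
      ∀ᶠ s in 𝓝[<] s₀, paramX D s = paramX D s₀ + (s - s₀) ∧
        paramY h D s = h (paramX D s) ∧ ContDiffAt ℝ 1 h (paramX D s)) := by
  obtain ⟨h1, h2⟩ := paramX_spec D s₀
  set x := paramX D s₀ with hx
  rcases h1.lt_or_eq with h1 | h1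
  · left
    constructor
    · by_contra hxD
      rw [departure_eq_of_notMem hxD] at h2
      linarith
    · have : ∀ᶠ s in 𝓝[<] s₀, arrival D x < s :=
        (eventually_gt_nhds h1).filter_mono nhdsWithin_le_nhds
      filter_upwards [this, self_mem_nhdsWithin] with s hs hs'
      have hs' : s < s₀ := hs'
      have e : paramX D s = x := paramX_eq_iff.2 ⟨hs.le, hs'.le.trans h2⟩
      refine ⟨e, ?_⟩
      rw [paramY_of_eq e, paramY_of_eq hx.symm]; ring
  · right
    constructor
    · rw [paramY_of_eq hx.symm, h1]; ring
    · have t1 := tendsto_left_aux x s₀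
      have t2 : ∀ᶠ z in 𝓝[<] x, ContDiffAt ℝ 1 h z := (hh.eventually_contDiffAt x).filter_mono
        (nhdsWithin_mono _ fun _ hz => ne_of_lt hz)
      filter_upwards [t1.eventually (eventually_left D x), t1.eventually t2] with s hs hs'
      have e : paramX D s = x + (s - s₀) := by
        refine paramX_eq_iff.2 ⟨by rw [hs.2]; linarith, ?_⟩
        rw [departure_eq_of_notMem hs.1, hs.2]; linarith
      rw [e]
      refine ⟨rfl, ?_, hs'⟩
      rw [paramY_of_eq e, ← hD _ hs.1, sub_self, zero_mul, add_zero]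
      exact Admissible.leftLim_eq_of_continuousAt hs'.continuousAt

/-- One-sided limits of the parametrization and its derivative, from an affine or graph germ. -/
theorem germ_limits {l m : Filter ℝ} {X Y : ℝ → ℝ} {x₀ y₀ : ℝ}
    (hl : ∀ p : ℝ → Prop, (∀ᶠ s in l, p s) → ∀ᶠ s in l, ∀ᶠ u in 𝓝 s, p u) (hls : l ≤ 𝓝 s₀)
    (hm : Tendsto (fun s => x₀ + (s - s₀)) l m)
    (hd : ∃ d, Tendsto (deriv h) m (𝓝 d))
    (hg : (∃ c, ∀ᶠ s in l, X s = x₀ ∧ Y s = y₀ + c * (s - s₀)) ∨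
      (Tendsto h m (𝓝 y₀) ∧ ∀ᶠ s in l, X s = x₀ + (s - s₀) ∧ Y s = h (X s) ∧
        ContDiffAt ℝ 1 h (X s))) :
    Tendsto X l (𝓝 x₀) ∧ Tendsto Y l (𝓝 y₀) ∧ (∃ d, Tendsto (deriv X) l (𝓝 d)) ∧
      ∃ d, Tendsto (deriv Y) l (𝓝 d) := by
  have hlin : ∀ a c : ℝ, Tendsto (fun s => a + c * (s - s₀)) l (𝓝 a) := by
    intro a c
    have : Continuous fun s => a + c * (s - s₀) := by fun_prop
    have := this.tendsto s₀
    rw [sub_self, mul_zero, add_zero] at this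
    exact this.mono_left hls
  have hder : ∀ a c s : ℝ, HasDerivAt (fun s => a + c * (s - s₀)) c s := by
    intro a c s
    simpa using (((hasDerivAt_id s).sub_const s₀).const_mul c).const_add a
  rcases hg with ⟨c, hg⟩ | ⟨hhl, hg⟩
  · refine ⟨tendsto_const_nhds.congr' (hg.mono fun s hs => hs.1.symm),
      (hlin y₀ c).congr' (hg.mono fun s hs => hs.2.symm), ⟨0, ?_⟩, ⟨c, ?_⟩⟩
    · refine tendsto_const_nhds.congr' ((hl _ hg).mono fun s hs => ?_)
      have : X =ᶠ[𝓝 s] fun _ => x₀ := hs.mono fun u hu => hu.1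
      rw [this.deriv_eq, deriv_const]
    · refine tendsto_const_nhds.congr' ((hl _ hg).mono fun s hs => ?_)
      have : Y =ᶠ[𝓝 s] fun u => y₀ + c * (u - s₀) := hs.mono fun u hu => hu.2
      rw [this.deriv_eq, (hder y₀ c s).deriv]
  · have hX : Tendsto X l (𝓝 x₀) := by
      have := (hlin x₀ 1).congr' (hg.mono fun s hs => show x₀ + 1 * (s - s₀) = X s by
        rw [hs.1, one_mul])
      exact this
    obtain ⟨d, hd⟩ := hd
    refine ⟨hX, ?_, ⟨1, ?_⟩, ⟨d, ?_⟩⟩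
    · refine (hhl.comp hm).congr' (hg.mono fun s hs => ?_)
      rw [comp_apply, hs.2.1, hs.1]
    · refine tendsto_const_nhds.congr' ((hl _ hg).mono fun s hs => ?_)
      have : X =ᶠ[𝓝 s] fun u => x₀ + 1 * (u - s₀) := hs.mono fun u hu => by simpa using hu.1
      rw [this.deriv_eq, (hder x₀ 1 s).deriv]
    · refine (hd.comp hm).congr' (((hl _ hg).and hg).mono fun s hs => ?_)
      have : Y =ᶠ[𝓝 s] fun u => h (x₀ + 1 * (u - s₀)) := hs.1.mono fun u hu => by
        simp only [one_mul]
        rw [hu.2.1, hu.1]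
      have h2 : HasDerivAt h (deriv h (X s)) (x₀ + 1 * (s - s₀)) := by
        rw [one_mul, ← hs.2.1]
        exact (hs.2.2.2.differentiableAt (by norm_num)).hasDerivAt
      have h3 := h2.comp s (hder x₀ 1 s)
      rw [this.deriv_eq]
      simp only [comp_apply]
      rw [show (fun u => h (x₀ + 1 * (u - s₀))) = h ∘ fun u => x₀ + 1 * (u - s₀) from rfl,
        h3.deriv, mul_one, hs.2.1]

/-- A parametrization that is, off a finite set, locally a graph or a vertical segment. -/
structure RegularParam (h X Y : ℝ → ℝ) (E : Finset ℝ) : Prop extends IsParametrization h X Y where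
  regular : ∀ s, s ∉ E →
    (ContDiffAt ℝ 1 h (X s) ∧ ∀ᶠ u in 𝓝 s, X u = X s + (u - s) ∧ Y u = h (X u)) ∨
      ∃ c, c ≠ 0 ∧ ∀ᶠ u in 𝓝 s, X u = X s ∧ Y u = Y s + c * (u - s)
  -- Consequently a parameter interval that avoids `E` lies entirely over such a `ξ` or misses it.
  levels : ∀ ξ, ¬ ContDiffAt ℝ 1 h ξ → ∃ α ∈ E, ∃ β ∈ E, ∀ s, X s = ξ ↔ α ≤ s ∧ s ≤ β

theorem paramY_continuous_piecewise (hh : PiecewiseC1 h)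
    (hD : ∀ x, x ∉ D → leftLim h x = rightLim h x) (s₀ : ℝ) :
    (Tendsto (paramX D) (𝓝[<] s₀) (𝓝 (paramX D s₀)) ∧
      Tendsto (paramY h D) (𝓝[<] s₀) (𝓝 (paramY h D s₀)) ∧
      (∃ d, Tendsto (deriv (paramX D)) (𝓝[<] s₀) (𝓝 d)) ∧
      ∃ d, Tendsto (deriv (paramY h D)) (𝓝[<] s₀) (𝓝 d)) ∧
    (Tendsto (paramX D) (𝓝[>] s₀) (𝓝 (paramX D s₀)) ∧
      Tendsto (paramY h D) (𝓝[>] s₀) (𝓝 (paramY h D s₀)) ∧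
      (∃ d, Tendsto (deriv (paramX D)) (𝓝[>] s₀) (𝓝 d)) ∧
      ∃ d, Tendsto (deriv (paramY h D)) (𝓝[>] s₀) (𝓝 d)) := by
  constructor
  · refine germ_limits (h := h) (m := 𝓝[<] (paramX D s₀)) (fun p hp => ?_) nhdsWithin_le_nhds
      (tendsto_left_aux _ _) (hh.exists_tendsto _).2.2.1 ?_
    · filter_upwards [eventually_eventually_nhdsWithin.2 hp, self_mem_nhdsWithin] with s hs hs'
      rwa [isOpen_Iio.nhdsWithin_eq hs'] at hs
    · rcases left_germ hh hD s₀ with ⟨-, hg⟩ | ⟨e, hg⟩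
      · exact Or.inl ⟨_, hg⟩
      · exact Or.inr ⟨e ▸ hh.tendsto_leftLim _, hg⟩
  · refine germ_limits (h := h) (m := 𝓝[>] (paramX D s₀)) (fun p hp => ?_) nhdsWithin_le_nhds
      (tendsto_right_aux _ _) (hh.exists_tendsto _).2.2.2 ?_
    · filter_upwards [eventually_eventually_nhdsWithin.2 hp, self_mem_nhdsWithin] with s hs hs'
      rwa [isOpen_Ioi.nhdsWithin_eq hs'] at hs
    · rcases right_germ hh hD s₀ with ⟨-, hg⟩ | ⟨e, hg⟩
      · exact Or.inl ⟨_, hg⟩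
      · exact Or.inr ⟨e ▸ hh.tendsto_rightLim _, hg⟩

theorem continuous_of_sides {g : ℝ → ℝ} (hl : ∀ s, Tendsto g (𝓝[<] s) (𝓝 (g s)))
    (hr : ∀ s, Tendsto g (𝓝[>] s) (𝓝 (g s))) : Continuous g := by
  refine continuous_iff_continuousAt.2 fun s => ?_
  rw [continuousAt_iff_punctured_nhds, ← nhdsLT_sup_nhdsGT]
  exact (hl s).sup (hr s)

theorem regular_cases (hh : PiecewiseC1 h) (hD : ∀ x, x ∉ D → leftLim h x = rightLim h x)
    (hDj : ∀ x ∈ D, leftLim h x ≠ rightLim h x) {s₀ : ℝ}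
    (ha : ¬ ContDiffAt ℝ 1 h (paramX D s₀) → s₀ ≠ arrival D (paramX D s₀))
    (hb : ¬ ContDiffAt ℝ 1 h (paramX D s₀) → s₀ ≠ departure D (paramX D s₀)) :
    (ContDiffAt ℝ 1 h (paramX D s₀) ∧ ∀ᶠ u in 𝓝 s₀, paramX D u = paramX D s₀ + (u - s₀) ∧
      paramY h D u = h (paramX D u)) ∨
    ∃ c, c ≠ 0 ∧ ∀ᶠ u in 𝓝 s₀, paramX D u = paramX D s₀ ∧
      paramY h D u = paramY h D s₀ + c * (u - s₀) := by
  obtain ⟨h1, h2⟩ := paramX_spec D s₀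
  by_cases hc : ContDiffAt ℝ 1 h (paramX D s₀)
  · left
    refine ⟨hc, ?_⟩
    have e1 := Admissible.leftLim_eq_of_continuousAt hc.continuousAt
    have e2 := Admissible.rightLim_eq_of_continuousAt hc.continuousAt
    have hnD : paramX D s₀ ∉ D := fun hmem => hDj _ hmem (e1.trans e2.symm)
    rcases left_germ hh hD s₀ with ⟨hmem, -⟩ | ⟨e, hg⟩
    · exact absurd hmem hnD
    rcases right_germ hh hD s₀ with ⟨hmem, -⟩ | ⟨-, hg'⟩
    · exact absurd hmem hnD
    rw [eventually_nhdsWithin_iff] at hg hg'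
    filter_upwards [hg, hg'] with u hu hu'
    rcases lt_trichotomy u s₀ with hlt | rfl | hlt
    · exact ⟨(hu hlt).1, (hu hlt).2.1⟩
    · exact ⟨by ring, by rw [e, e1]⟩
    · exact ⟨(hu' hlt).1, (hu' hlt).2.1⟩
  · right
    have h1 := h1.lt_of_ne (ha hc).symm
    have h2 := h2.lt_of_ne (hb hc)
    have hmem : paramX D s₀ ∈ D := by
      by_contra hmem
      rw [departure_eq_of_notMem hmem] at h2
      linarith
    refine ⟨rightLim h (paramX D s₀) - leftLim h (paramX D s₀),
      sub_ne_zero.2 (hDj _ hmem).symm, ?_⟩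
    filter_upwards [Ioo_mem_nhds h1 h2] with u hu
    have e : paramX D u = paramX D s₀ := paramX_eq_iff.2 ⟨hu.1.le, hu.2.le⟩
    refine ⟨e, ?_⟩
    rw [paramY_of_eq e, paramY_of_eq rfl]; ring

theorem exists_regularParam (hh : PiecewiseC1 h) : ∃ X Y E, RegularParam h X Y E := by
  classical
  obtain ⟨S, hS, -⟩ := id hh
  -- Only abscissas with different one-sided limits get a parameter interval of their own; kinks and
  -- removable discontinuities are passed without a stop.
  set D := S.filter fun x => leftLim h x ≠ rightLim h x with hDdef
  have hDj : ∀ x ∈ D, leftLim h x ≠ rightLim h x := fun x hx => (Finset.mem_filter.1 hx).2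
  have hD : ∀ x, x ∉ D → leftLim h x = rightLim h x := by
    intro x hx
    by_contra hne
    by_cases hxS : x ∈ S
    · exact hx (Finset.mem_filter.2 ⟨hxS, hne⟩)
    · exact hne ((Admissible.leftLim_eq_of_continuousAt (hS x hxS).continuousAt).trans
        (Admissible.rightLim_eq_of_continuousAt (hS x hxS).continuousAt).symm)
  have hside := paramY_continuous_piecewise hh hD
  have hcX : Continuous (paramX D) := continuous_of_sides (fun s => (hside s).1.1)
    fun s => (hside s).2.1
  have hcY : Continuous (paramY h D) := continuous_of_sides (fun s => (hside s).1.2.1)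
    fun s => (hside s).2.2.1
  set E := S.image (arrival D) ∪ S.image (departure D) with hE
  have hSx : ∀ x, ¬ ContDiffAt ℝ 1 h x → x ∈ S := fun x hx => by
    by_contra hxS; exact hx (hS x hxS)
  have hreg : ∀ s, s ∉ E → _ := fun s hs => regular_cases hh hD hDj (s₀ := s)
    (fun hc e => hs (Finset.mem_union_left _ (Finset.mem_image.2 ⟨_, hSx _ hc, e.symm⟩)))
    (fun hc e => hs (Finset.mem_union_right _ (Finset.mem_image.2 ⟨_, hSx _ hc, e.symm⟩)))
  have hsmooth : ∀ s, s ∉ E → ContDiffAt ℝ 1 (paramX D) s ∧ ContDiffAt ℝ 1 (paramY h D) s := by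
    intro s hs
    rcases hreg s hs with ⟨hc, hev⟩ | ⟨c, -, hev⟩
    · have hX : paramX D =ᶠ[𝓝 s] fun u => paramX D s + (u - s) := hev.mono fun u hu => hu.1
      have hY : paramY h D =ᶠ[𝓝 s] h ∘ fun u => paramX D s + (u - s) := hev.mono fun u hu => by
        rw [hu.2, hu.1]; rfl
      have hlin : ContDiffAt ℝ 1 (fun u => paramX D s + (u - s)) s := by fun_prop
      refine ⟨hlin.congr_of_eventuallyEq hX, ContDiffAt.congr_of_eventuallyEq ?_ hY⟩
      refine ContDiffAt.comp s ?_ hlin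
      rwa [sub_self, add_zero]
    · have hX : paramX D =ᶠ[𝓝 s] fun _ => paramX D s := hev.mono fun u hu => hu.1
      have hY : paramY h D =ᶠ[𝓝 s] fun u => paramY h D s + c * (u - s) := hev.mono fun u hu => hu.2
      exact ⟨contDiffAt_const.congr_of_eventuallyEq hX, ContDiffAt.congr_of_eventuallyEq
        (by fun_prop) hY⟩
  refine ⟨paramX D, paramY h D, E, ⟨hcX, hcY, ?_, ?_, monotone_paramX D, ?_, ?_⟩, hreg, ?_⟩
  · exact ⟨E, fun s hs => (hsmooth s hs).1, fun s _ => ⟨⟨_, (hside s).1.1⟩, ⟨_, (hside s).2.1⟩,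
      (hside s).1.2.2.1, (hside s).2.2.2.1⟩⟩
  · exact ⟨E, fun s hs => (hsmooth s hs).2, fun s _ => ⟨⟨_, (hside s).1.2.1⟩, ⟨_, (hside s).2.2.1⟩,
      (hside s).1.2.2.2, (hside s).2.2.2.2⟩⟩
  · intro s s' hss
    have hX : paramX D s' = paramX D s := (congrArg Prod.fst hss).symm
    have hY : paramY h D s = paramY h D s' := congrArg Prod.snd hss
    rw [paramY_of_eq rfl, paramY_of_eq hX] at hY
    by_cases hmem : paramX D s ∈ D
    · have h1 : (rightLim h (paramX D s) - leftLim h (paramX D s)) * (s - s') = 0 := by linarith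
      rcases mul_eq_zero.1 h1 with h2 | h2
      · exact absurd (sub_eq_zero.1 h2).symm (hDj _ hmem)
      · exact sub_eq_zero.1 h2
    · have h1 := paramX_spec D s
      have h2 := paramX_spec D s'
      rw [hX] at h2
      rw [departure_eq_of_notMem hmem] at h1 h2
      exact (le_antisymm h1.2 h1.1).trans (le_antisymm h2.1 h2.2)
  · ext ⟨x, y⟩
    constructor
    · rintro ⟨s, hs⟩
      obtain ⟨rfl, rfl⟩ := Prod.ext_iff.1 hs
      have hsp := paramX_spec D s
      change paramY h D s ∈ uIcc (leftLim h (paramX D s)) (rightLim h (paramX D s))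
      by_cases hmem : paramX D s ∈ D
      · rw [departure_eq_of_mem hmem] at hsp
        rw [← segment_eq_uIcc]
        refine ⟨1 - (s - arrival D (paramX D s)), s - arrival D (paramX D s), by linarith,
          by linarith, by ring, ?_⟩
        rw [paramY_of_eq rfl, smul_eq_mul, smul_eq_mul]; ring
      · rw [paramY_of_eq rfl, hD _ hmem, uIcc_self]; simp
    · intro hp
      have hp : y ∈ uIcc (leftLim h x) (rightLim h x) := hp
      by_cases hmem : x ∈ D
      · rw [← segment_eq_uIcc] at hp
        obtain ⟨a, b, ha, hb, hab, hy⟩ := hp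
        have e : paramX D (arrival D x + b) = x :=
          paramX_eq_iff.2 ⟨by linarith, by rw [departure_eq_of_mem hmem]; linarith⟩
        refine ⟨arrival D x + b, Prod.ext e ?_⟩
        change paramY h D (arrival D x + b) = y
        rw [paramY_of_eq e, ← hy, smul_eq_mul, smul_eq_mul,
          show a = 1 - b by linarith]
        ring
      · rw [← hD x hmem, uIcc_self] at hp
        have e : paramX D (arrival D x) = x := paramX_eq_iff.2 ⟨le_rfl, arrival_le_departure D x⟩
        refine ⟨arrival D x, Prod.ext e ?_⟩
        change paramY h D (arrival D x) = y
        rw [paramY_of_eq e, sub_self, mul_zero, add_zero, hp]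
  · intro ξ hξ
    exact ⟨arrival D ξ, Finset.mem_union_left _ (Finset.mem_image_of_mem _ (hSx ξ hξ)),
      departure D ξ, Finset.mem_union_right _ (Finset.mem_image_of_mem _ (hSx ξ hξ)),
      fun s => paramX_eq_iff⟩

end Param
end EqualArea

/-! ### Finite folding and existence of the equal-area construction -/

namespace EqualArea
open Function

/-- By Rolle's theorem a continuous function with finitely many local extrema has finite level
sets. -/
theorem finite_level {g : ℝ → ℝ} (hg : Continuous g) (hfin : {s | IsLocalExtr g s}.Finite) (z : ℝ) :
    {s | g s = z}.Finite := by
  classical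
  -- Each point of the level set is encoded by the extrema to its left; Rolle's theorem puts an
  -- extremum between two such points, so the code is injective.
  refine Finite.of_injOn (f := fun s => hfin.toFinset.filter (· < s))
    (t := (hfin.toFinset.powerset : Set (Finset ℝ))) ?_ ?_ (Finset.finite_toSet _)
  · intro s _
    exact Finset.mem_coe.2 (Finset.mem_powerset.2 (Finset.filter_subset _ _))
  · have key : ∀ s s', g s = z → g s' = z → s < s' →
        hfin.toFinset.filter (· < s) ≠ hfin.toFinset.filter (· < s') := by
      intro s s' hs hs' hlt he
      obtain ⟨c, hc, hce⟩ := exists_isLocalExtr_Ioo hlt hg.continuousOn (hs.trans hs'.symm)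
      have : c ∈ hfin.toFinset.filter (· < s') := by simpa using ⟨hce, hc.2⟩
      rw [← he, Finset.mem_filter] at this
      exact lt_asymm hc.1 this.2
    intro s hs s' hs' he
    rcases lt_trichotomy s s' with h | h | h
    · exact absurd he (key s s' hs hs' h)
    · exact h
    · exact absurd he.symm (key s' s hs' hs h)

/-- A parametrized admissible datum for which every curve `γ_t` folds finitely often. -/
structure Folding (f h X Y : ℝ → ℝ) (K : ℝ) (E : Finset ℝ) : Prop where
  admissible : Admissible f h K
  param : RegularParam h X Y E
  finite_extr : ∀ t : ℝ, 0 ≤ t → {ξ : ℝ | IsLocalExtr (fun ζ : ℝ => ζ + deriv f (h ζ) * t) ξ}.Finite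

variable {f h X Y : ℝ → ℝ} {K t z s s' : ℝ} {E : Finset ℝ}

/-- The parameters of the points of `γ_t` over `z` that are not yet absorbed by a shock. -/
def optSet (f h X Y : ℝ → ℝ) (K t z : ℝ) : Set ℝ :=
  {s | position f X Y t s = z ∧ Alive f h K (X s, Y s) t}

/-- The first parameter in `optSet`. -/
noncomputable def loParam (f h X Y : ℝ → ℝ) (K t z : ℝ) : ℝ := sInf (optSet f h X Y K t z)

/-- The last parameter in `optSet`. -/
noncomputable def hiParam (f h X Y : ℝ → ℝ) (K t z : ℝ) : ℝ := sSup (optSet f h X Y K t z)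

namespace Folding

/-- Off `E` the curve is locally a graph or vertical. On a graph piece an extremum of the position
is one of `ξ ↦ ξ + f'(h ξ) t`; on a vertical piece the position is strictly monotone, since `f'` is,
and has no extremum. -/
theorem finite_localExtr (F : Folding f h X Y K E) (ht : 0 < t) :
    {s | IsLocalExtr (position f X Y t) s}.Finite := by
  set G : Set ℝ := {s | IsLocalExtr (fun ζ : ℝ => ζ + deriv f (h ζ) * t) (X s) ∧ Y s = h (X s)}
  have hG : G.Finite := by
    refine Finite.of_finite_image (f := X) ((F.finite_extr t ht.le).subset ?_) ?_
    · rintro _ ⟨s, hs, rfl⟩; exact hs.1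
    · intro s hs s' hs' he
      exact F.param.eq_of_eq he (by rw [hs.2, hs'.2, he])
  refine (E.finite_toSet.union hG).subset fun s hs => ?_
  by_cases hE : s ∈ E
  · exact Or.inl hE
  right
  have hs : IsLocalExtr (position f X Y t) s := hs
  rcases F.param.regular s hE with ⟨-, hr⟩ | ⟨c, hc, hr⟩
  · refine ⟨?_, hr.self_of_nhds.2⟩
    have ht' : Tendsto (fun ζ : ℝ => s + (ζ - X s)) (𝓝 (X s)) (𝓝 s) := by
      have : ContinuousAt (fun ζ : ℝ => s + (ζ - X s)) (X s) := by fun_prop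
      simpa [ContinuousAt] using this
    have he : (fun ζ : ℝ => position f X Y t (s + (ζ - X s))) =ᶠ[𝓝 (X s)]
        fun ζ => ζ + deriv f (h ζ) * t := by
      filter_upwards [ht'.eventually hr] with ζ hζ
      have e : X (s + (ζ - X s)) = ζ := by rw [hζ.1]; ring
      rw [position, hζ.2, e]
    have h1 : IsLocalExtr (fun ζ : ℝ => position f X Y t (s + (ζ - X s))) (X s) := by
      rcases hs with hs | hs
      · left
        have := ht'.eventually hs
        filter_upwards [this] with ζ hζ
        simpa using hζ
      · right
        have := ht'.eventually hs
        filter_upwards [this] with ζ hζ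
        simpa using hζ
    exact he.isLocalExtr_iff.1 h1
  · exfalso
    have hsym : Tendsto (fun u => 2 * s - u) (𝓝 s) (𝓝 s) := by
      have : ContinuousAt (fun u : ℝ => 2 * s - u) s := by fun_prop
      have e : 2 * s - s = s := by ring
      simpa [ContinuousAt, e] using this
    -- Parameters symmetric about `s` are moved to opposite sides of the position of `s`.
    have hkey : ∀ᶠ u in 𝓝 s, u ≠ s →
        (position f X Y t u - position f X Y t s) *
          (position f X Y t (2 * s - u) - position f X Y t s) < 0 := by
      filter_upwards [hr, hsym.eventually hr] with u hu hu' hne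
      have hanti := F.admissible.strictAnti_deriv
      simp only [position, hu.1, hu.2, hu'.1, hu'.2]
      have hd : c * (u - s) ≠ 0 := mul_ne_zero hc (sub_ne_zero.2 hne)
      have e : Y s + c * (2 * s - u - s) = Y s - c * (u - s) := by ring
      rw [e]
      rcases hd.lt_or_gt with hd | hd
      · have h1 := hanti (show Y s + c * (u - s) < Y s by linarith)
        have h2 := hanti (show Y s < Y s - c * (u - s) by linarith)
        have h1 := mul_lt_mul_of_pos_right h1 ht
        have h2 := mul_lt_mul_of_pos_right h2 ht
        exact mul_neg_of_pos_of_neg (by linarith) (by linarith)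
      · have h1 := hanti (show Y s < Y s + c * (u - s) by linarith)
        have h2 := hanti (show Y s - c * (u - s) < Y s by linarith)
        have h1 := mul_lt_mul_of_pos_right h1 ht
        have h2 := mul_lt_mul_of_pos_right h2 ht
        exact mul_neg_of_neg_of_pos (by linarith) (by linarith)
    have hex : ∀ p : ℝ → Prop, (∀ᶠ u in 𝓝 s, p u) → ∃ u, u ≠ s ∧ p u := fun p hp =>
      ((eventually_mem_nhdsWithin (s := {s}ᶜ)).and (hp.filter_mono nhdsWithin_le_nhds)).exists
    rcases hs with hs | hs
    · obtain ⟨u, hu, h1, h2, h3⟩ := hex _ (hkey.and (hs.and (hsym.eventually hs)))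
      have := h1 hu
      have h4 := mul_nonneg (sub_nonneg.2 h2) (sub_nonneg.2 h3)
      linarith
    · obtain ⟨u, hu, h1, h2, h3⟩ := hex _ (hkey.and (hs.and (hsym.eventually hs)))
      have := h1 hu
      have h4 := mul_nonneg_of_nonpos_of_nonpos (sub_nonpos.2 h2) (sub_nonpos.2 h3)
      linarith

theorem finite_position_eq (F : Folding f h X Y K E) (ht : 0 < t) (z : ℝ) :
    {s | position f X Y t s = z}.Finite :=
  finite_level (F.param.continuous_position_left F.admissible t) (F.finite_localExtr ht) z

theorem finite_optSet (F : Folding f h X Y K E) (ht : 0 < t) (z : ℝ) :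
    (optSet f h X Y K t z).Finite :=
  (F.finite_position_eq ht z).subset fun _ hs => hs.1

theorem loParam_mem (F : Folding f h X Y K E) (ht : 0 < t) (z : ℝ) :
    loParam f h X Y K t z ∈ optSet f h X Y K t z :=
  Set.Nonempty.csInf_mem (F.param.exists_alive F.admissible ht z) (F.finite_optSet ht z)

theorem hiParam_mem (F : Folding f h X Y K E) (ht : 0 < t) (z : ℝ) :
    hiParam f h X Y K t z ∈ optSet f h X Y K t z :=
  Set.Nonempty.csSup_mem (F.param.exists_alive F.admissible ht z) (F.finite_optSet ht z)

theorem loParam_le (F : Folding f h X Y K E) (ht : 0 < t) (hs : s ∈ optSet f h X Y K t z) :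
    loParam f h X Y K t z ≤ s := csInf_le (F.finite_optSet ht z).bddBelow hs

theorem le_hiParam (F : Folding f h X Y K E) (ht : 0 < t) (hs : s ∈ optSet f h X Y K t z) :
    s ≤ hiParam f h X Y K t z := le_csSup (F.finite_optSet ht z).bddAbove hs

theorem hiParam_lt_loParam (F : Folding f h X Y K E) (ht : 0 < t) {z' : ℝ} (hz : z < z') :
    hiParam f h X Y K t z < loParam f h X Y K t z' := by
  have h1 := F.hiParam_mem ht z
  have h2 := F.loParam_mem ht z'
  exact F.param.lt_of_position_lt F.admissible ht h1.2 h2.2 (by rw [h1.1, h2.1]; exact hz)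

/-- Only finitely many points of the line carry a shock at a given time. -/
theorem finite_multi (F : Folding f h X Y K E) (ht : 0 < t) :
    {z | loParam f h X Y K t z < hiParam f h X Y K t z}.Finite := by
  -- Rolle's theorem gives an extremum strictly between the first and the last alive parameter over
  -- `z`; these intervals are disjoint for different `z`, so finitely many extrema allow finitely
  -- many `z`.
  have hc : ∀ z, ∃ c, loParam f h X Y K t z < hiParam f h X Y K t z →
      c ∈ Ioo (loParam f h X Y K t z) (hiParam f h X Y K t z) ∧
        IsLocalExtr (position f X Y t) c := by
    intro z
    by_cases hz : loParam f h X Y K t z < hiParam f h X Y K t z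
    · obtain ⟨c, h1, h2⟩ := exists_isLocalExtr_Ioo hz
        (F.param.continuous_position_left F.admissible t).continuousOn
        ((F.loParam_mem ht z).1.trans (F.hiParam_mem ht z).1.symm)
      exact ⟨c, fun _ => ⟨h1, h2⟩⟩
    · exact ⟨0, fun h => absurd h hz⟩
  choose c hc using hc
  refine Finite.of_injOn (f := c) (fun z hz => (hc z hz).2) ?_ (F.finite_localExtr ht)
  have key : ∀ z z', loParam f h X Y K t z < hiParam f h X Y K t z →
      loParam f h X Y K t z' < hiParam f h X Y K t z' → z < z' → c z < c z' :=
    fun z z' hz hz' hlt => (hc z hz).1.2.trans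
      ((F.hiParam_lt_loParam ht hlt).trans (hc z' hz').1.1)
  intro z hz z' hz' he
  rcases lt_trichotomy z z' with h | h | h
  · exact absurd he (key z z' hz hz' h).ne
  · exact h
  · exact absurd he.symm (key z' z hz' hz h).ne

theorem isClosed_alive (F : Folding f h X Y K E) (t : ℝ) :
    IsClosed {s | Alive f h K (X s, Y s) t} := by
  have hc : Continuous fun s => (X s, position f X Y t s, t) :=
    F.param.continuous_fst.prodMk
      ((F.param.continuous_position_left F.admissible t).prodMk continuous_const)
  exact F.admissible.isClosed_isOpt.preimage hc

theorem exists_alive_le (F : Folding f h X Y K E) (ht : 0 < t) (s : ℝ) :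
    ∃ s' ≤ s, Alive f h K (X s', Y s') t := by
  obtain ⟨C, hC0, -, hC⟩ := F.admissible.exists_flux_bound
  obtain ⟨s', h1, h2⟩ := F.param.exists_alive F.admissible ht (X s - C * t - 1)
  refine ⟨s', (F.param.lt_of_fst_lt ?_).le, h2⟩
  have h3 := hC (Y s') (abs_le.2 (F.admissible.mem_Icc_of_mem (F.param.mem_initialCurve s')))
  have h4 : -(C * t) ≤ deriv f (Y s') * t := by
    have := mul_le_mul_of_nonneg_right (neg_le_of_abs_le h3) ht.le
    linarith
  rw [position] at h1
  linarith

theorem exists_alive_ge (F : Folding f h X Y K E) (ht : 0 < t) (s : ℝ) :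
    ∃ s', s ≤ s' ∧ Alive f h K (X s', Y s') t := by
  obtain ⟨C, hC0, -, hC⟩ := F.admissible.exists_flux_bound
  obtain ⟨s', h1, h2⟩ := F.param.exists_alive F.admissible ht (X s + C * t + 1)
  refine ⟨s', (F.param.lt_of_fst_lt ?_).le, h2⟩
  have h3 := hC (Y s') (abs_le.2 (F.admissible.mem_Icc_of_mem (F.param.mem_initialCurve s')))
  have h4 : deriv f (Y s') * t ≤ C * t := mul_le_mul_of_nonneg_right (le_of_abs_le h3) ht.le
  rw [position] at h1
  linarith

/-- Every parameter lies in the interval that is absorbed over some point `z`. -/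
theorem exists_mem_Icc (F : Folding f h X Y K E) (ht : 0 < t) (s : ℝ) :
    ∃ z, s ∈ Icc (loParam f h X Y K t z) (hiParam f h X Y K t z) := by
  set A := {s' | Alive f h K (X s', Y s') t} with hA
  have hAc : IsClosed A := F.isClosed_alive t
  have m1 : sSup (A ∩ Iic s) ∈ A ∩ Iic s := by
    obtain ⟨s', h1, h2⟩ := F.exists_alive_le ht s
    exact (hAc.inter isClosed_Iic).csSup_mem ⟨s', h2, h1⟩ (bddAbove_Iic.mono inter_subset_right)
  have m2 : sInf (A ∩ Ici s) ∈ A ∩ Ici s := by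
    obtain ⟨s', h1, h2⟩ := F.exists_alive_ge ht s
    exact (hAc.inter isClosed_Ici).csInf_mem ⟨s', h2, h1⟩ (bddBelow_Ici.mono inter_subset_right)
  set s₁ := sSup (A ∩ Iic s) with hs₁
  set s₂ := sInf (A ∩ Ici s) with hs₂
  have hm1 : s₁ ≤ s := m1.2
  have hm2 : s ≤ s₂ := m2.2
  -- `s₁` and `s₂` are the alive parameters nearest to `s` on either side. Were their positions
  -- different, a position in between would have an alive parameter between them.
  rcases lt_trichotomy (position f X Y t s₁) (position f X Y t s₂) with hlt | he | hlt
  · exfalso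
    obtain ⟨z, hz1, hz2⟩ := _root_.exists_between hlt
    obtain ⟨s₃, h1, h2⟩ := F.param.exists_alive F.admissible ht z
    have h3 := F.param.lt_of_position_lt F.admissible ht m1.1 h2 (h1 ▸ hz1)
    have h4 := F.param.lt_of_position_lt F.admissible ht h2 m2.1 (h1 ▸ hz2)
    rcases le_total s₃ s with h | h
    · exact absurd (le_csSup (bddAbove_Iic.mono inter_subset_right)
        (show s₃ ∈ A ∩ Iic s from ⟨h2, h⟩)) (not_le.2 h3)
    · exact absurd (csInf_le (bddBelow_Ici.mono inter_subset_right)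
        (show s₃ ∈ A ∩ Ici s from ⟨h2, h⟩)) (not_le.2 h4)
  · exact ⟨position f X Y t s₁, (F.loParam_le ht ⟨rfl, m1.1⟩).trans hm1,
      hm2.trans (F.le_hiParam ht ⟨he.symm, m2.1⟩)⟩
  · have := F.param.lt_of_position_lt F.admissible ht m2.1 m1.1 hlt
    linarith

/-- The cuts prescribed by the variational principle. -/
noncomputable def cuts (F : Folding f h X Y K E) (ht : 0 < t) : Finset (ℝ × ℝ) :=
  (F.finite_multi ht).toFinset.image fun z => (loParam f h X Y K t z, hiParam f h X Y K t z)

theorem mem_cuts (F : Folding f h X Y K E) (ht : 0 < t) {p : ℝ × ℝ} :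
    p ∈ F.cuts ht ↔ ∃ z, loParam f h X Y K t z < hiParam f h X Y K t z ∧
      (loParam f h X Y K t z, hiParam f h X Y K t z) = p := by
  simp [cuts]

theorem remaining_iff (F : Folding f h X Y K E) (ht : 0 < t) :
    (∀ p ∈ F.cuts ht, s ∉ Ioo p.1 p.2) ↔
      ∃ z, s = loParam f h X Y K t z ∨ s = hiParam f h X Y K t z := by
  constructor
  · intro hs
    obtain ⟨z, h1, h2⟩ := F.exists_mem_Icc ht s
    refine ⟨z, ?_⟩
    by_contra! hne
    have h1 := lt_of_le_of_ne h1 hne.1.symm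
    have h2 := lt_of_le_of_ne h2 hne.2
    exact hs _ ((F.mem_cuts ht).2 ⟨z, h1.trans h2, rfl⟩) ⟨h1, h2⟩
  · rintro ⟨z, hz⟩ p hp ⟨h1, h2⟩
    obtain ⟨z', hz', rfl⟩ := (F.mem_cuts ht).1 hp
    have hm : s ∈ Icc (loParam f h X Y K t z) (hiParam f h X Y K t z) := by
      have := F.loParam_le ht (F.hiParam_mem ht z)
      rcases hz with rfl | rfl
      exacts [⟨le_rfl, this⟩, ⟨this, le_rfl⟩]
    rcases lt_trichotomy z z' with h | h | h
    · have := F.hiParam_lt_loParam ht h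
      simp only at h1 h2
      linarith [hm.2]
    · subst h
      rcases hz with rfl | rfl
      exacts [lt_irrefl _ h1, lt_irrefl _ h2]
    · have := F.hiParam_lt_loParam ht h
      simp only at h1 h2
      linarith [hm.1]

/-- Both ends of a cut are optimal at the same position, so their transported values agree and the
signed area vanishes. Every other point on the line has at most this value, which is the condition
on preceding right lobes. -/
theorem isEqualAreaCut (F : Folding f h X Y K E) (ht : 0 < t) :
    IsEqualAreaCut (fun s => X s + deriv f (Y s) * t) Y (F.cuts ht) := by
  have hlh : ∀ z, loParam f h X Y K t z ≤ hiParam f h X Y K t z :=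
    fun z => F.loParam_le ht (F.hiParam_mem ht z)
  refine ⟨?_, ?_, ?_, ?_, ?_, ?_⟩
  · intro p hp
    obtain ⟨z, hz, rfl⟩ := (F.mem_cuts ht).1 hp
    exact hz
  · intro p hp q hq hne
    obtain ⟨z, hz, rfl⟩ := (F.mem_cuts ht).1 hp
    obtain ⟨z', hz', rfl⟩ := (F.mem_cuts ht).1 hq
    rw [Set.disjoint_left]
    rintro s ⟨h1, h2⟩ ⟨h3, h4⟩
    simp only at h1 h2 h3 h4
    rcases lt_trichotomy z z' with h | h | h
    · linarith [F.hiParam_lt_loParam ht h]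
    · exact hne (by rw [h])
    · linarith [F.hiParam_lt_loParam ht h]
  · intro p hp
    obtain ⟨z, hz, rfl⟩ := (F.mem_cuts ht).1 hp
    exact (F.loParam_mem ht z).1.trans (F.hiParam_mem ht z).1.symm
  · intro p hp
    obtain ⟨z, hz, rfl⟩ := (F.mem_cuts ht).1 hp
    have h1 := F.loParam_mem ht z
    have h2 := F.hiParam_mem ht z
    rw [F.param.signedArea_eq F.admissible, h1.1, h2.1,
      le_antisymm (F.param.charValue_le F.admissible ht h2.2 (h1.1.trans h2.1.symm))
        (F.param.charValue_le F.admissible ht h1.2 (h2.1.trans h1.1.symm))]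
    ring
  · intro p hp s hs hx
    obtain ⟨z, hz, rfl⟩ := (F.mem_cuts ht).1 hp
    have h1 := F.loParam_mem ht z
    have hx : position f X Y t s = position f X Y t (loParam f h X Y K t z) := hx
    rw [F.param.signedArea_eq F.admissible, hx]
    have := F.param.charValue_le F.admissible ht h1.2 hx
    simp only
    linarith
  · intro s s' hlt hs hs' hC
    obtain ⟨z, hz⟩ := (F.remaining_iff ht).1 hs
    obtain ⟨z', hz'⟩ := (F.remaining_iff ht).1 hs'
    have hp : position f X Y t s = z := by
      rcases hz with rfl | rfl
      exacts [(F.loParam_mem ht z).1, (F.hiParam_mem ht z).1]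
    have hp' : position f X Y t s' = z' := by
      rcases hz' with rfl | rfl
      exacts [(F.loParam_mem ht z').1, (F.hiParam_mem ht z').1]
    change position f X Y t s < position f X Y t s'
    rw [hp, hp']
    have b1 : s ∈ Icc (loParam f h X Y K t z) (hiParam f h X Y K t z) := by
      rcases hz with rfl | rfl
      exacts [⟨le_rfl, hlh z⟩, ⟨hlh z, le_rfl⟩]
    have b2 : s' ∈ Icc (loParam f h X Y K t z') (hiParam f h X Y K t z') := by
      rcases hz' with rfl | rfl
      exacts [⟨le_rfl, hlh z'⟩, ⟨hlh z', le_rfl⟩]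
    rcases lt_trichotomy z z' with h | h | h
    · exact h
    · exfalso
      subst h
      have e1 : s = loParam f h X Y K t z := hz.resolve_right fun e => by linarith [b2.2]
      have e2 : s' = hiParam f h X Y K t z := hz'.resolve_left fun e => by linarith [b1.1]
      exact hC ((F.mem_cuts ht).2 ⟨z, by rw [← e1, ← e2]; exact hlt, by rw [e1, e2]⟩)
    · linarith [F.hiParam_lt_loParam ht h, b1.1, b2.2]

open Classical in
theorem exists_isEqualAreaSolution (F : Folding f h X Y K E) :
    ∃ u, IsEqualAreaSolution f h u := by
  refine ⟨fun x t => if 0 < t then Y (loParam f h X Y K t x) else h x, by simp, fun t ht => ?_⟩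
  refine ⟨X, Y, F.cuts ht, F.param.toIsParametrization, F.isEqualAreaCut ht, fun z => ?_⟩
  exact ⟨loParam f h X Y K t z, (F.remaining_iff ht).2 ⟨z, Or.inl rfl⟩, (F.loParam_mem ht z).1,
    by simp [ht]⟩

end Folding
end EqualArea

/-! ### The optimal field: continuity, upward jumps and the integral law -/

namespace EqualArea
open Function

variable {f h X Y : ℝ → ℝ} {K t z s s' : ℝ} {E : Finset ℝ} {u : ℝ → ℝ → ℝ}

namespace IsOptField

theorem isOpt (hu : IsOptField f h K u) (H : Admissible f h K) (ht : 0 < t) (z : ℝ) :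
    IsOpt f h K (z - deriv f (u z t) * t) z t ∧ slopeOf f K (deriv f (u z t) * t) t = u z t := by
  obtain ⟨X, hX, he⟩ := hu t ht z
  have h1 := H.eq_add_of_isOpt ht hX
  rw [← he] at h1
  have h2 : z - deriv f (u z t) * t = X := by linarith
  have h3 : deriv f (u z t) * t = z - X := by linarith
  rw [h2, h3]
  exact ⟨hX, he.symm⟩

theorem abs_le (hu : IsOptField f h K u) (H : Admissible f h K) (ht : 0 < t) (z : ℝ) :
    |u z t| ≤ K := by
  rw [← (hu.isOpt H ht z).2]
  exact H.abs_slopeOf_le _ _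

theorem mono (hu : IsOptField f h K u) (H : Admissible f h K) (ht : 0 < t) {z z' : ℝ} (hz : z < z') :
    z - deriv f (u z t) * t ≤ z' - deriv f (u z' t) * t :=
  H.isOpt_mono ht (hu.isOpt H ht z).1 (hu.isOpt H ht z').1 hz

theorem exists_param (hu : IsOptField f h K u) (H : Admissible f h K) (P : IsParametrization h X Y)
    (ht : 0 < t) (z : ℝ) : ∃ s ∈ optSet f h X Y K t z, Y s = u z t := by
  obtain ⟨X', hX, he⟩ := hu t ht z
  obtain ⟨s, h1, h2⟩ := P.exists_eq (H.mem_completedGraph_of_isOpt ht hX)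
  simp only at h1 h2
  have h3 := H.alive_of_isOpt ht hX
  rw [← h2, ← h1] at h3
  have h4 := H.eq_add_of_isOpt ht hX
  refine ⟨s, ⟨?_, h3⟩, by rw [h2, he]⟩
  rw [position, h2, h1, ← h4]

/-- The feet of nearby points depend monotonically on the point and converge from both sides to the
foot selected by `u`; this squeezes all optimal feet at `z`. -/
theorem unique_of_continuousAt (hu : IsOptField f h K u) (H : Admissible f h K) (ht : 0 < t)
    (hc : ContinuousAt (fun z => u z t) z) {X X' : ℝ} (hX : IsOpt f h K X z t)
    (hX' : IsOpt f h K X' z t) : X ≤ X' := by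
  have hd : Tendsto (fun w => w - deriv f (u w t) * t) (𝓝 z) (𝓝 (z - deriv f (u z t) * t)) :=
    tendsto_id.sub (((H.continuous_deriv.tendsto _).comp hc).mul_const t)
  have h1 : z - deriv f (u z t) * t ≤ X' := by
    refine le_of_tendsto (hd.mono_left (nhdsWithin_le_nhds (s := Iio z))) ?_
    filter_upwards [self_mem_nhdsWithin] with w hw
    exact H.isOpt_mono ht (hu.isOpt H ht w).1 hX' hw
  have h2 : X ≤ z - deriv f (u z t) * t := by
    refine ge_of_tendsto (hd.mono_left (nhdsWithin_le_nhds (s := Ioi z))) ?_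
    filter_upwards [self_mem_nhdsWithin] with w hw
    exact H.isOpt_mono ht hX (hu.isOpt H ht w).1 hw
  exact h2.trans h1

theorem continuousAt_of_unique (hu : IsOptField f h K u) (H : Admissible f h K) (ht : 0 < t)
    (hun : ∀ X X', IsOpt f h K X z t → IsOpt f h K X' z t → X = X') :
    ContinuousAt (fun p : ℝ × ℝ => u p.1 p.2) (z, t) := by
  have h1 := hu.isOpt H ht z
  have hpos : ∀ᶠ p : ℝ × ℝ in 𝓝 (z, t), 0 < p.2 :=
    (continuous_snd.tendsto (z, t)).eventually (lt_mem_nhds ht)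
  have hX : Tendsto (fun p : ℝ × ℝ => p.1 - deriv f (u p.1 p.2) * p.2) (𝓝 (z, t))
      (𝓝 (z - deriv f (u z t) * t)) :=
    H.tendsto_of_unique ht (fun X' hX' => hun _ _ hX' h1.1) (continuous_fst.tendsto (z, t))
      (continuous_snd.tendsto (z, t)) (hpos.mono fun p hp => (hu.isOpt H hp p.1).1)
  have hw : Tendsto (fun p : ℝ × ℝ => deriv f (u p.1 p.2) * p.2) (𝓝 (z, t))
      (𝓝 (deriv f (u z t) * t)) := by
    have := (continuous_fst.tendsto (z, t)).sub hX
    simpa using this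
  have := H.tendsto_slopeOf ht hw (continuous_snd.tendsto (z, t))
  rw [h1.2] at this
  exact this.congr' (hpos.mono fun p hp => (hu.isOpt H hp p.1).2)

theorem hasFDerivAt (hu : IsOptField f h K u) (H : Admissible f h K) (ht : 0 < t)
    (hc : ContinuousAt (fun z => u z t) z) :
    HasFDerivAt (fun p : ℝ × ℝ => hopfLax f h K p.1 p.2)
      (u z t • ContinuousLinearMap.fst ℝ ℝ ℝ -
        (f (u z t) - f 0) • ContinuousLinearMap.snd ℝ ℝ ℝ) (z, t) := by
  have h1 := hu.isOpt H ht z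
  have h2 := H.hasFDerivAt_hopfLax ht h1.1 fun X' hX' =>
    le_antisymm (hu.unique_of_continuousAt H ht hc hX' h1.1)
      (hu.unique_of_continuousAt H ht hc h1.1 hX')
  rwa [sub_sub_cancel, h1.2] at h2

theorem hasDerivAt_fst (hu : IsOptField f h K u) (H : Admissible f h K) (ht : 0 < t)
    (hc : ContinuousAt (fun z => u z t) z) :
    HasDerivAt (fun x => hopfLax f h K x t) (u z t) z := by
  have h1 : HasDerivAt (fun x : ℝ => (x, t)) (1, 0) z := (hasDerivAt_id z).prodMk (hasDerivAt_const z t)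
  have h2 := (hu.hasFDerivAt H ht hc).comp_hasDerivAt_of_eq z h1 rfl
  exact h2.congr_deriv (by simp)

theorem hasDerivAt_snd (hu : IsOptField f h K u) (H : Admissible f h K) (ht : 0 < t)
    (hc : ContinuousAt (fun z => u z t) z) :
    HasDerivAt (fun τ => hopfLax f h K z τ) (-(f (u z t) - f 0)) t := by
  have h1 : HasDerivAt (fun τ : ℝ => (z, τ)) (0, 1) t := (hasDerivAt_const t z).prodMk (hasDerivAt_id t)
  have h2 := (hu.hasFDerivAt H ht hc).comp_hasDerivAt_of_eq t h1 rfl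
  exact h2.congr_deriv (by simp)

/-- The foot reached from the left is at most the one reached from the right, so `f'(r) ≤ f'(l)`,
and `f'` is strictly decreasing. -/
theorem jumpsUpward (hu : IsOptField f h K u) (H : Admissible f h K) : JumpsUpward u := by
  intro x t l r ht hl hr hne
  refine lt_of_le_of_ne ?_ hne
  have hL : Tendsto (fun w => w - deriv f (u w t) * t) (𝓝[<] x) (𝓝 (x - deriv f l * t)) :=
    (tendsto_id.mono_left nhdsWithin_le_nhds).sub
      (((H.continuous_deriv.tendsto _).comp hl).mul_const t)
  have hR : Tendsto (fun w => w - deriv f (u w t) * t) (𝓝[>] x) (𝓝 (x - deriv f r * t)) :=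
    (tendsto_id.mono_left nhdsWithin_le_nhds).sub
      (((H.continuous_deriv.tendsto _).comp hr).mul_const t)
  have h1 : x - deriv f l * t ≤ x - deriv f r * t := by
    refine ge_of_tendsto hR ?_
    filter_upwards [self_mem_nhdsWithin] with z' hz'
    refine le_of_tendsto hL ?_
    filter_upwards [self_mem_nhdsWithin] with z hz
    exact hu.mono H ht (lt_trans hz hz')
  have h2 : deriv f r * t ≤ deriv f l * t := by linarith
  exact H.strictAnti_deriv.le_iff_ge.1 (le_of_mul_le_mul_right h2 ht)

end IsOptField

namespace Folding

theorem exists_param_of_isOpt (F : Folding f h X Y K E) (ht : 0 < t) {X' : ℝ}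
    (hX : IsOpt f h K X' z t) : ∃ s ∈ optSet f h X Y K t z, X s = X' := by
  obtain ⟨s, h1, h2⟩ := F.param.exists_eq (F.admissible.mem_completedGraph_of_isOpt ht hX)
  simp only at h1 h2
  have h3 := F.admissible.alive_of_isOpt ht hX
  rw [← h2, ← h1] at h3
  have h4 := F.admissible.eq_add_of_isOpt ht hX
  refine ⟨s, ⟨?_, h3⟩, h1⟩
  rw [position, h2, h1, ← h4]

theorem unique_of_eq (F : Folding f h X Y K E) (ht : 0 < t)
    (he : ¬ loParam f h X Y K t z < hiParam f h X Y K t z) {X₁ X₂ : ℝ}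
    (h₁ : IsOpt f h K X₁ z t) (h₂ : IsOpt f h K X₂ z t) : X₁ = X₂ := by
  obtain ⟨s₁, m₁, rfl⟩ := F.exists_param_of_isOpt ht h₁
  obtain ⟨s₂, m₂, rfl⟩ := F.exists_param_of_isOpt ht h₂
  have a1 := F.loParam_le ht m₁
  have a2 := F.loParam_le ht m₂
  have b1 := F.le_hiParam ht m₁
  have b2 := F.le_hiParam ht m₂
  rw [show s₁ = s₂ by linarith [not_lt.1 he]]

theorem continuousAt_iff (F : Folding f h X Y K E) (hu : IsOptField f h K u) (ht : 0 < t) :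
    ContinuousAt (fun w => u w t) z ↔ ¬ loParam f h X Y K t z < hiParam f h X Y K t z := by
  constructor
  · intro hc hlt
    have m₁ := F.loParam_mem ht z
    have m₂ := F.hiParam_mem ht z
    have hY := F.param.snd_lt_snd F.admissible ht hlt (m₁.1.trans m₂.1.symm)
    have e : ∀ s ∈ optSet f h X Y K t z, IsOpt f h K (X s) z t := fun s hs => by
      have := hs.2
      rw [← hs.1]; exact this
    have hX := le_antisymm
      (hu.unique_of_continuousAt F.admissible ht hc (e _ m₁) (e _ m₂))
      (hu.unique_of_continuousAt F.admissible ht hc (e _ m₂) (e _ m₁))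
    have h1 := m₁.1.trans m₂.1.symm
    rw [position, position, hX] at h1
    have := F.admissible.strictAnti_deriv hY
    have := mul_lt_mul_of_pos_right this ht
    linarith
  · intro he
    have h1 := hu.continuousAt_of_unique F.admissible ht fun X X' => F.unique_of_eq (z := z) ht he
    exact h1.comp_of_eq (f := fun w => (w, t)) (by fun_prop) rfl

theorem finite_discontinuous (F : Folding f h X Y K E) (hu : IsOptField f h K u) (ht : 0 < t) :
    {z | ¬ ContinuousAt (fun w => u w t) z}.Finite :=
  (F.finite_multi ht).subset fun z hz => by
    by_contra hlt
    exact hz ((F.continuousAt_iff hu ht).2 hlt)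

theorem measurable (F : Folding f h X Y K E) (hu : IsOptField f h K u) (ht : 0 < t) :
    Measurable fun z => u z t :=
  PiecewiseC1.measurable_of_finite (S := (F.finite_discontinuous hu ht).toFinset)
    fun x hx => by simpa using hx

theorem intervalIntegrable (F : Folding f h X Y K E) (hu : IsOptField f h K u) (ht : 0 < t)
    (a b : ℝ) : IntervalIntegrable (fun z => u z t) volume a b :=
  (intervalIntegrable_const (c := K)).mono_fun (F.measurable hu ht).aestronglyMeasurable
    (ae_of_all _ fun z => by
      change ‖u z t‖ ≤ ‖K‖
      rw [Real.norm_eq_abs, Real.norm_eq_abs]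
      exact (hu.abs_le F.admissible ht z).trans (le_abs_self K))

/-- The Hopf–Lax function is continuous in `x` and has derivative `u` off a finite set. -/
theorem integral_eq (F : Folding f h X Y K E) (hu : IsOptField f h K u) (ht : 0 < t) (a b : ℝ) :
    ∫ z in a..b, u z t = hopfLax f h K b t - hopfLax f h K a t := by
  refine MeasureTheory.integral_eq_of_hasDerivAt_off_countable
    (fun x => hopfLax f h K x t) _ (F.finite_discontinuous hu ht).countable ?_ ?_
    (F.intervalIntegrable hu ht a b)
  · exact (F.admissible.continuous_hopfLax.comp (by fun_prop : Continuous fun x : ℝ => (x, t))).continuousOn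
  · intro x hx
    exact hu.hasDerivAt_fst F.admissible ht (not_not.1 hx.2)

/-- The time derivative of the Hopf–Lax function at a point of continuity is `-(f(u) - f 0)`; in the
difference between `b` and `a` the constant `f 0` cancels. -/
theorem solvesIntegralLaw (F : Folding f h X Y K E) (hu : IsOptField f h K u) :
    SolvesIntegralLaw f u := by
  refine ⟨fun t ht => F.intervalIntegrable hu ht, fun a b t _ ht ha hb => ?_⟩
  have hs : ∀ c, ContinuousAt (fun p : ℝ × ℝ => u p.1 p.2) (c, t) →
      ContinuousAt (fun z => u z t) c := fun c hc =>
    hc.comp_of_eq (f := fun w => (w, t)) (by fun_prop) rfl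
  have h1 := (hu.hasDerivAt_snd F.admissible ht (hs b hb)).sub
    (hu.hasDerivAt_snd F.admissible ht (hs a ha))
  have h2 : (fun τ => ∫ x in a..b, u x τ) =ᶠ[𝓝 t]
      fun τ => hopfLax f h K b τ - hopfLax f h K a τ := by
    filter_upwards [lt_mem_nhds ht] with τ hτ
    exact F.integral_eq hu hτ a b
  refine (h1.congr_of_eventuallyEq h2).congr_deriv ?_
  ring

end Folding
end EqualArea

/-! ### Countable fibres, one-sided limits, bounded profiles, closedness of the initial curve -/

namespace EqualArea
open Function

/-- By the one-dimensional Sard theorem almost every fibre of a `C¹` function is countable. -/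
theorem ae_countable_fiber {I : Set ℝ} {c : ℝ → ℝ} (hI : I.OrdConnected)
    (hc : ContDiffOn ℝ 1 c I) : ∀ᵐ b, {τ | τ ∈ I ∧ c τ = b}.Countable := by
  have hends : (I \ interior I).Countable := by
    have : I \ interior I ⊆ {x | IsLeast I x} ∪ {x | IsGreatest I x} := by
      rintro x ⟨hx, hxi⟩
      by_contra hne
      simp only [mem_union, mem_ofPred_eq, not_or, IsLeast, IsGreatest, hx, true_and,
        mem_lowerBounds, mem_upperBounds] at hne
      push Not at hne
      obtain ⟨⟨a, ha, hax⟩, b, hb, hxb⟩ := hne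
      exact hxi (mem_interior_iff_mem_nhds.2
        (mem_of_superset (Icc_mem_nhds hax hxb) (hI.out ha hb)))
    refine Countable.mono this (Countable.union ?_ ?_)
    · exact Set.Subsingleton.countable fun x hx y hy => IsLeast.unique hx hy
    · exact Set.Subsingleton.countable fun x hx y hy => IsGreatest.unique hx hy
  have hd : ∀ x ∈ interior I, HasDerivAt c (deriv c x) x := fun x hx =>
    (((hc x (interior_subset hx)).contDiffAt (mem_interior_iff_mem_nhds.1 hx)).differentiableAt
      one_ne_zero).hasDerivAt
  have hnull : volume (c '' {x | x ∈ interior I ∧ deriv c x = 0}) = 0 := by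
    refine addHaar_image_eq_zero_of_det_fderivWithin_eq_zero (f' := fun _ => 0) volume
      (fun x hx => ?_) fun x _ => by simp
    have := (hd x hx.1).hasFDerivAt.hasFDerivWithinAt (s := {x | x ∈ interior I ∧ deriv c x = 0})
    rwa [hx.2, show ContinuousLinearMap.toSpanSingleton ℝ (0 : ℝ) = 0 by ext; simp] at this
  filter_upwards [compl_mem_ae_iff.2 hnull] with b hb
  -- Over a regular value each point of the fibre is isolated from the right, and a set of reals has
  -- only countably many such points.
  have h1 : {τ | τ ∈ interior I ∧ c τ = b}.Countable := by
    refine (countable_setOfPred_isolated_right_within (s := {τ | τ ∈ interior I ∧ c τ = b})).mono ?_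
    intro τ hτ
    refine ⟨hτ, ?_⟩
    have hne : deriv c τ ≠ 0 := fun h0 => hb ⟨τ, ⟨hτ.1, h0⟩, hτ.2⟩
    have := (hd τ hτ.1).eventually_ne (c := b) hne
    rw [← Filter.empty_mem_iff_bot, mem_nhdsWithin_iff_eventually]
    rw [eventually_nhdsWithin_iff] at this
    filter_upwards [this] with w hw hw'
    exact hw (ne_of_gt hw'.2) hw'.1.2
  refine (h1.union hends).mono fun τ hτ => ?_
  by_cases hi : τ ∈ interior I
  · exact Or.inl ⟨hi, hτ.2⟩
  · exact Or.inr ⟨hτ.1, hi⟩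

/-- A bounded function that is continuous before `x` and takes almost no value infinitely often
near `x` has a left limit at `x`. -/
theorem exists_tendsto_left {g : ℝ → ℝ} {x R : ℝ} (hc : ∀ᶠ w in 𝓝[<] x, ContinuousAt g w)
    (hb : ∀ w, |g w| ≤ R) {A : Set ℝ} (hA : A.Finite)
    (hfr : ∀ y, (∃ᶠ w in 𝓝[<] x, g w = y) → y ∈ A) : ∃ l, Tendsto g (𝓝[<] x) (𝓝 l) := by
  obtain ⟨δ, hδ, hδc⟩ := mem_nhdsLT_iff_exists_Ioo_subset.1 hc
  refine tendsto_of_no_upcrossings dense_univ ?_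
    ⟨R, by simpa using Eventually.of_forall fun w => le_of_abs_le (hb w)⟩
    ⟨-R, by simpa using Eventually.of_forall fun w => neg_le_of_abs_le (hb w)⟩
  rintro a - b - hab ⟨h1, h2⟩
  -- If `g` oscillated across `(a, b)`, the intermediate value theorem would make every value in
  -- `(a, b)` recur near `x`, but only those in the finite set `A` may.
  obtain ⟨y, hy, hyA⟩ := ((Ioo_infinite hab).sdiff hA).nonempty
  refine hyA (hfr y ?_)
  rw [frequently_iff]
  intro U hU
  obtain ⟨ε, hε, hεU⟩ := mem_nhdsLT_iff_exists_Ioo_subset.1 hU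
  have hI : Ioo (max δ ε) x ∈ 𝓝[<] x := Ioo_mem_nhdsLT (max_lt hδ hε)
  obtain ⟨w₁, hw₁, hg₁⟩ := frequently_iff.1 h1 hI
  obtain ⟨w₂, hw₂, hg₂⟩ := frequently_iff.1 h2 hI
  have hsub : uIcc w₁ w₂ ⊆ Ioo (max δ ε) x := ordConnected_Ioo.uIcc_subset hw₁ hw₂
  have hcont : ContinuousOn g (uIcc w₁ w₂) := fun w hw =>
    (hδc ⟨(le_max_left _ _).trans_lt (hsub hw).1, (hsub hw).2⟩ : ContinuousAt g w).continuousWithinAt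
  obtain ⟨w, hw, hwy⟩ := intermediate_value_uIcc hcont
    (show y ∈ uIcc (g w₁) (g w₂) from Icc_subset_uIcc ⟨(hg₁.trans hy.1).le, (hy.2.trans hg₂).le⟩)
  exact ⟨w, hεU ⟨(le_max_right _ _).trans_lt (hsub hw).1, (hsub hw).2⟩, hwy⟩

theorem exists_tendsto_right {g : ℝ → ℝ} {x R : ℝ} (hc : ∀ᶠ w in 𝓝[>] x, ContinuousAt g w)
    (hb : ∀ w, |g w| ≤ R) {A : Set ℝ} (hA : A.Finite)
    (hfr : ∀ y, (∃ᶠ w in 𝓝[>] x, g w = y) → y ∈ A) : ∃ l, Tendsto g (𝓝[>] x) (𝓝 l) := by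
  have hneg : Tendsto (fun w : ℝ => -w) (𝓝[<] (-x)) (𝓝[>] x) := by
    simpa using tendsto_neg_nhdsLT (a := -x)
  have hneg' : Tendsto (fun w : ℝ => -w) (𝓝[>] x) (𝓝[<] (-x)) := tendsto_neg_nhdsGT
  obtain ⟨l, hl⟩ := exists_tendsto_left (g := fun w => g (-w)) (x := -x) (R := R)
    ((hneg.eventually hc).mono fun w hw => hw.comp_of_eq continuousAt_neg rfl)
    (fun w => hb _) hA fun y hy => hfr y (hneg.frequently hy)
  exact ⟨l, (hl.comp hneg').congr fun w => by simp⟩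

/-- A bounded measurable function with bounded support. -/
structure BoundedProfile (w : ℝ → ℝ) (K R : ℝ) : Prop where
  measurable : Measurable w
  bound : ∀ x, |w x| ≤ K
  support : ∀ x, R ≤ |x| → w x = 0

namespace BoundedProfile

variable {w : ℝ → ℝ} {K R x : ℝ}

theorem integrable (hw : BoundedProfile w K R) : Integrable w := by
  have h1 : IntegrableOn w (Icc (-R) R) :=
    Integrable.of_bound hw.measurable.aestronglyMeasurable K (ae_of_all _ hw.bound)
  refine (integrableOn_iff_integrable_of_support_subset fun x hx => ?_).1 h1
  by_contra hn
  refine hx (hw.support x ?_)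
  rw [mem_Icc, ← _root_.abs_le] at hn
  exact (not_le.1 hn).le

theorem primitive_sub (hw : BoundedProfile w K R) (x y : ℝ) :
    primitive w y - primitive w x = ∫ z in x..y, w z := by
  rw [primitive, primitive]
  exact intervalIntegral.integral_Iic_sub_Iic hw.integrable.integrableOn hw.integrable.integrableOn

theorem abs_primitive_sub_le (hw : BoundedProfile w K R) (x y : ℝ) :
    |primitive w y - primitive w x| ≤ K * |y - x| := by
  rw [hw.primitive_sub]
  exact intervalIntegral.norm_integral_le_of_norm_le_const (f := w) (C := K) fun z _ => hw.bound z

theorem continuous_primitive (hw : BoundedProfile w K R) : Continuous (primitive w) := by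
  refine (LipschitzWith.of_dist_le_mul (K := K.toNNReal) fun x y => ?_).continuous
  rw [Real.dist_eq, Real.dist_eq, Real.coe_toNNReal _ ((abs_nonneg _).trans (hw.bound 0))]
  exact hw.abs_primitive_sub_le y x

theorem abs_primitive_le (hw : BoundedProfile w K R) (x : ℝ) : |primitive w x| ≤ ∫ y, |w y| := by
  rw [primitive]
  refine (abs_integral_le_integral_abs).trans ?_
  exact setIntegral_le_integral hw.integrable.abs (Eventually.of_forall fun _ => abs_nonneg _)

theorem primitive_eq (hw : BoundedProfile w K R) (hx : x ≤ -R) (y : ℝ) :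
    primitive w y = ∫ z in x..y, w z := by
  have : primitive w x = 0 := by
    rw [primitive]
    refine setIntegral_eq_zero_of_forall_eq_zero fun y hy => hw.support y ?_
    have : y ≤ x := hy
    exact le_trans (by linarith) (neg_le_abs y)
  rw [← hw.primitive_sub, this, sub_zero]

theorem hasDerivWithinAt_right (hw : BoundedProfile w K R) {r : ℝ}
    (hr : Tendsto w (𝓝[>] x) (𝓝 r)) : HasDerivWithinAt (primitive w) r (Ici x) x := by
  rw [show primitive w = fun y => primitive w x + ∫ z in x..y, w z from
    funext fun y => by rw [← hw.primitive_sub]; ring]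
  refine HasDerivWithinAt.const_add _ ?_
  exact intervalIntegral.integral_hasDerivWithinAt_of_tendsto_ae_right (t := Ioi x)
    hw.integrable.intervalIntegrable
    (hw.measurable.stronglyMeasurable.stronglyMeasurableAtFilter) (hr.mono_left inf_le_left)

theorem hasDerivWithinAt_left (hw : BoundedProfile w K R) {l : ℝ}
    (hl : Tendsto w (𝓝[<] x) (𝓝 l)) : HasDerivWithinAt (primitive w) l (Iic x) x := by
  rw [show primitive w = fun y => primitive w x + ∫ z in x..y, w z from
    funext fun y => by rw [← hw.primitive_sub]; ring]
  refine HasDerivWithinAt.const_add _ ?_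
  refine intervalIntegral.integral_hasDerivWithinAt_of_tendsto_ae_right (t := Iic x)
    hw.integrable.intervalIntegrable
    (hw.measurable.stronglyMeasurable.stronglyMeasurableAtFilter) (hl.mono_left ?_)
  have : ae (volume : Measure ℝ) ≤ 𝓟 {x}ᶜ := by
    rw [le_principal_iff, mem_ae_iff, compl_compl]; simp
  calc 𝓝[≤] x ⊓ ae volume ≤ 𝓝[≤] x ⊓ 𝓟 {x}ᶜ := inf_le_inf_left _ this
    _ = 𝓝[<] x := by
      rw [nhdsWithin, inf_assoc, inf_principal, nhdsWithin]
      congr 2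
      ext z; simp [lt_iff_le_and_ne]

theorem hasDerivAt (hw : BoundedProfile w K R) (hx : ContinuousAt w x) :
    HasDerivAt (primitive w) (w x) x := by
  have := (hw.hasDerivWithinAt_left (hx.tendsto.mono_left nhdsWithin_le_nhds)).union
    (hw.hasDerivWithinAt_right (hx.tendsto.mono_left nhdsWithin_le_nhds))
  rwa [Iic_union_Ici, hasDerivWithinAt_univ] at this

end BoundedProfile

section InitialCurve

variable {f h X Y : ℝ → ℝ} {K : ℝ}

/-- `X` is monotone and onto, hence proper, and so is the pair. The embedding allows nearness on the
surface to be read off from the parameters. -/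
theorem IsParametrization.isClosedEmbedding (P : IsParametrization h X Y) :
    IsClosedEmbedding fun s => (X s, Y s) := by
  have hc : Continuous fun s => (X s, Y s) := P.continuous_fst.prodMk P.continuous_snd
  have htop : Tendsto X atTop atTop := tendsto_atTop_atTop_of_monotone P.monotone_fst fun b => by
    obtain ⟨s, hs⟩ := P.exists_fst_eq b
    exact ⟨s, hs.ge⟩
  have hbot : Tendsto X atBot atBot := tendsto_atBot_atBot_of_monotone P.monotone_fst fun b => by
    obtain ⟨s, hs⟩ := P.exists_fst_eq b
    exact ⟨s, hs.le⟩
  have hX : Tendsto X (cocompact ℝ) (cocompact ℝ) := by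
    rw [cocompact_eq_atBot_atTop]
    exact hbot.sup_sup htop
  have hXY : Tendsto (fun s => (X s, Y s)) (cocompact ℝ) (cocompact (ℝ × ℝ)) := by
    rw [(hasBasis_cocompact (X := ℝ × ℝ)).tendsto_right_iff]
    intro k hk
    filter_upwards [hX (hk.image _root_.continuous_fst).compl_mem_cocompact] with s hs hmem
    exact hs ⟨_, hmem, rfl⟩
  exact .of_continuous_injective_isClosedMap hc P.injective
    (isProperMap_iff_tendsto_cocompact.2 ⟨hc, hXY⟩).isClosedMap

theorem IsParametrization.isClosed_completedGraph (P : IsParametrization h X Y) :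
    IsClosed (completedGraph h) := by
  rw [← P.range_eq]
  exact P.isClosedEmbedding.isClosed_range

/-- Off a finite set of abscissas the initial curve is the graph of `h` near a point of
differentiability. -/
theorem PiecewiseC1.exists_exceptional (hh : PiecewiseC1 h) : ∃ S : Finset ℝ,
    (∀ x, x ∉ S → ContDiffAt ℝ 1 h x) ∧ (∀ p ∈ initialCurve h, p.1 ∉ S → p.2 = h p.1) ∧
      ∀ p ∈ initialCurve h, p ∉ completedGraph h → p.1 ∈ S ∧ p.2 = h p.1 := by
  obtain ⟨S, hS, -⟩ := hh
  refine ⟨S, hS, fun p hp hpS => ?_, fun p hp hpc => ?_⟩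
  · rcases hp with hp | hp
    exacts [hp, Admissible.snd_eq_of_continuousAt hp (hS _ hpS).continuousAt]
  · have hp : p.2 = h p.1 := hp.resolve_right hpc
    refine ⟨by_contra fun hn => hpc ?_, hp⟩
    have hc := (hS _ hn).continuousAt
    change p.2 ∈ uIcc _ _
    rw [Admissible.leftLim_eq_of_continuousAt hc, Admissible.rightLim_eq_of_continuousAt hc, hp]
    simp

end InitialCurve

end EqualArea

/-! ### Discontinuities and potential of a function in the class `Υ` -/

namespace EqualArea
open Function

variable {f h X Y : ℝ → ℝ} {K : ℝ} {E : Finset ℝ} {v : ℝ → ℝ → ℝ}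

/-- The points of the open upper half plane at which `v` is discontinuous. -/
def badSet (v : ℝ → ℝ → ℝ) : Set (ℝ × ℝ) :=
  {q | 0 < q.2 ∧ ¬ ContinuousAt (fun p : ℝ × ℝ => v p.1 p.2) q}

theorem measurableSet_badSet (v : ℝ → ℝ → ℝ) : MeasurableSet (badSet v) :=
  (isOpen_lt continuous_const continuous_snd).measurableSet.inter
    (IsGδ.setOfPred_continuousAt _).measurableSet.compl

namespace Folding

/-- A point of `Γ̂` at which the graph of `v` is relatively open is a point of continuity. -/
theorem continuousAt_of_notMem_boundary (F : Folding f h X Y K E) {x₀ t₀ : ℝ} (ht : 0 < t₀)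
    (hb : (x₀, t₀, v x₀ t₀) ∉ graphBoundary f h v)
    (hc : (x₀ - deriv f (v x₀ t₀) * t₀, v x₀ t₀) ∈ completedGraph h) :
    ContinuousAt (fun p : ℝ × ℝ => v p.1 p.2) (x₀, t₀) := by
  obtain ⟨s₀, hX, hY⟩ := F.param.exists_eq hc
  simp only at hX hY
  have hx₀ : position f X Y t₀ s₀ = x₀ := by rw [position, hY, hX]; ring
  have hsurf : ∀ s t, 0 ≤ t → (position f X Y t s, t, Y s) ∈ boundingSurface f h := fun s t ht =>
    ⟨ht, (X s, Y s), F.param.mem_initialCurve s, rfl⟩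
  have hp : (x₀, t₀, v x₀ t₀) ∈ boundingSurface f h := by
    have := hsurf s₀ t₀ ht.le
    rwa [hx₀, hY] at this
  have hint : (⟨_, hp⟩ : boundingSurface f h) ∈
      interior (((↑) : boundingSurface f h → ℝ × ℝ × ℝ) ⁻¹' graphOf v) := by
    by_contra hn
    refine hb ⟨⟨_, hp⟩, ⟨subset_closure ?_, hn⟩, rfl⟩
    exact ⟨ht.le, rfl⟩
  obtain ⟨O', hO', hO'o, hpO'⟩ := mem_interior.1 hint
  obtain ⟨O, hO, rfl⟩ := isOpen_induced_iff.1 hO'o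
  have hpO : (x₀, t₀, v x₀ t₀) ∈ O := hpO'
  have hcont : Continuous fun q : ℝ × ℝ => (position f X Y q.2 q.1, q.2, Y q.1) :=
    (F.param.continuous_position F.admissible).prodMk
      (continuous_snd.prodMk (F.param.continuous_snd.comp continuous_fst))
  have hev : ∀ᶠ q : ℝ × ℝ in 𝓝 (s₀, t₀), v (position f X Y q.2 q.1) q.2 = Y q.1 := by
    have h1 : ∀ᶠ q : ℝ × ℝ in 𝓝 (s₀, t₀), (position f X Y q.2 q.1, q.2, Y q.1) ∈ O :=
      hcont.continuousAt.eventually (hO.mem_nhds (by simpa [hx₀, hY] using hpO))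
    have h2 : ∀ᶠ q : ℝ × ℝ in 𝓝 (s₀, t₀), 0 < q.2 :=
      (continuous_snd.tendsto _).eventually (lt_mem_nhds ht)
    filter_upwards [h1, h2] with q hq hq'
    have : (⟨_, hsurf q.1 q.2 hq'.le⟩ : boundingSurface f h) ∈ Subtype.val ⁻¹' O := hq
    exact (hO' this).2.symm
  refine fun W hW => ?_
  have hW : W ∈ 𝓝 (v x₀ t₀) := hW
  have hYW : ∀ᶠ q : ℝ × ℝ in 𝓝 (s₀, t₀), Y q.1 ∈ W :=
    (F.param.continuous_snd.comp continuous_fst).continuousAt.eventually (by simpa [hY] using hW)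
  obtain ⟨ε, hε, hball⟩ := Metric.eventually_nhds_iff_ball.1 (hev.and hYW)
  have hbox : ∀ s t, s ∈ Icc (s₀ - ε / 2) (s₀ + ε / 2) → |t - t₀| < ε →
      v (position f X Y t s) t = Y s ∧ Y s ∈ W := by
    intro s t hs htt
    refine hball (s, t) ?_
    rw [← ball_prod_same]
    refine ⟨?_, by rwa [Metric.mem_ball, Real.dist_eq]⟩
    rw [Metric.mem_ball, Real.dist_eq, abs_lt]
    constructor <;> linarith [hs.1, hs.2]
  have hle : s₀ - ε / 2 ≤ s₀ + ε / 2 := by linarith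
  -- Near `(s₀, t₀)` the function `v` returns `Y s` at the position of `s`, so equal positions have
  -- equal ordinates and hence equal parameters. The position is thus strictly monotone at time
  -- `t₀`, and for nearby times the intermediate value theorem still covers a neighbourhood of `x₀`.
  have hinj : InjOn (position f X Y t₀) (Icc (s₀ - ε / 2) (s₀ + ε / 2)) := by
    intro s hs s' hs' he
    have h1 := (hbox s t₀ hs (by simpa using hε)).1
    have h2 := (hbox s' t₀ hs' (by simpa using hε)).1
    have hYe : Y s = Y s' := by rw [← h1, ← h2, he]
    refine F.param.eq_of_eq ?_ hYe
    rw [position, position, hYe] at he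
    linarith
  have hpc := F.param.continuous_position F.admissible
  have hsides : (position f X Y t₀ (s₀ - ε / 2) - x₀) * (position f X Y t₀ (s₀ + ε / 2) - x₀) < 0 := by
    rw [← hx₀]
    have m1 : s₀ - ε / 2 ∈ Icc (s₀ - ε / 2) (s₀ + ε / 2) := ⟨le_rfl, hle⟩
    have m2 : s₀ + ε / 2 ∈ Icc (s₀ - ε / 2) (s₀ + ε / 2) := ⟨hle, le_rfl⟩
    have m0 : s₀ ∈ Icc (s₀ - ε / 2) (s₀ + ε / 2) := ⟨by linarith, by linarith⟩
    rcases (F.param.continuous_position_left F.admissible t₀).continuousOn.strictMonoOn_of_injOn_Icc'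
      hle hinj with hm | hm
    · exact mul_neg_of_neg_of_pos (sub_neg.2 (hm m1 m0 (by linarith)))
        (sub_pos.2 (hm m0 m2 (by linarith)))
    · exact mul_neg_of_pos_of_neg (sub_pos.2 (hm m1 m0 (by linarith)))
        (sub_neg.2 (hm m0 m2 (by linarith)))
  have hs' : ∀ᶠ q : ℝ × ℝ in 𝓝 (x₀, t₀), (position f X Y q.2 (s₀ - ε / 2) - q.1) *
      (position f X Y q.2 (s₀ + ε / 2) - q.1) < 0 := by
    have hc' : Continuous fun q : ℝ × ℝ => (position f X Y q.2 (s₀ - ε / 2) - q.1) *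
        (position f X Y q.2 (s₀ + ε / 2) - q.1) := by
      unfold position; fun_prop
    exact hc'.continuousAt.eventually (gt_mem_nhds hsides)
  have ht' : ∀ᶠ q : ℝ × ℝ in 𝓝 (x₀, t₀), |q.2 - t₀| < ε := by
    have hc' : Continuous fun q : ℝ × ℝ => |q.2 - t₀| := by fun_prop
    exact hc'.continuousAt.eventually (gt_mem_nhds (by simpa using hε))
  rw [mem_map]
  filter_upwards [hs', ht'] with q hq hqt
  have hmem : q.1 ∈ uIcc (position f X Y q.2 (s₀ - ε / 2)) (position f X Y q.2 (s₀ + ε / 2)) := by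
    rw [mem_uIcc]
    rcases mul_neg_iff.1 hq with ⟨a, b⟩ | ⟨a, b⟩
    · right; constructor <;> linarith
    · left; constructor <;> linarith
  obtain ⟨s, hs, hsx⟩ := intermediate_value_uIcc
    (F.param.continuous_position_left F.admissible q.2).continuousOn hmem
  rw [uIcc_of_le hle] at hs
  have := hbox s q.2 hs hqt
  rw [hsx] at this
  change v q.1 q.2 ∈ W
  rw [this.1]; exact this.2

end Folding

namespace MemUpsilon

theorem foot_mem (hv : MemUpsilon f h v) {t : ℝ} (ht : 0 ≤ t) (x : ℝ) :
    (x - deriv f (v x t) * t, v x t) ∈ initialCurve h := by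
  obtain ⟨-, p, hp, he⟩ := hv.surface (show (x, t, v x t) ∈ graphOf v from ⟨ht, rfl⟩)
  obtain ⟨h1, h2⟩ := Prod.ext_iff.1 he
  simp only [shear] at h1 h2
  rw [← h2, ← h1, add_sub_cancel_right]
  exact hp

theorem abs_le (hv : MemUpsilon f h v) (H : Admissible f h K) {t : ℝ} (ht : 0 ≤ t) (x : ℝ) :
    |v x t| ≤ K - 1 := H.abs_le_of_mem_initialCurve (hv.foot_mem ht x)

theorem exists_far (hv : MemUpsilon f h v) (H : Admissible f h K) (T : ℝ) :
    ∃ R, 0 < R ∧ ∀ t, 0 ≤ t → t ≤ T → ∀ x, R ≤ |x| → v x t = 0 := by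
  obtain ⟨R, hR, hfar, -⟩ := H.exists_far
  obtain ⟨C, hC0, -, hC⟩ := H.exists_flux_bound
  refine ⟨R + C * |T| + 1, by positivity, fun t ht htT x hx => ?_⟩
  refine hfar _ (hv.foot_mem ht x) ?_
  have h1 := hC (v x t) ((hv.abs_le H ht x).trans (by linarith))
  have h2 : |deriv f (v x t) * t| ≤ C * |T| := by
    rw [abs_mul]
    exact mul_le_mul h1 (abs_le_abs_of_nonneg ht htT) (abs_nonneg _) hC0
  have h3 := abs_sub_abs_le_abs_sub x (deriv f (v x t) * t)
  simp only
  linarith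

/-- The discontinuities of `v` lie over its boundary curves and over finitely many rays. -/
theorem badSet_subset (hv : MemUpsilon f h v) (F : Folding f h X Y K E) : ∃ S : Finset ℝ,
    ∀ q ∈ badSet v, (q.1, q.2, v q.1 q.2) ∈ graphBoundary f h v ∨
      ∃ ξ ∈ S, q.1 = ξ + deriv f (h ξ) * q.2 := by
  obtain ⟨S, -, -, hS⟩ := F.admissible.piecewise.exists_exceptional
  refine ⟨S, fun q hq => ?_⟩
  by_contra! hn
  refine hq.2 (F.continuousAt_of_notMem_boundary hq.1 hn.1 (by_contra fun hc => ?_))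
  -- Off the completed graph the initial curve has only stray values of `h` at its exceptional
  -- points; each of them travels along one ray.
  obtain ⟨h1, h2⟩ := hS _ (hv.foot_mem hq.1.le q.1) hc
  refine hn.2 _ h1 ?_
  simp only at h2
  rw [← h2]; ring

theorem finite_slice (hv : MemUpsilon f h v) (F : Folding f h X Y K E) (t : ℝ) :
    {x | (x, t) ∈ badSet v}.Finite := by
  obtain ⟨S, hS⟩ := hv.badSet_subset F
  obtain ⟨𝒞, h𝒞, hA, hbd⟩ := hv.boundary
  have hfin : (⋃ A ∈ 𝒞, (fun p : ℝ × ℝ × ℝ => (p.1, p.2.1)) '' A ∩ {q | q.2 = t}).Finite :=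
    h𝒞.biUnion fun A hA' => (hA A hA').2 t
  refine ((hfin.image Prod.fst).union (S.image fun ξ => ξ + deriv f (h ξ) * t).finite_toSet).subset
    fun x hx => ?_
  rcases hS _ hx with hb | ⟨ξ, hξ, he⟩
  · left
    rw [hbd] at hb
    obtain ⟨A, hA', hmem⟩ := hb
    exact ⟨(x, t), mem_biUnion hA' ⟨⟨_, hmem, rfl⟩, rfl⟩, rfl⟩
  · right
    simp only [Finset.coe_image, mem_image, Finset.mem_coe]
    exact ⟨ξ, hξ, he.symm⟩

/-- By `ae_countable_fiber` almost every line `x = b` meets the boundary curves at countably many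
times. A ray meets such a line once, unless it is vertical, and this is avoided for `b ∉ S`. -/
theorem ae_countable_times (hv : MemUpsilon f h v) (F : Folding f h X Y K E) :
    ∀ᵐ b, {t | (b, t) ∈ badSet v}.Countable := by
  obtain ⟨S, hS⟩ := hv.badSet_subset F
  obtain ⟨𝒞, h𝒞, hA, hbd⟩ := hv.boundary
  have h1 : ∀ᵐ b, ∀ A ∈ 𝒞, {t | (b, t) ∈ (fun p : ℝ × ℝ × ℝ => (p.1, p.2.1)) '' A}.Countable := by
    refine (ae_ball_iff h𝒞.countable).2 fun A hA' => ?_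
    obtain ⟨I, c, hI, -, hc, rfl⟩ := (hA A hA').1
    filter_upwards [ae_countable_fiber hI (contDiff_fst.comp_contDiffOn hc)] with b hb
    refine (hb.image fun τ => (c τ).2.1).mono ?_
    rintro t ⟨_, ⟨τ, hτ, rfl⟩, he⟩
    obtain ⟨h1, h2⟩ := Prod.ext_iff.1 he
    exact ⟨τ, ⟨hτ, h1⟩, h2⟩
  have h2 : ∀ᵐ b : ℝ, b ∉ S := S.countable_toSet.ae_notMem volume
  filter_upwards [h1, h2] with b hb hbS
  have hrays : (⋃ ξ ∈ S, {t | b = ξ + deriv f (h ξ) * t}).Countable := by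
    refine S.countable_toSet.biUnion fun ξ hξ => Set.Subsingleton.countable ?_
    intro t ht t' ht'
    have ht : b = ξ + deriv f (h ξ) * t := ht
    have ht' : b = ξ + deriv f (h ξ) * t' := ht'
    have hne : deriv f (h ξ) ≠ 0 := by
      intro h0
      rw [h0, zero_mul, add_zero] at ht
      exact hbS (ht ▸ hξ)
    exact mul_left_cancel₀ hne (by linarith)
  refine ((h𝒞.countable.biUnion hb).union hrays).mono fun t ht => ?_
  rcases hS _ ht with hb' | ⟨ξ, hξ, he⟩
  · left
    rw [hbd] at hb'
    obtain ⟨A, hA', hmem⟩ := hb'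
    exact mem_biUnion hA' ⟨_, hmem, rfl⟩
  · right
    exact mem_biUnion hξ he

theorem continuousAt_slice {t x : ℝ} (ht : 0 < t) (hx : (x, t) ∉ badSet v) : ContinuousAt (fun x => v x t) x := by
  have : ContinuousAt (fun p : ℝ × ℝ => v p.1 p.2) (x, t) := by
    by_contra hn
    exact hx ⟨ht, hn⟩
  exact this.comp_of_eq (f := fun w => (w, t)) (by fun_prop) rfl

theorem boundedProfile (hv : MemUpsilon f h v) (F : Folding f h X Y K E) {R T : ℝ}
    (hR : ∀ t, 0 ≤ t → t ≤ T → ∀ x, R ≤ |x| → v x t = 0) {t : ℝ} (ht : 0 ≤ t) (htT : t ≤ T) :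
    BoundedProfile (fun x => v x t) K R := by
  refine ⟨?_, fun x => (hv.abs_le F.admissible ht x).trans (by linarith), hR t ht htT⟩
  rcases ht.eq_or_lt with rfl | ht
  · rw [show (fun x => v x 0) = h from funext hv.initial]
    exact F.admissible.piecewise.measurable
  · exact PiecewiseC1.measurable_of_finite (S := (hv.finite_slice F t).toFinset) fun x hx =>
      continuousAt_slice ht (by simpa using hx)

theorem continuousWithinAt_time (hv : MemUpsilon f h v) (F : Folding f h X Y K E) {t : ℝ}
    (ht : 0 ≤ t) : ∀ᵐ x, ContinuousWithinAt (fun τ => v x τ) (Ici 0) t := by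
  rcases ht.eq_or_lt with rfl | ht
  · obtain ⟨S, hS, hS', -⟩ := F.admissible.piecewise.exists_exceptional
    obtain ⟨C, hC0, -, hC⟩ := F.admissible.exists_flux_bound
    filter_upwards [S.countable_toSet.ae_notMem volume] with x hx
    have hfoot : Tendsto (fun τ => x - deriv f (v x τ) * τ) (𝓝[≥] 0) (𝓝 x) := by
      have hz : Tendsto (fun τ => deriv f (v x τ) * τ) (𝓝[≥] 0) (𝓝 0) := by
        refine squeeze_zero_norm' (a := fun τ : ℝ => C * |τ|) ?_ ?_
        · filter_upwards [self_mem_nhdsWithin] with τ hτ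
          rw [norm_mul, Real.norm_eq_abs, Real.norm_eq_abs]
          exact mul_le_mul_of_nonneg_right
            (hC _ ((hv.abs_le F.admissible hτ x).trans (by linarith))) (abs_nonneg _)
        · have : Continuous fun τ : ℝ => C * |τ| := by fun_prop
          simpa using (this.tendsto 0).mono_left nhdsWithin_le_nhds
      simpa using tendsto_const_nhds.sub hz
    have h1 : ∀ᶠ y in 𝓝 x, y ∉ S :=
      (S.finite_toSet.isClosed.isOpen_compl).mem_nhds (by simpa using hx)
    have h2 : Tendsto (fun τ => h (x - deriv f (v x τ) * τ)) (𝓝[≥] 0) (𝓝 (h x)) :=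
      ((hS x hx).continuousAt.tendsto).comp hfoot
    rw [ContinuousWithinAt, hv.initial]
    refine h2.congr' ?_
    filter_upwards [hfoot.eventually h1, self_mem_nhdsWithin] with τ hτ hτ0
    exact (hS' _ (hv.foot_mem hτ0 x) hτ).symm
  · filter_upwards [(hv.finite_slice F t).countable.ae_notMem volume] with x hx
    have : ContinuousAt (fun p : ℝ × ℝ => v p.1 p.2) (x, t) := by
      by_contra hn
      exact hx ⟨ht, hn⟩
    exact (this.comp_of_eq (f := fun τ => (x, τ)) (by fun_prop) rfl).continuousWithinAt

theorem continuousOn_primitive (hv : MemUpsilon f h v) (F : Folding f h X Y K E) (b : ℝ) :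
    ContinuousOn (fun t => primitive (fun x => v x t) b) (Ici 0) := by
  intro t ht
  have ht : 0 ≤ t := ht
  obtain ⟨R, hR0, hR⟩ := hv.exists_far F.admissible (t + 1)
  have hev : ∀ᶠ τ in 𝓝[Ici 0] t, 0 ≤ τ ∧ τ ≤ t + 1 :=
    (eventually_mem_nhdsWithin (s := Ici (0 : ℝ))).and
      (((eventually_lt_nhds (show t < t + 1 by linarith)).mono fun _ h => h.le).filter_mono
        nhdsWithin_le_nhds)
  have hb : BoundedProfile ((Icc (-R) R).indicator fun _ => K) K (R + 1) := by
    refine ⟨measurable_const.indicator measurableSet_Icc, fun x => ?_, fun x hx => ?_⟩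
    · have hK := F.admissible.one_le
      by_cases hx : x ∈ Icc (-R) R
      · rw [indicator_of_mem hx, abs_of_nonneg (by linarith)]
      · rw [indicator_of_notMem hx, abs_zero]; linarith
    · refine indicator_of_notMem (fun hm => ?_) _
      have := _root_.abs_le.2 hm
      linarith
  simp only [primitive]
  refine continuousWithinAt_of_dominated (bound := (Icc (-R) R).indicator fun _ => K) ?_ ?_
    hb.integrable.integrableOn (ae_restrict_of_ae (hv.continuousWithinAt_time F ht))
  · filter_upwards [hev] with τ hτ
    exact (hv.boundedProfile F hR hτ.1 hτ.2).measurable.aestronglyMeasurable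
  · filter_upwards [hev] with τ hτ
    refine ae_of_all _ fun x => ?_
    by_cases hx : x ∈ Icc (-R) R
    · rw [indicator_of_mem hx]
      exact (hv.boundedProfile F hR hτ.1 hτ.2).bound x
    · rw [indicator_of_notMem hx, hR τ hτ.1 hτ.2 x, norm_zero]
      rw [mem_Icc, ← _root_.abs_le] at hx
      exact (not_le.1 hx).le

/-- The integral law applies on `[a, b]` with `a` so far left that `v` vanishes around `(a, t)`; the
flux through `a` is then `f 0`. -/
theorem hasDerivAt_primitive (hv : MemUpsilon f h v) (hl : SolvesIntegralLaw f v)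
    (F : Folding f h X Y K E) {b t : ℝ} (ht : 0 < t) (hb : (b, t) ∉ badSet v) :
    HasDerivAt (fun τ => primitive (fun x => v x τ) b) (-(f (v b t) - f 0)) t := by
  obtain ⟨R, hR0, hR⟩ := hv.exists_far F.admissible (t + 1)
  have hcb : ContinuousAt (fun p : ℝ × ℝ => v p.1 p.2) (b, t) := by
    by_contra hn
    exact hb ⟨ht, hn⟩
  set a := -R - |b| - 1 with ha
  have hab : a < b := by have := neg_abs_le b; linarith
  have hzero : ∀ᶠ p : ℝ × ℝ in 𝓝 (a, t), v p.1 p.2 = 0 := by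
    have h1 : ∀ᶠ p : ℝ × ℝ in 𝓝 (a, t), p.1 < -R :=
      (continuous_fst.tendsto _).eventually (gt_mem_nhds (by simp only [ha]; linarith [abs_nonneg b]))
    have h2 : ∀ᶠ p : ℝ × ℝ in 𝓝 (a, t), 0 < p.2 ∧ p.2 < t + 1 :=
      (continuous_snd.tendsto _).eventually (Ioo_mem_nhds ht (by simp))
    filter_upwards [h1, h2] with p hp hp'
    exact hR _ hp'.1.le hp'.2.le _ (le_trans (by linarith) (neg_le_abs p.1))
  have hva : v a t = 0 := hzero.self_of_nhds
  have hca : ContinuousAt (fun p : ℝ × ℝ => v p.1 p.2) (a, t) :=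
    continuousAt_const.congr (hzero.mono fun p hp => hp.symm)
  have h1 := hl.hasDerivAt a b t hab ht hca hcb
  rw [hva] at h1
  have h2 : (fun τ => primitive (fun x => v x τ) b) =ᶠ[𝓝 t] fun τ => ∫ x in a..b, v x τ := by
    filter_upwards [Ioo_mem_nhds ht (show t < t + 1 by linarith)] with τ hτ
    exact (hv.boundedProfile F hR hτ.1.le hτ.2.le).primitive_eq
      (by simp only [ha]; linarith [abs_nonneg b]) b
  exact (h1.congr_of_eventuallyEq h2).congr_deriv (by ring)

/-- The potential of `v` is Lipschitz continuous in time. -/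
theorem abs_primitive_sub_le (hv : MemUpsilon f h v) (hl : SolvesIntegralLaw f v)
    (F : Folding f h X Y K E) {C : ℝ} (hC : ∀ y, |y| ≤ K → |f y - f 0| ≤ C) {t t' : ℝ} (ht : 0 ≤ t)
    (htt : t ≤ t') (b : ℝ) :
    |primitive (fun x => v x t') b - primitive (fun x => v x t) b| ≤ C * |t' - t| := by
  -- If the bad times on `x = b` are countable, the bounded time derivative can be integrated. Such
  -- `b` are dense, and the bound passes to all others by continuity.
  have hgood : ∀ b, {t | (b, t) ∈ badSet v}.Countable →
      |primitive (fun x => v x t') b - primitive (fun x => v x t) b| ≤ C * |t' - t| := by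
    intro b hb
    set V := fun τ => primitive (fun x => v x τ) b with hV
    have hder : ∀ τ, 0 < τ → (b, τ) ∉ badSet v → |deriv V τ| ≤ C ∧ HasDerivAt V (deriv V τ) τ := by
      intro τ hτ hτb
      have h1 := hv.hasDerivAt_primitive hl F hτ hτb
      rw [h1.deriv]
      refine ⟨?_, h1⟩
      rw [abs_neg]
      exact hC _ ((hv.abs_le F.admissible hτ.le b).trans (by linarith))
    have hae : ∀ᵐ τ, 0 < τ → |deriv V τ| ≤ C := by
      filter_upwards [hb.ae_notMem volume] with τ hτ hτ0
      exact (hder τ hτ0 hτ).1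
    have hint : IntervalIntegrable (deriv V) volume t t' := by
      refine (intervalIntegrable_const (c := C)).mono_fun
        (measurable_deriv V).aestronglyMeasurable ?_
      refine (ae_restrict_iff' measurableSet_uIoc).2 ?_
      filter_upwards [hae] with τ hτ hmem
      rw [uIoc_of_le htt] at hmem
      exact (hτ (ht.trans_lt hmem.1)).trans (le_abs_self C)
    have h1 : ∫ τ in t..t', deriv V τ = V t' - V t := by
      refine MeasureTheory.integral_eq_of_hasDerivAt_off_countable V _ hb ?_ ?_ hint
      · exact (hv.continuousOn_primitive F b).mono fun τ hτ => by
          rw [uIcc_of_le htt] at hτ; exact ht.trans hτ.1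
      · intro τ hτ
        rw [min_eq_left htt] at hτ
        exact (hder τ (ht.trans_lt hτ.1.1) hτ.2).2
    change |V t' - V t| ≤ _
    rw [← h1]
    refine intervalIntegral.norm_integral_le_of_norm_le_const_ae (f := deriv V) (C := C) ?_
    filter_upwards [hae] with τ hτ hmem
    rw [uIoc_of_le htt] at hmem
    exact hτ (ht.trans_lt hmem.1)
  obtain ⟨R, hR0, hR⟩ := hv.exists_far F.admissible t'
  have c1 := (hv.boundedProfile F hR (ht.trans htt) le_rfl).continuous_primitive
  have c2 := (hv.boundedProfile F hR ht htt).continuous_primitive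
  have hd := Measure.dense_of_ae (μ := (volume : Measure ℝ)) (hv.ae_countable_times F)
  have hcl : IsClosed {b | |primitive (fun x => v x t') b - primitive (fun x => v x t) b| ≤
      C * |t' - t|} := isClosed_le (c1.sub c2).abs continuous_const
  exact (hcl.closure_subset_iff.2 hgood) (hd b)

end MemUpsilon
end EqualArea

/-! ### Uniqueness through the backward Hopf–Lax functional -/

namespace EqualArea
open Function

variable {f h X Y : ℝ → ℝ} {K T t z x : ℝ} {E : Finset ℝ} {u v : ℝ → ℝ → ℝ}

theorem eventually_notMem_of_finite {A : Set ℝ} (hA : A.Finite) (x : ℝ) :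
    ∀ᶠ w in 𝓝[≠] x, w ∉ A := by
  have h1 : ∀ᶠ w in 𝓝 x, w ∉ A \ {x} :=
    (hA.subset sdiff_subset).isClosed.isOpen_compl.mem_nhds fun hx => hx.2 rfl
  filter_upwards [h1.filter_mono nhdsWithin_le_nhds, eventually_mem_nhdsWithin] with w hw hne hwA
  exact hw ⟨hwA, hne⟩

theorem Admissible.hasDerivAt_lag_fst (H : Admissible f h K) (ht : 0 < t) (x : ℝ) :
    HasDerivAt (fun x => lag f K (z - x) t) (-slopeOf f K (z - x) t) x := by
  have h1 : HasDerivAt (fun x : ℝ => (z - x, t)) (-1, 0) x :=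
    ((hasDerivAt_id x).const_sub z).prodMk (hasDerivAt_const x t)
  exact ((H.hasFDerivAt_lag ht).comp_hasDerivAt_of_eq x h1 rfl).congr_deriv (by simp)

theorem Admissible.hasDerivAt_lag_snd (H : Admissible f h K) {w τ : ℝ} (ht : τ < T) :
    HasDerivAt (fun τ => lag f K w (T - τ)) (f (slopeOf f K w (T - τ)) - f 0) τ := by
  have h1 : HasDerivAt (fun τ : ℝ => (w, T - τ)) (0, -1) τ :=
    (hasDerivAt_const τ w).prodMk ((hasDerivAt_id τ).const_sub T)
  exact ((H.hasFDerivAt_lag (sub_pos.2 ht)).comp_hasDerivAt_of_eq τ h1 rfl).congr_deriv (by simp)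

theorem Admissible.lag_zero (H : Admissible f h K) (w : ℝ) : lag f K w 0 ≤ -K * |w| := by
  have hK := H.one_le
  rcases le_total 0 w with hw | hw
  · have := H.lag_le w 0 (y := -K) ⟨le_rfl, by linarith⟩
    rw [abs_of_nonneg hw]
    nlinarith
  · have := H.lag_le w 0 (y := K) ⟨by linarith, le_rfl⟩
    rw [abs_of_nonpos hw]
    nlinarith

namespace RegularParam

theorem differentiableAt_position (P : RegularParam h X Y E) (H : Admissible f h K) {s : ℝ}
    (hs : s ∉ E) : DifferentiableAt ℝ (position f X Y t) s := by
  have ha : Differentiable ℝ (deriv f) := H.contDiff_deriv.differentiable one_ne_zero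
  have key : DifferentiableAt ℝ X s ∧ DifferentiableAt ℝ Y s := by
    rcases P.regular s hs with ⟨hc, hr⟩ | ⟨c, -, hr⟩
    · have hX : DifferentiableAt ℝ X s := by
        have : DifferentiableAt ℝ (fun u => X s + (u - s)) s := by fun_prop
        exact this.congr_of_eventuallyEq (hr.mono fun u hu => hu.1)
      exact ⟨hX, ((hc.differentiableAt one_ne_zero).comp s hX).congr_of_eventuallyEq
        (hr.mono fun u hu => hu.2)⟩
    · have h1 : DifferentiableAt ℝ (fun u => Y s + c * (u - s)) s := by fun_prop
      exact ⟨(differentiableAt_const (X s)).congr_of_eventuallyEq (hr.mono fun u hu => hu.1),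
        h1.congr_of_eventuallyEq (hr.mono fun u hu => hu.2)⟩
  exact key.1.add (((ha _).comp s key.2).mul_const t)

/-- Off the finite set `E` the position is differentiable in the parameter, and differentiable maps
of the line preserve null sets. -/
theorem null_image (P : RegularParam h X Y E) (H : Admissible f h K) {N : Set ℝ}
    (hN : volume N = 0) : volume (position f X Y t '' N) = 0 := by
  refine measure_mono_null (t := position f X Y t '' (N \ E) ∪ position f X Y t '' E) ?_ ?_
  · rw [← image_union]
    exact image_mono fun x hx => by
      by_cases hE : x ∈ E
      exacts [Or.inr hE, Or.inl ⟨hx, hE⟩]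
  · refine measure_union_null ?_ ((E.finite_toSet.image _).measure_zero volume)
    refine addHaar_image_eq_zero_of_differentiableOn_of_addHaar_eq_zero volume (fun s hs => ?_)
      (measure_mono_null sdiff_subset hN)
    exact (P.differentiableAt_position H hs.2).differentiableWithinAt

end RegularParam

namespace MemUpsilon

theorem eventually_foot_mem (hv : MemUpsilon f h v) (H : Admissible f h K) (ht : 0 < t) (x : ℝ) :
    ∀ᶠ w in 𝓝[≠] x, (w - deriv f (v w t) * t, v w t) ∈ completedGraph h := by
  obtain ⟨S, -, -, hS⟩ := H.piecewise.exists_exceptional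
  filter_upwards [eventually_notMem_of_finite
    (S.finite_toSet.image fun ξ => ξ + deriv f (h ξ) * t) x] with w hw
  by_contra hn
  obtain ⟨h1, h2⟩ := hS _ (hv.foot_mem ht.le w) hn
  simp only at h1 h2
  exact hw ⟨_, h1, by simp only [← h2]; ring⟩

theorem foot_mem_of_tendsto (hv : MemUpsilon f h v) (F : Folding f h X Y K E) (ht : 0 < t)
    {l : Filter ℝ} [l.NeBot] (hl : l ≤ 𝓝[≠] x) {y : ℝ} (hy : Tendsto (fun w => v w t) l (𝓝 y)) :
    (x - deriv f y * t, y) ∈ completedGraph h := by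
  refine F.param.isClosed_completedGraph.mem_of_tendsto (f := fun w =>
    (w - deriv f (v w t) * t, v w t)) (Tendsto.prodMk_nhds ?_ hy)
    ((hv.eventually_foot_mem F.admissible ht x).filter_mono hl)
  exact (tendsto_id.mono_left (hl.trans nhdsWithin_le_nhds)).sub
    (((F.admissible.continuous_deriv.tendsto _).comp hy).mul_const t)

/-- A value taken frequently near `x` belongs to a characteristic through `(x, t)`, since the
completed graph is closed; there are finitely many of these, so `v(·, t)` cannot oscillate. -/
theorem exists_limits (hv : MemUpsilon f h v) (F : Folding f h X Y K E) (ht : 0 < t) (x : ℝ) :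
    (∃ l, Tendsto (fun w => v w t) (𝓝[<] x) (𝓝 l)) ∧
      ∃ r, Tendsto (fun w => v w t) (𝓝[>] x) (𝓝 r) := by
  have hcont : ∀ᶠ w in 𝓝[≠] x, ContinuousAt (fun w => v w t) w :=
    (eventually_notMem_of_finite (hv.finite_slice F t) x).mono fun w hw => continuousAt_slice ht hw
  have hA : (Y '' {s | position f X Y t s = x}).Finite := (F.finite_position_eq ht x).image _
  have hfr : ∀ l ≤ 𝓝[≠] x, ∀ y, (∃ᶠ w in l, v w t = y) →
      y ∈ Y '' {s | position f X Y t s = x} := by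
    intro l hl y hy
    have h1 := hy.and_eventually ((hv.eventually_foot_mem F.admissible ht x).filter_mono hl)
    have hc : Continuous fun w : ℝ => (w - deriv f y * t, y) := by fun_prop
    have h2 : (x - deriv f y * t, y) ∈ completedGraph h := by
      refine F.param.isClosed_completedGraph.mem_of_frequently_of_tendsto
        (f := fun w => (w - deriv f y * t, y)) (h1.mono ?_)
        ((hc.tendsto x).mono_left (hl.trans nhdsWithin_le_nhds))
      rintro w ⟨rfl, hw⟩
      exact hw
    obtain ⟨s, hs1, hs2⟩ := F.param.exists_eq h2
    simp only at hs1 hs2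
    refine ⟨s, ?_, hs2⟩
    change position f X Y t s = x
    rw [position, hs1, hs2]; ring
  have hlt : 𝓝[<] x ≤ 𝓝[≠] x := nhdsWithin_mono _ fun w hw => ne_of_lt hw
  have hgt : 𝓝[>] x ≤ 𝓝[≠] x := nhdsWithin_mono _ fun w hw => ne_of_gt hw
  exact ⟨exists_tendsto_left (hcont.filter_mono hlt) (fun w => hv.abs_le F.admissible ht.le w) hA
      (hfr _ hlt),
    exists_tendsto_right (hcont.filter_mono hgt) (fun w => hv.abs_le F.admissible ht.le w) hA
      (hfr _ hgt)⟩

/-- A maximizer of the potential at time `τ` plus the running cost to `(z, T)` lies on a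
characteristic through `(z, T)`. -/
theorem exists_param_of_max (hv : MemUpsilon f h v) (hj : JumpsUpward v) (F : Folding f h X Y K E)
    {τ : ℝ} (hτ : 0 < τ) (hτT : τ < T)
    (hx : ∀ x', primitive (fun w => v w τ) x' + lag f K (z - x') (T - τ) ≤
      primitive (fun w => v w τ) x + lag f K (z - x) (T - τ)) :
    ∃ σ, position f X Y T σ = z ∧ position f X Y τ σ = x := by
  obtain ⟨⟨l, hl⟩, r, hr⟩ := hv.exists_limits F hτ x
  obtain ⟨R, -, hR⟩ := hv.exists_far F.admissible T
  have hprof := hv.boundedProfile F hR hτ.le hτT.le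
  have hlag := F.admissible.hasDerivAt_lag_fst (z := z) (sub_pos.2 hτT) x
  set y := slopeOf f K (z - x) (T - τ) with hy
  have h1 := nonpos_of_isMax_right
    ((hprof.hasDerivWithinAt_right hr).add hlag.hasDerivWithinAt) hx
  have h2 := nonneg_of_isMax_left
    ((hprof.hasDerivWithinAt_left hl).add hlag.hasDerivWithinAt) hx
  -- The maximum gives `r ≤ y ≤ l`, which no upward jump satisfies.
  have hlr : l = r := by
    by_contra hne
    have := hj x τ l r hτ hl hr hne
    linarith
  have hry : r = y := by linarith
  have hmem := hv.foot_mem_of_tendsto F hτ 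
    (nhdsWithin_mono x (s := Ioi x) fun w hw => ne_of_gt hw) hr
  rw [hry] at hmem
  obtain ⟨σ, hσ1, hσ2⟩ := F.param.exists_eq hmem
  simp only at hσ1 hσ2
  have h3 := F.admissible.abs_le_of_mem hmem
  have h4 := F.admissible.eq_of_abs_slopeOf_lt (w := z - x) (t := T - τ)
    (lt_of_le_of_lt h3 (by linarith))
  rw [← hy] at h4
  refine ⟨σ, ?_, ?_⟩
  · rw [position, hσ1, hσ2]; linarith
  · rw [position, hσ1, hσ2]; ring

/-- The backward Hopf-Lax functional over `(z, T)` of the potential of `v` at time `τ`. -/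
noncomputable def envelope (f : ℝ → ℝ) (K : ℝ) (v : ℝ → ℝ → ℝ) (z T τ : ℝ) : ℝ :=
  sSup (range fun x => primitive (fun w => v w τ) x + lag f K (z - x) (T - τ))

theorem envelope_eq_of_max {τ : ℝ}
    (hx : ∀ x', primitive (fun w => v w τ) x' + lag f K (z - x') (T - τ) ≤
      primitive (fun w => v w τ) x + lag f K (z - x) (T - τ)) :
    envelope f K v z T τ = primitive (fun w => v w τ) x + lag f K (z - x) (T - τ) :=
  IsGreatest.csSup_eq ⟨mem_range_self x, by rintro _ ⟨x', rfl⟩; exact hx x'⟩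

theorem exists_max (hv : MemUpsilon f h v) (F : Folding f h X Y K E) {τ : ℝ} (hτ : 0 ≤ τ)
    (z T : ℝ) : ∃ x, ∀ x', primitive (fun w => v w τ) x' + lag f K (z - x') (T - τ) ≤
      primitive (fun w => v w τ) x + lag f K (z - x) (T - τ) := by
  obtain ⟨R, -, hR⟩ := hv.exists_far F.admissible τ
  have hp := hv.boundedProfile F hR hτ le_rfl
  exact F.admissible.exists_max_add_lag hp.continuous_primitive
    (fun x => le_of_abs_le (hp.abs_primitive_le x)) z (T - τ)

theorem le_envelope (hv : MemUpsilon f h v) (F : Folding f h X Y K E) {τ : ℝ} (hτ : 0 ≤ τ)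
    (z T x : ℝ) :
    primitive (fun w => v w τ) x + lag f K (z - x) (T - τ) ≤ envelope f K v z T τ := by
  obtain ⟨x₀, h₀⟩ := hv.exists_max F hτ z T
  rw [envelope_eq_of_max h₀]
  exact h₀ x

theorem abs_envelope_sub_le (hv : MemUpsilon f h v) (hl : SolvesIntegralLaw f v)
    (F : Folding f h X Y K E) {C : ℝ} (hC : ∀ y, |y| ≤ K → |f y - f 0| ≤ C) {τ τ' : ℝ} (hτ : 0 ≤ τ)
    (hτ' : 0 ≤ τ') : |envelope f K v z T τ' - envelope f K v z T τ| ≤ 2 * C * |τ' - τ| := by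
  have key : ∀ τ τ', 0 ≤ τ → 0 ≤ τ' →
      envelope f K v z T τ' - envelope f K v z T τ ≤ 2 * C * |τ' - τ| := by
    intro τ τ' hτ hτ'
    obtain ⟨x, hx⟩ := hv.exists_max F hτ' z T
    rw [envelope_eq_of_max hx]
    have h1 := hv.le_envelope F hτ z T x
    have h2 := le_of_abs_le (F.admissible.abs_lag_sub_le hC (z - x) (T - τ) (z - x) (T - τ'))
    rw [sub_self, abs_zero, mul_zero, zero_add, sub_sub_sub_cancel_left, abs_sub_comm] at h2
    have h3 : primitive (fun w => v w τ') x - primitive (fun w => v w τ) x ≤ C * |τ' - τ| := by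
      rcases le_total τ τ' with h | h
      · exact le_of_abs_le (hv.abs_primitive_sub_le hl F hC hτ h x)
      · have := neg_le_of_abs_le (hv.abs_primitive_sub_le hl F hC hτ' h x)
        rw [abs_sub_comm] at this
        linarith
    linarith
  refine _root_.abs_le.2 ⟨?_, key τ τ' hτ hτ'⟩
  have := key τ' τ hτ' hτ
  rw [abs_sub_comm] at this
  linarith

/-- With the maximizer `x` of time `τ` kept fixed, the functional touches the envelope from below at
`τ`. Its time derivative is zero there, because stationarity in `x` equates `v(x, τ)` with the slope
of the path and the two flux terms cancel. -/
theorem hasDerivAt_envelope (hv : MemUpsilon f h v) (hl : SolvesIntegralLaw f v)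
    (F : Folding f h X Y K E) {τ : ℝ} (hτ : 0 < τ) (hτT : τ < T)
    (hd : DifferentiableAt ℝ (envelope f K v z T) τ)
    (hx : ∀ x', primitive (fun w => v w τ) x' + lag f K (z - x') (T - τ) ≤
      primitive (fun w => v w τ) x + lag f K (z - x) (T - τ))
    (hb : (x, τ) ∉ badSet v) : HasDerivAt (envelope f K v z T) 0 τ := by
  obtain ⟨R, -, hR⟩ := hv.exists_far F.admissible T
  have hprof := hv.boundedProfile F hR hτ.le hτT.le
  have h1 := (hprof.hasDerivAt (continuousAt_slice hτ hb)).add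
    (F.admissible.hasDerivAt_lag_fst (z := z) (sub_pos.2 hτT) x)
  have h2 := IsLocalMax.hasDerivAt_eq_zero (Eventually.of_forall hx) h1
  have h3 := (hv.hasDerivAt_primitive hl F hτ hb).add
    (F.admissible.hasDerivAt_lag_snd (w := z - x) hτT)
  rw [show slopeOf f K (z - x) (T - τ) = v x τ by linarith, neg_add_cancel] at h3
  have h4 := hd.hasDerivAt.sub h3
  have h5 : IsLocalMin (envelope f K v z T - ((fun τ => primitive (fun w => v w τ) x) +
      fun τ => lag f K (z - x) (T - τ))) τ := by
    filter_upwards [lt_mem_nhds hτ] with τ' hτ'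
    simp only [Pi.sub_apply, Pi.add_apply]
    rw [envelope_eq_of_max hx, sub_self, sub_nonneg]
    exact hv.le_envelope F hτ'.le z T x
  have h6 := h5.hasDerivAt_eq_zero h4
  rw [sub_zero] at h6
  rw [← h6]
  exact hd.hasDerivAt

/-- Along almost every characteristic `v` is continuous at almost every time. -/
theorem ae_good_param (hv : MemUpsilon f h v) (F : Folding f h X Y K E) :
    ∀ᵐ σ, ∀ᵐ τ, (position f X Y τ σ, τ) ∉ badSet v := by
  have hm : MeasurableSet {q : ℝ × ℝ | (position f X Y q.2 q.1, q.2) ∉ badSet v} :=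
    (((F.param.continuous_position F.admissible).prodMk continuous_snd).measurable
      (measurableSet_badSet v)).compl
  -- By Fubini the quantifiers may be exchanged; at a fixed positive time only finitely many
  -- parameters sit at the finitely many bad positions.
  refine (Measure.ae_ae_comm hm).2 (ae_of_all _ fun τ => ?_)
  rcases le_or_gt τ 0 with hτ | hτ
  · exact ae_of_all _ fun σ hσ => absurd hσ.1 (not_lt.2 hτ)
  · have : (⋃ x ∈ {x | (x, τ) ∈ badSet v}, {σ | position f X Y τ σ = x}).Finite :=
      (hv.finite_slice F τ).biUnion fun x _ => F.finite_position_eq hτ x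
    filter_upwards [this.countable.ae_notMem volume] with σ hσ hmem
    exact hσ (mem_biUnion hmem rfl)

/-- For almost every `z` the envelope is constant on `[0, T]`, because it is Lipschitz with
derivative 0 almost everywhere. Its end values are the two sides, and both are continuous in `z`. -/
theorem primitive_eq_hopfLax (hv : MemUpsilon f h v) (hl : SolvesIntegralLaw f v)
    (hj : JumpsUpward v) (F : Folding f h X Y K E) (hT : 0 < T) (z : ℝ) :
    primitive (fun w => v w T) z = hopfLax f h K z T := by
  obtain ⟨C, hC0, hC, -⟩ := F.admissible.exists_flux_bound
  obtain ⟨R, -, hR⟩ := hv.exists_far F.admissible T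
  have hprof := hv.boundedProfile F hR hT.le le_rfl
  have hae : ∀ᵐ z, primitive (fun w => v w T) z = hopfLax f h K z T := by
    have hnull := F.param.null_image F.admissible (t := T) (ae_iff.1 (hv.ae_good_param F))
    filter_upwards [compl_mem_ae_iff.2 hnull] with z hz
    -- No exceptional parameter reaches `z` at time `T`, and the finitely many that do reach it are
    -- good at almost all times simultaneously.
    have hgood : ∀ᵐ τ, ∀ σ, position f X Y T σ = z → (position f X Y τ σ, τ) ∉ badSet v := by
      refine (ae_ball_iff (F.finite_position_eq hT z).countable).2 fun σ hσ => ?_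
      by_contra hn
      exact hz ⟨σ, hn, hσ⟩
    have hac : AbsolutelyContinuousOnInterval (envelope f K v z T) 0 T := by
      refine LipschitzOnWith.absolutelyContinuousOnInterval (K := (2 * C).toNNReal)
        (LipschitzOnWith.of_dist_le_mul fun τ hτ τ' hτ' => ?_)
      rw [uIcc_of_le hT.le] at hτ hτ'
      rw [Real.dist_eq, Real.dist_eq, Real.coe_toNNReal _ (by linarith)]
      exact hv.abs_envelope_sub_le hl F hC hτ'.1 hτ.1
    have hends : ∀ᵐ τ : ℝ, τ ∉ ({0, T} : Set ℝ) := (Set.toFinite _).countable.ae_notMem volume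
    obtain ⟨c, hc⟩ := hac.const_of_ae_hasDerivAt_zero (by
      filter_upwards [hgood, hac.ae_differentiableAt, hends] with τ h1 h2 h3 hτ
      have hd := h2 hτ
      rw [uIcc_of_le hT.le] at hτ
      have hτ0 : 0 < τ := lt_of_le_of_ne hτ.1 fun e => h3 (by simp [← e])
      have hτT : τ < T := lt_of_le_of_ne hτ.2 fun e => h3 (by simp [e])
      obtain ⟨x, hx⟩ := hv.exists_max F hτ0.le z T
      obtain ⟨σ, hσ1, hσ2⟩ := hv.exists_param_of_max hj F hτ0 hτT hx
      exact hv.hasDerivAt_envelope hl F hτ0 hτT hd hx (hσ2 ▸ h1 σ hσ1))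
    have h0 := hc 0 left_mem_uIcc
    have h1 := hc T right_mem_uIcc
    have e0 : envelope f K v z T 0 = hopfLax f h K z T := by
      rw [envelope, hopfLax, sub_zero, show (fun w => v w 0) = h from funext hv.initial]
      rfl
    -- In zero time the Lagrangian is at most `-K |z - x|`, which outweighs the `K`-Lipschitz
    -- potential, so the maximum is at `x = z`.
    have e1 : envelope f K v z T T = primitive (fun w => v w T) z := by
      have hz0 : lag f K (z - z) (T - T) = 0 := by
        rw [sub_self, sub_self, F.admissible.lag_eq]; ring
      rw [envelope_eq_of_max (x := z), hz0, add_zero]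
      intro x
      rw [hz0, add_zero, sub_self]
      have h2 := F.admissible.lag_zero (z - x)
      have h3 := neg_le_of_abs_le ((hv.boundedProfile F hR hT.le le_rfl).abs_primitive_sub_le x z)
      linarith
    rw [← e0, ← e1, h0, h1]
  have hcont : Continuous fun z => hopfLax f h K z T :=
    F.admissible.continuous_hopfLax.comp (by fun_prop : Continuous fun z : ℝ => (z, T))
  exact congrFun ((Continuous.ae_eq_iff_eq volume hprof.continuous_primitive hcont).1 hae) z

theorem ae_eq_optField (hv : MemUpsilon f h v) (hl : SolvesIntegralLaw f v)
    (hj : JumpsUpward v) (F : Folding f h X Y K E) (hu : IsOptField f h K u) (hT : 0 < T) :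
    (fun x => v x T) =ᵐ[volume] fun x => u x T := by
  obtain ⟨R, -, hR⟩ := hv.exists_far F.admissible T
  have hprof := hv.boundedProfile F hR hT.le le_rfl
  filter_upwards [(hv.finite_slice F T).countable.ae_notMem volume,
    (F.finite_discontinuous hu hT).countable.ae_notMem volume] with x hx hx'
  have h1 := hprof.hasDerivAt (continuousAt_slice hT hx)
  have h2 := hu.hasDerivAt_fst F.admissible hT (not_not.1 hx')
  rw [show primitive (fun w => v w T) = fun z => hopfLax f h K z T from
    funext (hv.primitive_eq_hopfLax hl hj F hT)] at h1
  exact h1.unique h2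

end MemUpsilon
end EqualArea

/-! ### Survival of characteristics -/

namespace EqualArea
open Function

variable {f h X Y : ℝ → ℝ} {K s s' t t' z : ℝ} {E : Finset ℝ} {u : ℝ → ℝ → ℝ}

/-- The point with parameter `s` has not been absorbed by a shock before time `t`. -/
def Survives (f h X Y : ℝ → ℝ) (K s t : ℝ) : Prop := 0 < t ∧ Alive f h K (X s, Y s) t

/-- The point with parameter `s` is absorbed at time `t`. -/
def Dies (f h X Y : ℝ → ℝ) (K s t : ℝ) : Prop :=
  Survives f h X Y K s t ∧ ∀ t', t < t' → ¬ Survives f h X Y K s t'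

theorem Dies.eq (hs : Dies f h X Y K s t) (hs' : Dies f h X Y K s t') : t = t' := by
  rcases lt_trichotomy t t' with hlt | he | hlt
  · exact absurd hs'.1 (hs.2 _ hlt)
  · exact he
  · exact absurd hs.1 (hs'.2 _ hlt)

namespace Folding

theorem survives_of_le (F : Folding f h X Y K E) (hs : Survives f h X Y K s t) (ht' : 0 < t')
    (htt : t' ≤ t) : Survives f h X Y K s t' := by
  rcases htt.lt_or_eq with hlt | rfl
  · exact ⟨ht', F.admissible.alive_of_lt (F.param.mem_initialCurve s) ht' hlt hs.2⟩
  · exact hs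

theorem survives_of_tendsto (F : Folding f h X Y K E) (ht : 0 < t) {α : Type*} {l : Filter α}
    [l.NeBot] {a b : α → ℝ} (ha : Tendsto a l (𝓝 s)) (hb : Tendsto b l (𝓝 t))
    (hs : ∃ᶠ i in l, Survives f h X Y K (a i) (b i)) : Survives f h X Y K s t := by
  refine ⟨ht, F.admissible.isOpt_of_tendsto ((F.param.continuous_fst.tendsto s).comp ha) ?_ hb
    (hs.mono fun i hi => hi.2)⟩
  exact ((F.param.continuous_position F.admissible).tendsto (s, t)).comp (ha.prodMk_nhds hb)

theorem eventually_not_survives (F : Folding f h X Y K E) (ht : 0 < t)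
    (hs : ¬ Survives f h X Y K s t) :
    ∀ᶠ q : ℝ × ℝ in 𝓝 (s, t), ¬ Survives f h X Y K q.1 q.2 := by
  by_contra hn
  exact hs (F.survives_of_tendsto ht (continuous_fst.tendsto (s, t)) (continuous_snd.tendsto (s, t))
    (not_eventually.1 hn |>.mono fun q hq => not_not.1 hq))

theorem mem_optSet (hs : Survives f h X Y K s t) : s ∈ optSet f h X Y K t (position f X Y t s) :=
  ⟨rfl, hs.2⟩

theorem position_le (F : Folding f h X Y K E) (hs : Survives f h X Y K s t)
    (hs' : Survives f h X Y K s' t) (hle : s ≤ s') :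
    position f X Y t s ≤ position f X Y t s' := by
  by_contra hlt
  exact absurd (F.param.lt_of_position_lt F.admissible hs.1 hs'.2 hs.2 (not_le.1 hlt)) (not_lt.2 hle)

/-- A path that stays optimal beyond `t` is the only optimal one at time `t`; a common foot and a
common position then force the same ordinate. -/
theorem eq_of_survives_later (F : Folding f h X Y K E) (ht : 0 < t) (htt : t < t')
    (hs : Survives f h X Y K s t') (hs' : s' ∈ optSet f h X Y K t (position f X Y t s)) :
    s' = s := by
  have hopt : IsOpt f h K (X s') (X s + deriv f (Y s) * t) t := by
    have := hs'.2
    change IsOpt f h K (X s') (position f X Y t s') t at this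
    rwa [hs'.1] at this
  have hX := F.admissible.isOpt_unique_of_lt ht htt hs.2 (F.param.mem_initialCurve s) hopt
  refine F.param.eq_of_eq hX ?_
  have h1 := hs'.1
  rw [position, position, hX] at h1
  exact F.admissible.deriv_injective (mul_right_cancel₀ ht.ne' (by linarith))

/-- Survival up to a later time is an open condition. -/
theorem eventually_survives (F : Folding f h X Y K E) (ht : 0 < t) (htt : t < t')
    (hs : Survives f h X Y K s t') : ∀ᶠ s' in 𝓝 s, Survives f h X Y K s' t := by
  -- The parameters absorbed or meeting others at time `t` fill finitely many closed intervals, and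
  -- `s` is in none of them because it is alone at its position.
  have hcl : IsClosed (⋃ z ∈ {z | loParam f h X Y K t z < hiParam f h X Y K t z},
      Icc (loParam f h X Y K t z) (hiParam f h X Y K t z)) :=
    (F.finite_multi ht).isClosed_biUnion fun _ _ => isClosed_Icc
  have hns : s ∉ ⋃ z ∈ {z | loParam f h X Y K t z < hiParam f h X Y K t z},
      Icc (loParam f h X Y K t z) (hiParam f h X Y K t z) := by
    rintro hmem
    obtain ⟨z, hz, hm⟩ := mem_iUnion₂.1 hmem
    have hz : loParam f h X Y K t z < hiParam f h X Y K t z := hz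
    have hl := F.loParam_mem ht z
    have hh := F.hiParam_mem ht z
    have hst := F.survives_of_le hs ht htt.le
    have e : z = position f X Y t s := le_antisymm
      (hl.1 ▸ F.position_le ⟨ht, hl.2⟩ hst hm.1) (hh.1 ▸ F.position_le hst ⟨ht, hh.2⟩ hm.2)
    subst e
    rw [F.eq_of_survives_later ht htt hs hl, F.eq_of_survives_later ht htt hs hh] at hz
    exact lt_irrefl _ hz
  filter_upwards [hcl.isOpen_compl.mem_nhds hns] with s' hs'
  obtain ⟨z, hz⟩ := F.exists_mem_Icc ht s'
  by_cases hlt : loParam f h X Y K t z < hiParam f h X Y K t z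
  · exact absurd (mem_iUnion₂.2 ⟨z, hlt, hz⟩) hs'
  · rw [show s' = loParam f h X Y K t z by linarith [hz.1, hz.2, not_lt.1 hlt]]
    exact ⟨ht, (F.loParam_mem ht z).2⟩

theorem survives_of_eq (F : Folding f h X Y K E) (hu : IsOptField f h K u) (ht : 0 < t)
    (he : u (position f X Y t s) t = Y s) : Survives f h X Y K s t := by
  have h1 := (hu.isOpt F.admissible ht (position f X Y t s)).1
  rw [he, position, add_sub_cancel_right] at h1
  exact ⟨ht, h1⟩

/-- Strictly before `t'` the parameter is alone at its position, so `u` has no other choice; at the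
time of absorption it may take another branch. -/
theorem eq_of_survives (F : Folding f h X Y K E) (hu : IsOptField f h K u) (ht : 0 < t)
    (htt : t < t') (hs : Survives f h X Y K s t') : u (position f X Y t s) t = Y s := by
  obtain ⟨s', h1, h2⟩ := hu.exists_param F.admissible F.param.toIsParametrization ht
    (position f X Y t s)
  rw [← h2, F.eq_of_survives_later ht htt hs h1]

theorem abs_fst_sub_le (F : Folding f h X Y K E) {C : ℝ} (hC : ∀ y, |y| ≤ K → |deriv f y| ≤ C)
    (ht : 0 < t) (he : position f X Y t s' = position f X Y t s) : |X s' - X s| ≤ 2 * C * t := by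
  have hb : ∀ s, |deriv f (Y s) * t| ≤ C * t := fun s => by
    rw [abs_mul, abs_of_pos ht]
    exact mul_le_mul_of_nonneg_right
      (hC _ (abs_le.2 (F.admissible.mem_Icc_of_mem (F.param.mem_initialCurve s)))) ht.le
  rw [position, position] at he
  rw [show X s' - X s = deriv f (Y s) * t - deriv f (Y s') * t by linarith]
  linarith [abs_sub (deriv f (Y s) * t) (deriv f (Y s') * t), hb s, hb s']

theorem survives_of_unique (F : Folding f h X Y K E) (ht : 0 < t)
    (hun : ∀ s', position f X Y t s' = position f X Y t s → s' = s) : Survives f h X Y K s t := by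
  obtain ⟨s', h1, h2⟩ := F.param.exists_alive F.admissible ht (position f X Y t s)
  rw [hun s' h1] at h2
  exact ⟨ht, h2⟩

/-- Points that meet at time `t` start within `2 C t` of each other. Where the speed `f'(h ξ)` is
`Λ`-Lipschitz in `ξ` and `Λ t < 1`, such points coincide, so the characteristic is without rivals.
-/
theorem short_time_of_graph (F : Folding f h X Y K E) (hd : ContDiffAt ℝ 1 h (X s)) :
    ∃ t, 0 < t ∧ ∀ᶠ s' in 𝓝 s, Survives f h X Y K s' t := by
  obtain ⟨C, hC0, -, hC⟩ := F.admissible.exists_flux_bound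
  have hg : ContDiffAt ℝ 1 (fun x => deriv f (h x)) (X s) :=
    F.admissible.contDiff_deriv.contDiffAt.comp (X s) hd
  obtain ⟨Λ, U, hU, hΛ⟩ := hg.exists_lipschitzOnWith
  have hcont : ∀ᶠ x in 𝓝 (X s), ContinuousAt h x :=
    (hd.eventually (by simp)).mono fun x hx => hx.continuousAt
  obtain ⟨δ, hδ, hball⟩ := Metric.mem_nhds_iff.1 (Filter.inter_mem hU hcont)
  obtain ⟨t, ht, ht1, ht2⟩ : ∃ t : ℝ, 0 < t ∧ Λ * t < 1 ∧ 2 * C * t < δ / 2 := by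
    have e1 : ∀ᶠ t : ℝ in 𝓝[>] 0, Λ * t < 1 :=
      ((by fun_prop : Continuous fun t : ℝ => Λ * t).continuousAt.eventually
        (gt_mem_nhds (by simp))).filter_mono nhdsWithin_le_nhds
    have e2 : ∀ᶠ t : ℝ in 𝓝[>] 0, 2 * C * t < δ / 2 :=
      ((by fun_prop : Continuous fun t : ℝ => 2 * C * t).continuousAt.eventually
        (gt_mem_nhds (by simpa using hδ))).filter_mono nhdsWithin_le_nhds
    exact (((eventually_mem_nhdsWithin (s := Ioi (0 : ℝ))).and (e1.and e2)).exists)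
  refine ⟨t, ht, ?_⟩
  filter_upwards [F.param.continuous_fst.continuousAt.eventually
    (Metric.ball_mem_nhds (X s) (half_pos hδ))] with s' hs'
  refine F.survives_of_unique ht fun s'' he => ?_
  have hX := F.abs_fst_sub_le hC ht he
  rw [Real.dist_eq] at hs'
  have m1 : X s' ∈ Metric.ball (X s) δ := by rw [Metric.mem_ball, Real.dist_eq]; linarith
  have m2 : X s'' ∈ Metric.ball (X s) δ := by
    rw [Metric.mem_ball, Real.dist_eq]
    have := abs_sub_le (X s'') (X s') (X s)
    linarith
  have y1 : Y s' = h (X s') := Admissible.snd_eq_of_continuousAt (F.param.mem s') (hball m1).2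
  have y2 : Y s'' = h (X s'') := Admissible.snd_eq_of_continuousAt (F.param.mem s'') (hball m2).2
  have h1 := hΛ.dist_le_mul _ (hball m1).1 _ (hball m2).1
  simp only [Real.dist_eq, ← y1, ← y2] at h1
  have h2 : X s'' - X s' = (deriv f (Y s') - deriv f (Y s'')) * t := by
    rw [position, position] at he
    linarith
  have h3 : |X s'' - X s'| ≤ Λ * t * |X s'' - X s'| := by
    calc |X s'' - X s'| = |deriv f (Y s') - deriv f (Y s'')| * t := by
          rw [h2, abs_mul, abs_of_pos ht]
      _ ≤ Λ * |X s' - X s''| * t := mul_le_mul_of_nonneg_right h1 ht.le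
      _ = Λ * t * |X s'' - X s'| := by rw [abs_sub_comm]; ring
  have h4 : X s'' = X s' := by
    by_contra hne
    have : 0 < |X s'' - X s'| := abs_pos.2 (sub_ne_zero.2 hne)
    nlinarith
  exact F.param.eq_of_eq h4 (by rw [y1, y2, h4])

/-- A rarefaction fan: near a downward jump the points on the right have smaller ordinates and are
faster, those on the left are slower, so nothing catches up with an inner point of the segment. -/
theorem short_time_of_vertical (F : Folding f h X Y K E) (hX : ∀ᶠ s' in 𝓝 s, X s' = X s)
    (hr : rightLim h (X s) < Y s) (hl : Y s < leftLim h (X s)) :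
    ∃ t, 0 < t ∧ ∀ᶠ s' in 𝓝 s, Survives f h X Y K s' t := by
  obtain ⟨C, hC0, -, hC⟩ := F.admissible.exists_flux_bound
  obtain ⟨m₁, hm₁, hm₁'⟩ := _root_.exists_between hr
  obtain ⟨m₂, hm₂, hm₂'⟩ := _root_.exists_between hl
  have hpc := F.admissible.piecewise
  have e1 : ∀ᶠ x in 𝓝[>] (X s), h x < m₁ ∧ ContinuousAt h x :=
    ((hpc.tendsto_rightLim _).eventually (gt_mem_nhds hm₁)).and (hpc.eventually_continuousAt_right _)
  have e2 : ∀ᶠ x in 𝓝[<] (X s), m₂ < h x ∧ ContinuousAt h x :=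
    ((hpc.tendsto_leftLim _).eventually (lt_mem_nhds hm₂')).and (hpc.eventually_continuousAt_left _)
  rw [eventually_nhdsWithin_iff] at e1 e2
  obtain ⟨δ, hδ, hball⟩ := Metric.eventually_nhds_iff.1 (e1.and e2)
  obtain ⟨t, ht, ht2⟩ : ∃ t : ℝ, 0 < t ∧ 2 * C * t < δ := by
    have e2 : ∀ᶠ t : ℝ in 𝓝[>] 0, 2 * C * t < δ :=
      ((by fun_prop : Continuous fun t : ℝ => 2 * C * t).continuousAt.eventually
        (gt_mem_nhds (by simpa using hδ))).filter_mono nhdsWithin_le_nhds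
    exact ((eventually_mem_nhdsWithin (s := Ioi (0 : ℝ))).and e2).exists
  refine ⟨t, ht, ?_⟩
  filter_upwards [hX, F.param.continuous_snd.continuousAt.eventually (Ioo_mem_nhds hm₁' hm₂)]
    with s' hs' hY
  refine F.survives_of_unique ht fun s'' he => ?_
  have hXs := F.abs_fst_sub_le hC ht he
  rw [hs'] at hXs
  have hb := hball (lt_of_le_of_lt (by rwa [Real.dist_eq]) ht2 : dist (X s'') (X s) < δ)
  rw [position, position, hs'] at he
  rcases lt_trichotomy (X s'') (X s) with hlt | heq | hgt
  · obtain ⟨b1, b2⟩ := hb.2 hlt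
    rw [← Admissible.snd_eq_of_continuousAt (F.param.mem s'') b2] at b1
    have := F.admissible.strictAnti_deriv (hY.2.trans b1)
    have := mul_lt_mul_of_pos_right this ht
    linarith
  · refine F.param.eq_of_eq (heq.trans hs'.symm)
      (F.admissible.deriv_injective (mul_right_cancel₀ ht.ne' (by linarith)))
  · obtain ⟨b1, b2⟩ := hb.1 hgt
    rw [← Admissible.snd_eq_of_continuousAt (F.param.mem s'') b2] at b1
    have := F.admissible.strictAnti_deriv (b1.trans hY.1)
    have := mul_lt_mul_of_pos_right this ht
    linarith

/-- Almost all points survive for a short time, the others lie on an upward jump of `h`. -/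
theorem short_time (F : Folding f h X Y K E) (hs : s ∉ E) :
    (∃ t, 0 < t ∧ ∀ᶠ s' in 𝓝 s, Survives f h X Y K s' t) ∨
      leftLim h (X s) < rightLim h (X s) := by
  rcases F.param.regular s hs with ⟨hd, -⟩ | ⟨c, hc, hr⟩
  · exact Or.inl (F.short_time_of_graph hd)
  refine or_iff_not_imp_right.2 fun hlr => ?_
  have hsym : Tendsto (fun u => 2 * s - u) (𝓝 s) (𝓝 s) := by
    have : ContinuousAt (fun u : ℝ => 2 * s - u) s := by fun_prop
    have e : 2 * s - s = s := by ring
    simpa [ContinuousAt, e] using this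
  obtain ⟨w, hne, hw, hw'⟩ := ((eventually_mem_nhdsWithin (s := {s}ᶜ)).and
    ((hr.and (hsym.eventually hr)).filter_mono nhdsWithin_le_nhds)).exists
  have hmem : ∀ w, X w = X s → rightLim h (X s) ≤ Y w ∧ Y w ≤ leftLim h (X s) := by
    intro w hw
    have := F.param.mem w
    change Y w ∈ uIcc (leftLim h (X w)) (rightLim h (X w)) at this
    rw [hw, uIcc_of_ge (not_lt.1 hlr)] at this
    exact this
  have b1 := hmem _ hw.1
  have b2 := hmem _ hw'.1
  rw [hw.2] at b1
  rw [hw'.2] at b2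
  have hd : c * (w - s) ≠ 0 := mul_ne_zero hc (sub_ne_zero.2 hne)
  refine F.short_time_of_vertical (hr.mono fun u hu => hu.1) ?_ ?_
  · rcases hd.lt_or_gt with hd | hd
    · linarith
    · have : c * (2 * s - w - s) = -(c * (w - s)) := by ring
      linarith
  · rcases hd.lt_or_gt with hd | hd
    · have : c * (2 * s - w - s) = -(c * (w - s)) := by ring
      linarith
    · linarith

end Folding
end EqualArea

/-! ### The boundary of the graph on the characteristic surface -/

namespace EqualArea
open Function

variable {f h X Y : ℝ → ℝ} {K s s' t t' z : ℝ} {E : Finset ℝ} {u : ℝ → ℝ → ℝ} {p : ℝ × ℝ × ℝ}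

theorem mem_graphBoundary_iff (hsurf : graphOf u ⊆ boundingSurface f h) :
    p ∈ graphBoundary f h u ↔ p ∈ boundingSurface f h ∧ p ∈ closure (graphOf u) ∧
      p ∈ closure (boundingSurface f h \ graphOf u) := by
  have e1 : Subtype.val '' ((↑) ⁻¹' graphOf u : Set (boundingSurface f h)) = graphOf u := by
    rw [Subtype.image_preimage_coe, inter_eq_right]
    exact hsurf
  have e2 : Subtype.val '' ((↑) ⁻¹' graphOf u : Set (boundingSurface f h))ᶜ =
      boundingSurface f h \ graphOf u := by
    rw [← preimage_compl, Subtype.image_preimage_coe]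
    rfl
  rw [graphBoundary, frontier_eq_closure_inter_closure,
    Topology.IsInducing.subtypeVal.closure_eq_preimage_closure_image,
    Topology.IsInducing.subtypeVal.closure_eq_preimage_closure_image, e1, e2]
  constructor
  · rintro ⟨q, ⟨h1, h2⟩, rfl⟩
    exact ⟨q.2, h1, h2⟩
  · rintro ⟨h0, h1, h2⟩
    exact ⟨⟨p, h0⟩, ⟨h1, h2⟩, rfl⟩

theorem notMem_graphBoundary_of_eventually_mem (hsurf : graphOf u ⊆ boundingSurface f h)
    (hp : ∀ᶠ q in 𝓝[boundingSurface f h] p, q ∈ graphOf u) : p ∉ graphBoundary f h u := fun hb => by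
  have h1 := mem_closure_iff_frequently.1 ((mem_graphBoundary_iff hsurf).1 hb).2.2
  obtain ⟨q, hq, hq'⟩ := (h1.and_eventually (eventually_nhdsWithin_iff.1 hp)).exists
  exact hq.2 (hq' hq.1)

theorem notMem_graphBoundary_of_eventually_notMem (hsurf : graphOf u ⊆ boundingSurface f h)
    (hp : ∀ᶠ q in 𝓝[boundingSurface f h] p, q ∉ graphOf u) : p ∉ graphBoundary f h u := fun hb => by
  have h1 := mem_closure_iff_frequently.1 ((mem_graphBoundary_iff hsurf).1 hb).2.1
  obtain ⟨q, hq, hq'⟩ := (h1.and_eventually (eventually_nhdsWithin_iff.1 hp)).exists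
  exact hq' (hsurf hq) hq

/-- The point of the surface with parameter `s` at time `t`. -/
noncomputable def surfacePoint (f X Y : ℝ → ℝ) (s t : ℝ) : ℝ × ℝ × ℝ :=
  (position f X Y t s, t, Y s)

namespace Folding

theorem continuous_surfacePoint (F : Folding f h X Y K E) :
    Continuous fun q : ℝ × ℝ => surfacePoint f X Y q.1 q.2 :=
  (F.param.continuous_position F.admissible).prodMk
    (continuous_snd.prodMk (F.param.continuous_snd.comp continuous_fst))

theorem surfacePoint_mem (F : Folding f h X Y K E) (ht : 0 ≤ t) :
    surfacePoint f X Y s t ∈ boundingSurface f h :=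
  ⟨ht, (X s, Y s), F.param.mem_initialCurve s, rfl⟩

/-- Undoing the shear is continuous and the parametrization is an embedding, so nearby surface
points have nearby parameters. The stray values of `h` are finitely many and stay away. -/
theorem eventually_surface (F : Folding f h X Y K E) {P : ℝ → ℝ → Prop}
    (hP : ∀ᶠ q : ℝ × ℝ in 𝓝 (s, t), 0 ≤ q.2 → P q.1 q.2) :
    ∀ᶠ q in 𝓝[boundingSurface f h] surfacePoint f X Y s t,
      ∃ s', q = surfacePoint f X Y s' q.2.1 ∧ 0 ≤ q.2.1 ∧ P s' q.2.1 := by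
  obtain ⟨S, -, -, hS⟩ := F.admissible.piecewise.exists_exceptional
  set φ : ℝ × ℝ × ℝ → (ℝ × ℝ) × ℝ := fun q => ((q.1 - deriv f q.2.2 * q.2.1, q.2.2), q.2.1) with hφ
  have ha := F.admissible.continuous_deriv
  have hφc : Continuous φ := by fun_prop
  have hφp : φ (surfacePoint f X Y s t) = ((X s, Y s), t) := by
    simp [hφ, surfacePoint, position]
  have h1 : ∀ᶠ q in 𝓝 (surfacePoint f X Y s t), (φ q).1 ∈ initialCurve h →
      (φ q).1 ∈ completedGraph h := by
    have hfin : (initialCurve h \ completedGraph h).Finite := by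
      refine (S.finite_toSet.image fun ξ => (ξ, h ξ)).subset fun p hp => ?_
      obtain ⟨h1, h2⟩ := hS p hp.1 hp.2
      exact ⟨p.1, h1, Prod.ext rfl h2.symm⟩
    have : ∀ᶠ p in 𝓝 (X s, Y s), p ∉ initialCurve h \ completedGraph h :=
      hfin.isClosed.isOpen_compl.mem_nhds fun hm => hm.2 (F.param.mem s)
    have hc : Tendsto (fun q => (φ q).1) (𝓝 (surfacePoint f X Y s t)) (𝓝 (X s, Y s)) := by
      have : Tendsto (fun q => (φ q).1) _ (𝓝 (φ (surfacePoint f X Y s t)).1) :=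
        (continuous_fst.comp hφc).tendsto (surfacePoint f X Y s t)
      rwa [hφp] at this
    filter_upwards [hc.eventually this] with q hq hm
    exact by_contra fun hn => hq ⟨hm, hn⟩
  have h2 : ∀ᶠ q in 𝓝 (surfacePoint f X Y s t), ∀ a : ℝ × ℝ, ((X a.1, Y a.1), a.2) = φ q →
      0 ≤ a.2 → P a.1 a.2 := by
    have hind := (F.param.isClosedEmbedding.isInducing.prodMap (IsInducing.id (X := ℝ))).nhds_eq_comap
      (s, t)
    rw [hind, eventually_comap] at hP
    have hc := hφc.tendsto (surfacePoint f X Y s t)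
    rw [hφp] at hc
    exact hc.eventually hP
  filter_upwards [h1.filter_mono nhdsWithin_le_nhds, h2.filter_mono nhdsWithin_le_nhds,
    self_mem_nhdsWithin] with q hq1 hq2 hq
  obtain ⟨h0, r, hr, he⟩ := hq
  obtain ⟨e1, e2⟩ := Prod.ext_iff.1 he
  simp only [shear] at e1 e2
  have hr' : (φ q).1 = r := Prod.ext (by simp only [hφ]; rw [← e1, ← e2]; ring) e2.symm
  obtain ⟨s', hs1, hs2⟩ := F.param.exists_eq (hq1 (hr' ▸ hr))
  rw [hr'] at hs1 hs2
  refine ⟨s', ?_, h0, hq2 (s', q.2.1) ?_ h0⟩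
  · refine Prod.ext ?_ (Prod.ext rfl ?_)
    · simp only [surfacePoint, position]; rw [hs1, hs2, e1]
    · simp only [surfacePoint]; rw [hs2, e2]
  · refine Prod.ext ?_ rfl
    rw [hr']
    exact Prod.ext hs1 hs2

theorem graphOf_subset (F : Folding f h X Y K E) (hu : IsOptField f h K u)
    (h0 : ∀ x, u x 0 = h x) : graphOf u ⊆ boundingSurface f h := by
  rintro ⟨x, t, y⟩ ⟨ht, hy⟩
  simp only at ht hy
  rcases ht.eq_or_lt with rfl | ht
  · exact ⟨le_rfl, (x, y), Or.inl (by rw [mem_ofPred_eq, hy, h0]), by simp [shear]⟩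
  · obtain ⟨s, hs, he⟩ := hu.exists_param F.admissible F.param.toIsParametrization ht x
    have := F.surfacePoint_mem (s := s) ht.le
    rwa [surfacePoint, hs.1, he, ← hy] at this

theorem foot_mem (F : Folding f h X Y K E) (hu : IsOptField f h K u) (ht : 0 < t) (x : ℝ) :
    (x - deriv f (u x t) * t, u x t) ∈ completedGraph h := by
  obtain ⟨s, hs, he⟩ := hu.exists_param F.admissible F.param.toIsParametrization ht x
  rw [← he, ← hs.1, position, add_sub_cancel_right]
  exact F.param.mem s

/-- Around a point that survives beyond its time the surface is in the graph, because survival is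
open; around a point that no longer survives it is off the graph. A stray value of `h` is off the
graph as well, since for positive times `u` uses only the closed completed graph. -/
theorem exists_dies_of_mem_boundary (F : Folding f h X Y K E) (hu : IsOptField f h K u)
    (h0 : ∀ x, u x 0 = h x) (hp : p ∈ graphBoundary f h u) (ht : 0 < p.2.1) :
    ∃ s, Dies f h X Y K s p.2.1 ∧ p = surfacePoint f X Y s p.2.1 := by
  have hsurf := F.graphOf_subset hu h0
  obtain ⟨-, r, hr, he⟩ := ((mem_graphBoundary_iff hsurf).1 hp).1
  obtain ⟨e1, e2⟩ := Prod.ext_iff.1 he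
  simp only [shear] at e1 e2
  by_cases hrc : r ∈ completedGraph h
  · obtain ⟨s, hs1, hs2⟩ := F.param.exists_eq hrc
    have hps : p = surfacePoint f X Y s p.2.1 := by
      refine Prod.ext ?_ (Prod.ext rfl ?_)
      · simp only [surfacePoint, position]; rw [hs1, hs2, e1]
      · simp only [surfacePoint]; rw [hs2, e2]
    refine ⟨s, ?_, hps⟩
    set t := p.2.1 with ht'
    rw [hps] at hp
    by_contra hnd
    by_cases hsv : Survives f h X Y K s t
    · obtain ⟨t', htt', hst'⟩ : ∃ t', t < t' ∧ Survives f h X Y K s t' := by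
        by_contra! hno
        exact hnd ⟨hsv, hno⟩
      obtain ⟨t₁, ht₁, ht₁'⟩ := _root_.exists_between htt'
      refine notMem_graphBoundary_of_eventually_mem hsurf ?_ hp
      have hev : ∀ᶠ q : ℝ × ℝ in 𝓝 (s, t), 0 ≤ q.2 →
          Y q.1 = u (position f X Y q.2 q.1) q.2 := by
        filter_upwards [(continuous_fst.tendsto (s, t)).eventually
          (F.eventually_survives (ht.trans ht₁) ht₁' hst'),
          (continuous_snd.tendsto (s, t)).eventually (Ioo_mem_nhds ht ht₁)] with q hq1 hq2 _
        exact (F.eq_of_survives hu hq2.1 hq2.2 hq1).symm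
      filter_upwards [F.eventually_surface
        (P := fun s t => Y s = u (position f X Y t s) t) hev] with q ⟨s', hq, hq0, hq'⟩
      rw [hq]
      exact ⟨hq0, hq'⟩
    · refine notMem_graphBoundary_of_eventually_notMem hsurf ?_ hp
      have hev : ∀ᶠ q : ℝ × ℝ in 𝓝 (s, t), 0 ≤ q.2 →
          Y q.1 ≠ u (position f X Y q.2 q.1) q.2 := by
        filter_upwards [F.eventually_not_survives ht hsv,
          (continuous_snd.tendsto (s, t)).eventually (lt_mem_nhds ht)] with q hq1 hq2 _ he
        exact hq1 (F.survives_of_eq hu hq2 he.symm)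
      filter_upwards [F.eventually_surface
        (P := fun s t => Y s ≠ u (position f X Y t s) t) hev] with q ⟨s', hq, hq0, hq'⟩ hm
      rw [hq] at hm
      exact hq' hm.2
  · exfalso
    refine notMem_graphBoundary_of_eventually_notMem hsurf ?_ hp
    have ha := F.admissible.continuous_deriv
    have hφc : Continuous fun q : ℝ × ℝ × ℝ => (q.1 - deriv f q.2.2 * q.2.1, q.2.2) := by fun_prop
    have h1 : ∀ᶠ q in 𝓝 p, (q.1 - deriv f q.2.2 * q.2.1, q.2.2) ∉ completedGraph h := by
      refine hφc.continuousAt.eventually (F.param.isClosed_completedGraph.isOpen_compl.mem_nhds ?_)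
      have : (p.1 - deriv f p.2.2 * p.2.1, p.2.2) = r :=
        Prod.ext (by simp only; rw [← e1, ← e2]; ring) e2.symm
      change (p.1 - deriv f p.2.2 * p.2.1, p.2.2) ∉ completedGraph h
      rwa [this]
    have h2 : ∀ᶠ q : ℝ × ℝ × ℝ in 𝓝 p, 0 < q.2.1 :=
      (continuous_fst.comp continuous_snd).continuousAt.eventually (lt_mem_nhds ht)
    filter_upwards [h1.filter_mono nhdsWithin_le_nhds, h2.filter_mono nhdsWithin_le_nhds]
      with q hq1 hq2 hm
    refine hq1 ?_
    have := F.foot_mem hu hq2 q.1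
    rwa [← show q.2.2 = u q.1 q.2.1 from hm.2] at this

/-- The characteristic runs in the graph just before `t` and off the graph just after. -/
theorem mem_boundary_of_dies (F : Folding f h X Y K E) (hu : IsOptField f h K u)
    (h0 : ∀ x, u x 0 = h x) (hd : Dies f h X Y K s t) :
    surfacePoint f X Y s t ∈ graphBoundary f h u := by
  have ht := hd.1.1
  have hc : Tendsto (fun t' => surfacePoint f X Y s t') (𝓝 t) (𝓝 (surfacePoint f X Y s t)) :=
    (F.continuous_surfacePoint.comp (by fun_prop : Continuous fun t' : ℝ => (s, t'))).tendsto t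
  refine (mem_graphBoundary_iff (F.graphOf_subset hu h0)).2 ⟨F.surfacePoint_mem ht.le, ?_, ?_⟩
  · refine mem_closure_of_tendsto (hc.mono_left (nhdsWithin_le_nhds (s := Iio t))) ?_
    filter_upwards [Ioo_mem_nhdsLT ht] with t' ht'
    exact ⟨ht'.1.le, (F.eq_of_survives hu ht'.1 ht'.2 hd.1).symm⟩
  · refine mem_closure_of_tendsto (hc.mono_left (nhdsWithin_le_nhds (s := Ioi t))) ?_
    filter_upwards [self_mem_nhdsWithin] with t' ht'
    have ht' : t < t' := ht'
    exact ⟨F.surfacePoint_mem (ht.trans ht').le, fun hm =>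
      hd.2 t' ht' (F.survives_of_eq hu (ht.trans ht') hm.2.symm)⟩

theorem not_survives_of_jump (F : Folding f h X Y K E)
    (hlr : leftLim h (X s) < rightLim h (X s)) : ¬ Survives f h X Y K s t := fun hs => by
  have h1 : IsOpt f h K (X s) (position f X Y t s) t := hs.2
  have := F.admissible.slopeOf_mem_of_isOpt hs.1 h1
  linarith [this.1, this.2]

theorem eventually_fst_eq (F : Folding f h X Y K E) (hs : s ∉ E) (hd : ¬ ContDiffAt ℝ 1 h (X s)) :
    ∀ᶠ s' in 𝓝 s, X s' = X s := by
  obtain ⟨α, hα, β, hβ, hab⟩ := F.param.levels _ hd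
  have := (hab s).1 rfl
  have h1 : α < s := lt_of_le_of_ne this.1 fun e => hs (e ▸ hα)
  have h2 : s < β := lt_of_le_of_ne this.2 fun e => hs (e ▸ hβ)
  filter_upwards [Ioo_mem_nhds h1 h2] with s' hs'
  exact (hab s').2 ⟨hs'.1.le, hs'.2.le⟩

/-- The boundary points at time zero, up to finitely many, are the inner points of downward
jumps. -/
theorem exists_of_mem_boundary_zero (F : Folding f h X Y K E) (hu : IsOptField f h K u)
    (h0 : ∀ x, u x 0 = h x) (hp : p ∈ graphBoundary f h u) (ht : p.2.1 = 0) :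
    (∃ s, (s ∉ E ∧ ¬ ContDiffAt ℝ 1 h (X s) ∧ ¬ leftLim h (X s) < rightLim h (X s)) ∧
      p = surfacePoint f X Y s 0) ∨
    p ∈ ((fun s => surfacePoint f X Y s 0) '' E) ∪
      (fun ξ => (ξ, 0, h ξ)) '' {ξ | ¬ ContDiffAt ℝ 1 h ξ} := by
  have hsurf := F.graphOf_subset hu h0
  obtain ⟨-, r, hr, he⟩ := ((mem_graphBoundary_iff hsurf).1 hp).1
  obtain ⟨e1, e2⟩ := Prod.ext_iff.1 he
  simp only [shear, ht, mul_zero, add_zero] at e1 e2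
  by_cases hrc : r ∈ completedGraph h
  swap
  · obtain ⟨S, hS, -⟩ := F.admissible.piecewise.exists_exceptional
    right; right
    have hr' : r.2 = h r.1 := hr.resolve_right hrc
    refine ⟨r.1, fun hd => hrc ?_, Prod.ext e1 (Prod.ext ht.symm (by rw [← e2, hr']))⟩
    have hc := hd.continuousAt
    change r.2 ∈ uIcc _ _
    rw [Admissible.leftLim_eq_of_continuousAt hc, Admissible.rightLim_eq_of_continuousAt hc, hr']
    simp
  obtain ⟨s, hs1, hs2⟩ := F.param.exists_eq hrc
  have hps : p = surfacePoint f X Y s 0 := by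
    refine Prod.ext ?_ (Prod.ext ht ?_)
    · simp only [surfacePoint, position]; rw [hs1, mul_zero, add_zero, e1]
    · simp only [surfacePoint]; rw [hs2, e2]
  have hz : ∀ s, position f X Y 0 s = X s := fun s => by rw [position, mul_zero, add_zero]
  by_cases hE : s ∈ E
  · exact Or.inr (Or.inl ⟨s, hE, hps.symm⟩)
  by_cases hd : ContDiffAt ℝ 1 h (X s)
  · exfalso
    obtain ⟨t₁, ht₁, hev⟩ := F.short_time_of_graph hd
    refine notMem_graphBoundary_of_eventually_mem hsurf ?_ hp
    have hcd : ∀ᶠ s' in 𝓝 s, ContDiffAt ℝ 1 h (X s') :=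
      F.param.continuous_fst.continuousAt.eventually (hd.eventually (by simp))
    have hev : ∀ᶠ q : ℝ × ℝ in 𝓝 (s, 0), 0 ≤ q.2 →
        Y q.1 = u (position f X Y q.2 q.1) q.2 := by
      filter_upwards [(continuous_fst.tendsto (s, (0 : ℝ))).eventually (hev.and hcd),
        (continuous_snd.tendsto (s, (0 : ℝ))).eventually (gt_mem_nhds ht₁)] with q hq1 hq2 hq0
      rcases hq0.eq_or_lt with hq0 | hq0
      · rw [← hq0, hz, h0]
        exact Admissible.snd_eq_of_continuousAt (F.param.mem q.1) hq1.2.continuousAt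
      · exact (F.eq_of_survives hu hq0 hq2 hq1.1).symm
    rw [hps]
    filter_upwards [F.eventually_surface
      (P := fun s t => Y s = u (position f X Y t s) t) hev] with q ⟨s', hq, hq0, hq'⟩
    rw [hq]
    exact ⟨hq0, hq'⟩
  by_cases hlr : leftLim h (X s) < rightLim h (X s)
  · right; right
    refine ⟨X s, hd, ?_⟩
    have hY : Y s = h (X s) := by
      by_contra hne
      refine notMem_graphBoundary_of_eventually_notMem hsurf ?_ hp
      have hev : ∀ᶠ q : ℝ × ℝ in 𝓝 (s, 0), 0 ≤ q.2 →
          Y q.1 ≠ u (position f X Y q.2 q.1) q.2 := by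
        filter_upwards [(continuous_fst.tendsto (s, (0 : ℝ))).eventually
          ((F.eventually_fst_eq hE hd).and
            (F.param.continuous_snd.continuousAt.eventually (isOpen_ne.mem_nhds hne)))]
          with q hq hq0 he
        rcases hq0.eq_or_lt with hq0 | hq0
        · rw [← hq0, hz, h0, hq.1] at he
          exact hq.2 he
        · exact F.not_survives_of_jump (by rw [hq.1]; exact hlr) (F.survives_of_eq hu hq0 he.symm)
      rw [hps]
      filter_upwards [F.eventually_surface
        (P := fun s t => Y s ≠ u (position f X Y t s) t) hev] with q ⟨s', hq, hq0, hq'⟩ hm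
      rw [hq] at hm
      exact hq' hm.2
    rw [hps, surfacePoint, hz, hY]
  · exact Or.inl ⟨s, ⟨hE, hd, hlr⟩, hps⟩

/-- The point is approached within the graph along its own characteristic and, unless it is itself
off the graph, from outside along the vertical segment, on which `u(·, 0)` takes one value only. -/
theorem mem_boundary_zero (F : Folding f h X Y K E) (hu : IsOptField f h K u)
    (h0 : ∀ x, u x 0 = h x) (hs : s ∉ E) (hd : ¬ ContDiffAt ℝ 1 h (X s))
    (hlr : ¬ leftLim h (X s) < rightLim h (X s)) :
    surfacePoint f X Y s 0 ∈ graphBoundary f h u := by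
  have hz : ∀ s, position f X Y 0 s = X s := fun s => by rw [position, mul_zero, add_zero]
  obtain ⟨t₁, ht₁, hev⟩ := (F.short_time hs).resolve_right hlr
  refine (mem_graphBoundary_iff (F.graphOf_subset hu h0)).2 ⟨F.surfacePoint_mem le_rfl, ?_, ?_⟩
  · have hc : Tendsto (fun t' => surfacePoint f X Y s t') (𝓝 0) (𝓝 (surfacePoint f X Y s 0)) :=
      (F.continuous_surfacePoint.comp (by fun_prop : Continuous fun t' : ℝ => (s, t'))).tendsto 0
    refine mem_closure_of_tendsto (hc.mono_left (nhdsWithin_le_nhds (s := Ioi 0))) ?_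
    filter_upwards [Ioo_mem_nhdsGT ht₁] with t' ht'
    exact ⟨ht'.1.le, (F.eq_of_survives hu ht'.1 ht'.2 hev.self_of_nhds).symm⟩
  · have hc : Tendsto (fun s' => surfacePoint f X Y s' 0) (𝓝 s) (𝓝 (surfacePoint f X Y s 0)) :=
      (F.continuous_surfacePoint.comp (by fun_prop : Continuous fun s' : ℝ => (s', (0 : ℝ)))).tendsto s
    by_cases hY : Y s = h (X s)
    · refine mem_closure_of_tendsto (hc.mono_left (nhdsWithin_le_nhds (s := {s}ᶜ))) ?_
      filter_upwards [(F.eventually_fst_eq hs hd).filter_mono nhdsWithin_le_nhds,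
        eventually_mem_nhdsWithin] with s' hs' hne
      refine ⟨F.surfacePoint_mem le_rfl, fun hm => hne ?_⟩
      have h1 : Y s' = u (position f X Y 0 s') 0 := hm.2
      rw [hz, h0, hs', ← hY] at h1
      exact F.param.eq_of_eq hs' h1
    · refine subset_closure ⟨F.surfacePoint_mem le_rfl, fun hm => hY ?_⟩
      have h1 : Y s = u (position f X Y 0 s) 0 := hm.2
      rwa [hz, h0] at h1

end Folding
end EqualArea

/-! ### Where shocks start, and what finitely many shocks imply -/

namespace EqualArea
open Function

variable {f h X Y : ℝ → ℝ} {K s s' t t' z : ℝ} {E : Finset ℝ} {u : ℝ → ℝ → ℝ}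

/-- A shock starts at the point with parameter `s` at time `t`: the point is absorbed, and it is
the only one at its position. -/
def IsCenter (f h X Y : ℝ → ℝ) (K s t : ℝ) : Prop :=
  Dies f h X Y K s t ∧ ∀ s' ∈ optSet f h X Y K t (position f X Y t s), s' = s

namespace Folding

theorem survives_sSup (F : Folding f h X Y K E) {B : ℝ}
    (hne : {t | t ≤ B ∧ Survives f h X Y K s t}.Nonempty) :
    Survives f h X Y K s (sSup {t | t ≤ B ∧ Survives f h X Y K s t}) := by
  set S := {t | t ≤ B ∧ Survives f h X Y K s t}
  have hbdd : BddAbove S := ⟨B, fun t ht => ht.1⟩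
  obtain ⟨t₀, ht₀⟩ := hne
  have hpos : 0 < sSup S := ht₀.2.1.trans_le (le_csSup hbdd ht₀)
  by_contra hn
  have h1 : ∀ᶠ t in 𝓝 (sSup S), ¬ Survives f h X Y K s t :=
    ((by fun_prop : Continuous fun t : ℝ => (s, t)).tendsto (sSup S)).eventually
      (F.eventually_not_survives hpos hn)
  obtain ⟨l, hl, hsub⟩ := exists_Ioc_subset_of_mem_nhds h1 (exists_lt _)
  obtain ⟨t, ht, hlt⟩ := exists_lt_of_lt_csSup ⟨t₀, ht₀⟩ hl
  exact hsub ⟨hlt, le_csSup hbdd ht⟩ ht.2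

theorem dies_sSup (F : Folding f h X Y K E) {B : ℝ} (hs : Survives f h X Y K s t)
    (hB : ¬ Survives f h X Y K s B) (htB : t ≤ B) :
    Dies f h X Y K s (sSup {t | t ≤ B ∧ Survives f h X Y K s t}) := by
  have hne : {t | t ≤ B ∧ Survives f h X Y K s t}.Nonempty := ⟨t, htB, hs⟩
  refine ⟨F.survives_sSup hne, fun t' ht' hs' => ?_⟩
  rcases le_total t' B with hle | hle
  · have hbdd : BddAbove {t | t ≤ B ∧ Survives f h X Y K s t} := ⟨B, fun t ht => ht.1⟩
    exact absurd (le_csSup hbdd (show t' ∈ {t | t ≤ B ∧ _} from ⟨hle, hs'⟩)) (not_le.2 ht')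
  · exact hB (F.survives_of_le hs' (hs.1.trans_le htB) hle)

theorem exists_dies (F : Folding f h X Y K E) {B : ℝ} (hs : Survives f h X Y K s t)
    (hB : ¬ Survives f h X Y K s B) (hB0 : 0 < B) : ∃ τ, Dies f h X Y K s τ :=
  ⟨_, F.dies_sSup hs hB (le_of_not_ge fun hlt => hB (F.survives_of_le hs hB0 hlt))⟩

theorem mem_optSet_of_between (F : Folding f h X Y K E) {s₁ s₂ : ℝ} (h1 : s₁ ∈ optSet f h X Y K t z)
    (h2 : s₂ ∈ optSet f h X Y K t z) (hs : Survives f h X Y K s t) (hl : s₁ ≤ s) (hr : s ≤ s₂) :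
    s ∈ optSet f h X Y K t z :=
  ⟨le_antisymm (h2.1 ▸ F.position_le hs ⟨hs.1, h2.2⟩ hr)
    (h1.1 ▸ F.position_le ⟨hs.1, h1.2⟩ hs hl), hs.2⟩

/-- If all parameters in between survived, they would be squeezed into one position, but only
finitely many parameters share a position. -/
theorem exists_dead_between (F : Folding f h X Y K E) (ht : 0 < t) {s₁ s₂ : ℝ}
    (h1 : s₁ ∈ optSet f h X Y K t z) (h2 : s₂ ∈ optSet f h X Y K t z) (hlt : s₁ < s₂) :
    ∃ s ∈ Ioo s₁ s₂, ¬ Survives f h X Y K s t := by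
  by_contra! hall
  exact (Ioo_infinite hlt) ((F.finite_optSet ht z).subset fun s hs =>
    F.mem_optSet_of_between h1 h2 (hall s hs) hs.1.le hs.2.le)

/-- If a point between two surviving points has been absorbed, a shock has started between them. -/
theorem exists_isCenter (F : Folding f h X Y K E) {r₁ r₂ : ℝ} (h1 : Survives f h X Y K r₁ t)
    (h2 : Survives f h X Y K r₂ t) (hs : s ∈ Ioo r₁ r₂) (hd : ¬ Survives f h X Y K s t)
    (hT : ∀ s ∈ Icc r₁ r₂, ∃ t, Survives f h X Y K s t) :
    ∃ m ∈ Ioo r₁ r₂, ∃ t₀, IsCenter f h X Y K m t₀ := by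
  have ht := h1.1
  have hne : ∀ s ∈ Icc r₁ r₂, {τ | τ ≤ t ∧ Survives f h X Y K s τ}.Nonempty := fun s hs => by
    obtain ⟨τ, hτ⟩ := hT s hs
    exact ⟨min τ t, min_le_right _ _, F.survives_of_le hτ (lt_min hτ.1 ht) (min_le_left _ _)⟩
  have hbdd : ∀ s, BddAbove {τ | τ ≤ t ∧ Survives f h X Y K s τ} := fun s => ⟨t, fun τ hτ => hτ.1⟩
  -- The survival time, truncated at `t`, is lower semicontinuous because survival is open. Its
  -- minimum point is the first to be absorbed, and everything else between `r₁` and `r₂` is still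
  -- alive then.
  set L : ℝ → ℝ := fun s => sSup {τ | τ ≤ t ∧ Survives f h X Y K s τ} with hL
  have hLs : ∀ s ∈ Icc r₁ r₂, Survives f h X Y K s (L s) := fun s hs => F.survives_sSup (hne s hs)
  have hlsc : LowerSemicontinuousOn L (Icc r₁ r₂) := by
    intro s hs y hy
    obtain ⟨τ, hτ, hyτ⟩ := exists_lt_of_lt_csSup (hne s hs) hy
    obtain ⟨τ', h3, h4⟩ := _root_.exists_between (max_lt hyτ hτ.2.1)
    filter_upwards [(F.eventually_survives ((le_max_right _ _).trans_lt h3) h4 hτ.2).filter_mono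
      nhdsWithin_le_nhds] with s' hs'
    exact ((le_max_left _ _).trans_lt h3).trans_le
      (le_csSup (hbdd s') ⟨h4.le.trans hτ.1, hs'⟩)
  have hsI : s ∈ Icc r₁ r₂ := ⟨hs.1.le, hs.2.le⟩
  obtain ⟨m, hm, hmin⟩ := hlsc.exists_isMinOn ⟨s, hsI⟩ isCompact_Icc
  have hLt : L m < t := by
    refine lt_of_le_of_lt (hmin hsI) (lt_of_le_of_ne ?_ fun e => hd (e ▸ hLs s hsI))
    exact csSup_le (hne s hsI) fun τ hτ => hτ.1
  have hdead : ¬ Survives f h X Y K m t := fun hst =>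
    absurd (le_csSup (hbdd m) ⟨le_rfl, hst⟩) (not_le.2 hLt)
  have hmI : m ∈ Ioo r₁ r₂ := ⟨lt_of_le_of_ne hm.1 fun e => hdead (e ▸ h1),
    lt_of_le_of_ne hm.2 fun e => hdead (e ▸ h2)⟩
  have hall : ∀ s ∈ Icc r₁ r₂, Survives f h X Y K s (L m) := fun s hs =>
    F.survives_of_le (hLs s hs) (hLs m hm).1 (hmin hs)
  have hm0 := (hLs m hm).1
  have hdies : Dies f h X Y K m (L m) := by
    obtain ⟨τ, hτ⟩ := hne m hm
    exact F.dies_sSup hτ.2 hdead hτ.1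
  refine ⟨m, hmI, L m, hdies, fun p hp => ?_⟩
  have hmo := mem_optSet hdies.1
  by_contra hpm
  -- A companion `p` of `m` beyond `r₁` or `r₂` would squeeze that end point into the collision,
  -- though it survives until `t`; a companion in between would enclose a parameter already dead.
  rcases lt_or_gt_of_ne hpm with hlt | hlt
  · rcases le_or_gt p r₁ with hle | hgt
    · have hr := F.mem_optSet_of_between hp hmo (hall r₁ ⟨le_rfl, (hmI.1.trans hmI.2).le⟩) hle hmI.1.le
      exact hmI.1.ne' (F.eq_of_survives_later hm0 hLt h1 (by rw [hr.1]; exact hmo))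
    · obtain ⟨q, hq, hqd⟩ := F.exists_dead_between hm0 hp hmo hlt
      exact hqd (hall q ⟨(hgt.trans hq.1).le, (hq.2.trans hmI.2).le⟩)
  · rcases le_or_gt r₂ p with hle | hgt
    · have hr := F.mem_optSet_of_between hmo hp (hall r₂ ⟨(hmI.1.trans hmI.2).le, le_rfl⟩) hmI.2.le hle
      exact hmI.2.ne (F.eq_of_survives_later hm0 hLt h2 (by rw [hr.1]; exact hmo))
    · obtain ⟨q, hq, hqd⟩ := F.exists_dead_between hm0 hmo hp hlt
      exact hqd (hall q ⟨(hmI.1.trans hq.1).le, (hq.2.trans hgt).le⟩)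

/-- A point that does not survive lies below a shock. -/
theorem exists_shock (F : Folding f h X Y K E) (ht : 0 < t) (hs : ¬ Survives f h X Y K s t) :
    ∃ z, loParam f h X Y K t z < s ∧ s < hiParam f h X Y K t z := by
  obtain ⟨z, hz⟩ := F.exists_mem_Icc ht s
  exact ⟨z, lt_of_le_of_ne hz.1 fun e => hs ⟨ht, e ▸ (F.loParam_mem ht z).2⟩,
    lt_of_le_of_ne hz.2 fun e => hs ⟨ht, e ▸ (F.hiParam_mem ht z).2⟩⟩

theorem abs_position_sub_le (F : Folding f h X Y K E) {C : ℝ}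
    (hC : ∀ y, |y| ≤ K → |deriv f y| ≤ C) (s t t' : ℝ) :
    |position f X Y t' s - position f X Y t s| ≤ C * |t' - t| := by
  rw [show position f X Y t' s - position f X Y t s = deriv f (Y s) * (t' - t) by
    simp only [position]; ring, abs_mul]
  exact mul_le_mul_of_nonneg_right
    (hC _ (abs_le.2 (F.admissible.mem_Icc_of_mem (F.param.mem_initialCurve s)))) (abs_nonneg _)

/-- After a point has been absorbed its shock moves with bounded speed. -/
theorem exists_shock_after (F : Folding f h X Y K E) {C : ℝ}
    (hC : ∀ y, |y| ≤ K → |deriv f y| ≤ C) (hd : Dies f h X Y K s t) (htt : t < t') :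
    ∃ z, loParam f h X Y K t' z < hiParam f h X Y K t' z ∧
      |z - position f X Y t s| ≤ C * |t' - t| := by
  have ht' := hd.1.1.trans htt
  obtain ⟨z, h1, h2⟩ := F.exists_shock ht' (hd.2 t' htt)
  have m1 := F.loParam_mem ht' z
  have m2 := F.hiParam_mem ht' z
  have a1 := F.position_le (F.survives_of_le ⟨ht', m1.2⟩ hd.1.1 htt.le) hd.1 h1.le
  have a2 := F.position_le hd.1 (F.survives_of_le ⟨ht', m2.2⟩ hd.1.1 htt.le) h2.le
  have b1 := abs_le.1 (F.abs_position_sub_le hC (loParam f h X Y K t' z) t t')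
  have b2 := abs_le.1 (F.abs_position_sub_le hC (hiParam f h X Y K t' z) t t')
  rw [m1.1] at b1
  rw [m2.1] at b2
  exact ⟨z, h1.trans h2, abs_le.2 ⟨by linarith, by linarith⟩⟩

/-- Before a collision of two points there is a shock between them. -/
theorem eventually_shock_before (F : Folding f h X Y K E) (ht : 0 < t) {s₁ s₂ : ℝ}
    (h1 : s₁ ∈ optSet f h X Y K t z) (h2 : s₂ ∈ optSet f h X Y K t z) (hlt : s₁ < s₂) :
    ∀ᶠ τ in 𝓝[<] t, ∃ w, loParam f h X Y K τ w < hiParam f h X Y K τ w ∧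
      position f X Y τ s₁ ≤ w ∧ w ≤ position f X Y τ s₂ := by
  obtain ⟨s, hs, hd⟩ := F.exists_dead_between ht h1 h2 hlt
  have hev : ∀ᶠ τ in 𝓝 t, ¬ Survives f h X Y K s τ :=
    ((by fun_prop : Continuous fun t : ℝ => (s, t)).tendsto t).eventually
      (F.eventually_not_survives ht hd)
  filter_upwards [hev.filter_mono nhdsWithin_le_nhds, Ioo_mem_nhdsLT ht] with τ hτ hτ'
  obtain ⟨w, hw1, hw2⟩ := F.exists_shock hτ'.1 hτ
  have m1 := F.loParam_mem hτ'.1 w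
  have m2 := F.hiParam_mem hτ'.1 w
  refine ⟨w, hw1.trans hw2, ?_, ?_⟩
  · exact m2.1 ▸ F.position_le (F.survives_of_le ⟨ht, h1.2⟩ hτ'.1 hτ'.2.le) ⟨hτ'.1, m2.2⟩
      (hs.1.trans hw2).le
  · exact m1.1 ▸ F.position_le ⟨hτ'.1, m1.2⟩ (F.survives_of_le ⟨ht, h2.2⟩ hτ'.1 hτ'.2.le)
      (hw1.trans hs.2).le

end Folding

/-- The shocks of `u` lie on `n` pairwise disjoint continuous paths. -/
structure ShockPaths (u : ℝ → ℝ → ℝ) {n : ℕ} (I : Fin n → Set ℝ) (σ : Fin n → ℝ → ℝ) : Prop where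
  ordConnected : ∀ i, (I i).OrdConnected
  continuousOn : ∀ i, ContinuousOn (σ i) (I i)
  eq_of_eq : ∀ i j t, t ∈ I i → t ∈ I j → σ i t = σ j t → i = j
  mem_iff : ∀ q, q ∈ shockSet u ↔ ∃ i, q.2 ∈ I i ∧ σ i q.2 = q.1

theorem FinitelyManyShocks.exists_shockPaths (hu : FinitelyManyShocks u) :
    ∃ (n : ℕ) (I : Fin n → Set ℝ) (σ : Fin n → ℝ → ℝ), ShockPaths u I σ := by
  obtain ⟨n, I, σ, h1, h2, h3⟩ := hu
  refine ⟨n, I, σ, fun i => (h1 i).1, fun i => (h1 i).2, fun i j t hi hj he => ?_, fun q => ?_⟩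
  · by_contra hne
    exact Set.disjoint_left.1 (h2 hne) ⟨t, hi, rfl⟩ ⟨t, hj, Prod.ext he.symm rfl⟩
  · rw [h3]
    simp only [mem_iUnion, mem_image]
    exact exists_congr fun i => ⟨fun ⟨t, ht, he⟩ => he ▸ ⟨ht, rfl⟩, fun ⟨ht, he⟩ => ⟨_, ht, Prod.ext he rfl⟩⟩

/-- The times at which one of the shock paths begins or ends without containing its end point. -/
def openEnds {n : ℕ} (I : Fin n → Set ℝ) : Set ℝ :=
  {t | ∃ i, t ∉ I i ∧ ((∃ᶠ τ in 𝓝[>] t, τ ∈ I i) ∨ ∃ᶠ τ in 𝓝[<] t, τ ∈ I i)}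

theorem exists_frequently {ι α : Type*} [Finite ι] {l : Filter α} [l.NeBot] {P : ι → α → Prop}
    (hP : ∀ᶠ a in l, ∃ i, P i a) : ∃ i, ∃ᶠ a in l, P i a := by
  by_contra! hn
  have : ∀ᶠ a in l, ∀ i, ¬ P i a := eventually_all.2 fun i => hn i
  obtain ⟨a, ⟨i, hi⟩, ha⟩ := (hP.and this).exists
  exact ha i hi

namespace ShockPaths

variable {n : ℕ} {I : Fin n → Set ℝ} {σ : Fin n → ℝ → ℝ}

/-- Each of the finitely many intervals lacks at most one end point on either side. -/
theorem finite_openEnds (P : ShockPaths u I σ) : (openEnds I).Finite := by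
  have h1 : ∀ i, {t | t ∉ I i ∧ ∃ᶠ τ in 𝓝[>] t, τ ∈ I i}.Subsingleton := by
    intro i
    have key : ∀ t t', t ∉ I i → t' ∉ I i → (∃ᶠ τ in 𝓝[>] t, τ ∈ I i) →
        (∃ᶠ τ in 𝓝[>] t', τ ∈ I i) → ¬ t < t' := by
      intro t t' ht ht' hf hf' hlt
      obtain ⟨a, ha, ha'⟩ := (hf.and_eventually (Ioo_mem_nhdsGT hlt)).exists
      obtain ⟨b, hb, hb'⟩ := (hf'.and_eventually self_mem_nhdsWithin).exists
      exact ht' ((P.ordConnected i).out ha hb ⟨ha'.2.le, le_of_lt hb'⟩)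
    intro t ht t' ht'
    exact le_antisymm (not_lt.1 (key t' t ht'.1 ht.1 ht'.2 ht.2))
      (not_lt.1 (key t t' ht.1 ht'.1 ht.2 ht'.2))
  have h2 : ∀ i, {t | t ∉ I i ∧ ∃ᶠ τ in 𝓝[<] t, τ ∈ I i}.Subsingleton := by
    intro i
    have key : ∀ t t', t ∉ I i → t' ∉ I i → (∃ᶠ τ in 𝓝[<] t, τ ∈ I i) →
        (∃ᶠ τ in 𝓝[<] t', τ ∈ I i) → ¬ t < t' := by
      intro t t' ht ht' hf hf' hlt
      obtain ⟨a, ha, ha'⟩ := (hf'.and_eventually (Ioo_mem_nhdsLT hlt)).exists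
      obtain ⟨b, hb, hb'⟩ := (hf.and_eventually self_mem_nhdsWithin).exists
      exact ht ((P.ordConnected i).out hb ha ⟨le_of_lt hb', ha'.1.le⟩)
    intro t ht t' ht'
    exact le_antisymm (not_lt.1 (key t' t ht'.1 ht.1 ht'.2 ht.2))
      (not_lt.1 (key t t' ht.1 ht'.1 ht.2 ht'.2))
  refine (finite_iUnion fun i => (h1 i).finite.union (h2 i).finite).subset ?_
  rintro t ⟨i, hi, hf | hf⟩
  · exact mem_iUnion.2 ⟨i, Or.inl ⟨hi, hf⟩⟩
  · exact mem_iUnion.2 ⟨i, Or.inr ⟨hi, hf⟩⟩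

theorem exists_path (P : ShockPaths u I σ) (F : Folding f h X Y K E) (hu : IsOptField f h K u)
    (ht : 0 < t) (hz : loParam f h X Y K t z < hiParam f h X Y K t z) :
    ∃ i, t ∈ I i ∧ σ i t = z :=
  (P.mem_iff (z, t)).1 ⟨ht, fun hc => (F.continuousAt_iff hu ht).1 hc hz⟩

theorem eq_of_frequently (P : ShockPaths u I σ) {i : Fin n} (hi : t ∈ I i) {l : Filter ℝ}
    (hl : l ≤ 𝓝 t) {C : ℝ} (hf : ∃ᶠ τ in l, τ ∈ I i ∧ |σ i τ - z| ≤ C * |τ - t|) : σ i t = z := by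
  have hne := frequently_iff_neBot.1 hf
  set g := l ⊓ 𝓟 {τ | τ ∈ I i ∧ |σ i τ - z| ≤ C * |τ - t|}
  have hg : ∀ᶠ τ in g, τ ∈ I i ∧ |σ i τ - z| ≤ C * |τ - t| := mem_inf_of_right (mem_principal_self _)
  have hgt : g ≤ 𝓝 t := inf_le_left.trans hl
  have h1 : Tendsto (σ i) g (𝓝 (σ i t)) :=
    (P.continuousOn i t hi).mono_left (le_inf hgt (le_principal_iff.2 (hg.mono fun τ hτ => hτ.1)))
  have h2 : Tendsto (fun τ => σ i τ - z) g (𝓝 0) := by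
    have hc : Continuous fun τ : ℝ => C * |τ - t| := by fun_prop
    refine squeeze_zero_norm' (a := fun τ : ℝ => C * |τ - t|) (hg.mono fun τ hτ => hτ.2) ?_
    simpa using (hc.tendsto t).mono_left hgt
  have h3 := tendsto_nhds_unique (h1.sub_const z) h2
  linarith

/-- Some shock path comes out of the centre. If its interval contained `t`, it would by continuity
pass through the centre, but a parameter alone at its position is a point of continuity of `u(·,
t)`. -/
theorem mem_openEnds_of_isCenter (P : ShockPaths u I σ) (F : Folding f h X Y K E)
    (hu : IsOptField f h K u) (hc : IsCenter f h X Y K s t) : t ∈ openEnds I := by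
  obtain ⟨C, hC0, -, hC⟩ := F.admissible.exists_flux_bound
  have ht := hc.1.1.1
  have hev : ∀ᶠ τ in 𝓝[>] t, ∃ i, τ ∈ I i ∧ |σ i τ - position f X Y t s| ≤ C * |τ - t| := by
    filter_upwards [self_mem_nhdsWithin] with τ hτ
    obtain ⟨z, hz, hzb⟩ := F.exists_shock_after hC hc.1 hτ
    obtain ⟨i, hi, rfl⟩ := P.exists_path F hu (ht.trans hτ) hz
    exact ⟨i, hi, hzb⟩
  obtain ⟨i, hi⟩ := exists_frequently hev
  refine ⟨i, fun hmem => ?_, Or.inl (hi.mono fun τ hτ => hτ.1)⟩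
  have he := P.eq_of_frequently hmem nhdsWithin_le_nhds hi
  have hs := (P.mem_iff (position f X Y t s, t)).2 ⟨i, hmem, he⟩
  refine hs.2 ((F.continuousAt_iff hu ht).2 fun hlt => ?_)
  rw [hc.2 _ (F.loParam_mem ht _), hc.2 _ (F.hiParam_mem ht _)] at hlt
  exact lt_irrefl _ hlt

/-- Just before `t` there are shocks between `s₁` and `s₂` and between `s₂` and `s₃`, both tending
to `z`. If the intervals of both paths contained `t`, the two paths would intersect. -/
theorem mem_openEnds_of_triple (P : ShockPaths u I σ) (F : Folding f h X Y K E)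
    (hu : IsOptField f h K u) (ht : 0 < t) {s₁ s₂ s₃ : ℝ} (h1 : s₁ ∈ optSet f h X Y K t z)
    (h2 : s₂ ∈ optSet f h X Y K t z) (h3 : s₃ ∈ optSet f h X Y K t z) (h12 : s₁ < s₂)
    (h23 : s₂ < s₃) : t ∈ openEnds I := by
  obtain ⟨C, hC0, -, hC⟩ := F.admissible.exists_flux_bound
  have hev : ∀ᶠ τ in 𝓝[<] t, ∃ p : Fin n × Fin n, p.1 ≠ p.2 ∧
      (τ ∈ I p.1 ∧ |σ p.1 τ - z| ≤ C * |τ - t|) ∧ (τ ∈ I p.2 ∧ |σ p.2 τ - z| ≤ C * |τ - t|) := by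
    filter_upwards [F.eventually_shock_before ht h1 h2 h12, F.eventually_shock_before ht h2 h3 h23,
      Ioo_mem_nhdsLT ht] with τ ⟨w, hw, hw1, hw2⟩ ⟨w', hw', hw1', hw2'⟩ hτ
    have b1 := abs_le.1 (F.abs_position_sub_le hC s₁ t τ)
    have b2 := abs_le.1 (F.abs_position_sub_le hC s₂ t τ)
    have b3 := abs_le.1 (F.abs_position_sub_le hC s₃ t τ)
    rw [h1.1] at b1
    rw [h2.1] at b2
    rw [h3.1] at b3
    -- A common shock would sit on the middle characteristic, which is alone at its position until
    -- `t`.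
    have hne : w ≠ w' := by
      rintro rfl
      have he : w = position f X Y τ s₂ := le_antisymm hw2 hw1'
      have hs₂ : Survives f h X Y K s₂ t := ⟨ht, h2.2⟩
      have e1 := F.eq_of_survives_later hτ.1 hτ.2 hs₂ (F.loParam_mem hτ.1 _)
      have e2 := F.eq_of_survives_later hτ.1 hτ.2 hs₂ (F.hiParam_mem hτ.1 _)
      rw [he] at hw
      exact hw.ne (e1.trans e2.symm)
    obtain ⟨i, hi, hiw⟩ := P.exists_path F hu hτ.1 hw
    obtain ⟨j, hj, hjw⟩ := P.exists_path F hu hτ.1 hw'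
    refine ⟨(i, j), fun hij => hne ?_, ⟨hi, ?_⟩, ⟨hj, ?_⟩⟩
    · have hij : i = j := hij
      rw [← hiw, ← hjw, hij]
    · rw [hiw]; exact abs_le.2 ⟨by linarith, by linarith⟩
    · rw [hjw]; exact abs_le.2 ⟨by linarith, by linarith⟩
  obtain ⟨⟨i, j⟩, hij⟩ := exists_frequently hev
  have hi := hij.mono fun τ hτ => hτ.2.1
  have hj := hij.mono fun τ hτ => hτ.2.2
  by_contra hn
  have hti : t ∈ I i := by
    by_contra hmem
    exact hn ⟨i, hmem, Or.inr (hi.mono fun τ hτ => hτ.1)⟩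
  have htj : t ∈ I j := by
    by_contra hmem
    exact hn ⟨j, hmem, Or.inr (hj.mono fun τ hτ => hτ.1)⟩
  obtain ⟨τ, hτ⟩ := hij.exists
  exact hτ.1 (P.eq_of_eq i j t hti htj ((P.eq_of_frequently hti nhdsWithin_le_nhds hi).trans
    (P.eq_of_frequently htj nhdsWithin_le_nhds hj).symm))

/-- Only finitely many points are absorbed at a given time. -/
theorem finite_dies (P : ShockPaths u I σ) (F : Folding f h X Y K E)
    (hu : IsOptField f h K u) (t : ℝ) : {s | Dies f h X Y K s t}.Finite := by
  rcases le_or_gt t 0 with ht | ht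
  · refine Set.finite_empty.subset fun s hs => ?_
    exact absurd hs.1.1 (not_lt.2 ht)
  obtain ⟨C, hC0, -, hC⟩ := F.admissible.exists_flux_bound
  have hpos : (position f X Y t '' {s | Dies f h X Y K s t}).Finite := by
    by_contra hinf
    -- Absorption at `n + 1` different positions would give, slightly later, `n + 1` separated
    -- shocks on only `n` paths.
    obtain ⟨A, hA, hcard⟩ := Set.Infinite.exists_subset_card_eq hinf (n + 1)
    have hsep : ∀ᶠ τ in 𝓝[>] t, ∀ z ∈ A, ∀ z' ∈ A, z ≠ z' → 2 * (C * |τ - t|) < |z - z'| := by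
      refine (Finset.eventually_all A).2 fun z _ => (Finset.eventually_all A).2 fun z' _ => ?_
      by_cases hne : z = z'
      · exact Eventually.of_forall fun _ h => absurd hne h
      have hc : Continuous fun τ : ℝ => 2 * (C * |τ - t|) := by fun_prop
      filter_upwards [(hc.tendsto t).eventually_lt_const
        (by simpa using abs_pos.2 (sub_ne_zero.2 hne) : _ < |z - z'|) |>.filter_mono
        nhdsWithin_le_nhds] with τ hτ _
      exact hτ
    obtain ⟨τ, hτ, hsepτ⟩ := ((eventually_mem_nhdsWithin (s := Ioi t)).and hsep).exists
    have hpath : ∀ z, ∃ i, z ∈ A → |σ i τ - z| ≤ C * |τ - t| := by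
      intro z
      by_cases hz : z ∈ A
      · obtain ⟨s, hs, rfl⟩ := hA hz
        obtain ⟨w, hw, hwb⟩ := F.exists_shock_after hC hs hτ
        obtain ⟨i, -, rfl⟩ := P.exists_path F hu (ht.trans hτ) hw
        exact ⟨i, fun _ => hwb⟩
      · obtain ⟨z₀, hz₀⟩ := Finset.card_pos.1 (by omega : 0 < A.card)
        obtain ⟨s, hs, rfl⟩ := hA hz₀
        obtain ⟨w, hw, hwb⟩ := F.exists_shock_after hC hs hτ
        obtain ⟨i, -, -⟩ := P.exists_path F hu (ht.trans hτ) hw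
        exact ⟨i, fun h => absurd h hz⟩
    choose ι hι using hpath
    have hle := Finset.card_le_card_of_injOn (s := A) (t := Finset.univ) ι (fun _ _ => Finset.mem_coe.2 (Finset.mem_univ _))
      fun z hz z' hz' he => by
        by_contra hne
        have h1 := hι z hz
        have h2 := hι z' hz'
        rw [he] at h1
        have h3 := hsepτ z hz z' hz' hne
        have h4 := abs_sub_le z (σ (ι z') τ) z'
        rw [abs_sub_comm z (σ _ _)] at h4
        linarith
    rw [hcard, Finset.card_univ, Fintype.card_fin] at hle
    omega
  refine (hpos.biUnion fun z _ => F.finite_optSet ht z).subset fun s hs => ?_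
  exact mem_biUnion (mem_image_of_mem _ hs) (Folding.mem_optSet hs.1)

end ShockPaths
end EqualArea

/-! ### Differentiability of the time of absorption -/

namespace EqualArea
open Function

variable {f h X Y : ℝ → ℝ} {K s s' t t' z : ℝ} {E : Finset ℝ} {u : ℝ → ℝ → ℝ}

/-- Implicit differentiation of a continuous function. -/
theorem hasDerivAt_of_isLittleO {T : ℝ → ℝ} {A B s₀ : ℝ} (hB : B ≠ 0)
    (ho : (fun s => A * (s - s₀) + B * (T s - T s₀)) =o[𝓝 s₀] fun s => (s - s₀, T s - T s₀)) :
    HasDerivAt T (-A / B) s₀ := by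
  -- With constant `|B| / 2` the remainder is absorbed by `|B| |T s - T s₀|`, which bounds the
  -- increment of `T` linearly.
  have hO : (fun s => (s - s₀, T s - T s₀)) =O[𝓝 s₀] fun s => s - s₀ := by
    have hb := ho.def (half_pos (abs_pos.2 hB))
    refine Asymptotics.IsBigO.prod_left (Asymptotics.isBigO_refl _ _)
      (Asymptotics.IsBigO.of_bound (2 * |A| / |B| + 1) ?_)
    filter_upwards [hb] with s hs
    rw [Prod.norm_def] at hs
    simp only [Real.norm_eq_abs] at hs ⊢
    have hB' := abs_pos.2 hB
    have h1 : |B| * |T s - T s₀| ≤ |A| * |s - s₀| + |A * (s - s₀) + B * (T s - T s₀)| := by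
      rw [← abs_mul, ← abs_mul]
      have := abs_sub (A * (s - s₀) + B * (T s - T s₀)) (A * (s - s₀))
      rw [add_sub_cancel_left] at this
      linarith
    have h2 : max |s - s₀| |T s - T s₀| ≤ |s - s₀| + |T s - T s₀| :=
      max_le (le_add_of_nonneg_right (abs_nonneg _)) (le_add_of_nonneg_left (abs_nonneg _))
    have h3 := mul_le_mul_of_nonneg_left h2 (half_pos hB').le
    rw [div_add_one hB'.ne', div_mul_eq_mul_div, le_div_iff₀ hB']
    nlinarith
  rw [hasDerivAt_iff_isLittleO]
  refine ((ho.trans_isBigO hO).const_mul_left B⁻¹).congr_left fun s => ?_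
  rw [smul_eq_mul]
  field_simp
  ring

theorem RegularParam.contDiffAt (P : RegularParam h X Y E) (hs : s ∉ E) :
    ContDiffAt ℝ 1 X s ∧ ContDiffAt ℝ 1 Y s := by
  rcases P.regular s hs with ⟨hc, hr⟩ | ⟨c, -, hr⟩
  · have hX : ContDiffAt ℝ 1 X s :=
      (by fun_prop : ContDiffAt ℝ 1 (fun u => X s + (u - s)) s).congr_of_eventuallyEq
        (hr.mono fun u hu => hu.1)
    exact ⟨hX, (hc.comp s hX).congr_of_eventuallyEq (hr.mono fun u hu => hu.2)⟩
  · exact ⟨contDiffAt_const.congr_of_eventuallyEq (hr.mono fun u hu => hu.1),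
      (by fun_prop : ContDiffAt ℝ 1 (fun u => Y s + c * (u - s)) s).congr_of_eventuallyEq
        (hr.mono fun u hu => hu.2)⟩

theorem RegularParam.hasDerivAt_fst_snd (P : RegularParam h X Y E) (hs : s ∉ E) :
    HasDerivAt X (deriv X s) s ∧ HasDerivAt Y (deriv Y s) s :=
  ⟨((P.contDiffAt hs).1.differentiableAt one_ne_zero).hasDerivAt,
    ((P.contDiffAt hs).2.differentiableAt one_ne_zero).hasDerivAt⟩

theorem RegularParam.contDiffOn (P : RegularParam h X Y E) {J : Set ℝ}
    (hE : ∀ s ∈ J, s ∉ E) : ContDiffOn ℝ 1 X J ∧ ContDiffOn ℝ 1 Y J :=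
  ⟨fun s hs => (P.contDiffAt (hE s hs)).1.contDiffWithinAt,
    fun s hs => (P.contDiffAt (hE s hs)).2.contDiffWithinAt⟩

/-- The derivative of the position in the parameter. -/
noncomputable def positionDeriv (f X Y : ℝ → ℝ) (t s : ℝ) : ℝ :=
  deriv X s + deriv (deriv f) (Y s) * deriv Y s * t

theorem RegularParam.hasFDerivAt_position (P : RegularParam h X Y E) (H : Admissible f h K)
    (hs : s ∉ E) : HasFDerivAt (fun q : ℝ × ℝ => position f X Y q.2 q.1)
      (positionDeriv f X Y t s • ContinuousLinearMap.fst ℝ ℝ ℝ +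
        deriv f (Y s) • ContinuousLinearMap.snd ℝ ℝ ℝ) (s, t) := by
  have h1 := (P.hasDerivAt_fst_snd hs).1.hasFDerivAt.comp (s, t) (hasFDerivAt_fst (𝕜 := ℝ) (p := (s, t)))
  have h2 := (P.hasDerivAt_fst_snd hs).2
  have h3 : HasDerivAt (deriv f) (deriv (deriv f) (Y s)) (Y s) :=
    (H.contDiff_deriv.differentiable one_ne_zero _).hasDerivAt
  have h4 := (h3.comp s h2).hasFDerivAt.comp (s, t) (hasFDerivAt_fst (𝕜 := ℝ) (p := (s, t)))
  have h5 := h1.add (h4.mul (hasFDerivAt_snd (𝕜 := ℝ) (p := (s, t))))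
  refine h5.congr_fderiv ?_
  ext
  · simp [positionDeriv]; ring
  · simp [positionDeriv]

/-- A one-sided form of differentiability: along a family whose optimal feet converge to `x₀`, only
this foot counts. At a shock each of the two branches has its own expansion. -/
theorem Admissible.isLittleO_hopfLax (H : Admissible f h K) {α : Type*} {l : Filter α}
    {x z' t' : α → ℝ} {x₀ : ℝ} (ht : 0 < t) (ho : IsOpt f h K x₀ z t)
    (hx : Tendsto x l (𝓝 x₀)) (hz : Tendsto z' l (𝓝 z)) (htt : Tendsto t' l (𝓝 t))
    (hoi : ∀ᶠ i in l, IsOpt f h K (x i) (z' i) (t' i)) :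
    (fun i => hopfLax f h K (z' i) (t' i) - hopfLax f h K z t -
      (slopeOf f K (z - x₀) t * (z' i - z) - (f (slopeOf f K (z - x₀) t) - f 0) * (t' i - t)))
      =o[l] fun i => (z' i - z, t' i - t) := by
  refine isLittleO_of_sandwich (φ := fun y => f y - f 0)
    (y₁ := fun i => slopeOf f K (z - x i) t) (y₂ := fun i => slopeOf f K (z' i - x₀) (t' i))
    (H.continuous.sub continuous_const).continuousAt ?_ ?_ ?_ ?_
  · exact H.tendsto_slopeOf ht (tendsto_const_nhds.sub hx) tendsto_const_nhds
  · exact H.tendsto_slopeOf ht (hz.sub_const x₀) htt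
  · filter_upwards [hoi] with i hi
    have h1 := H.action_le (x i) z t
    have h2 := H.lag_sub_le (z - x i) t (z' i - x i) (t' i)
    rw [hi.hopfLax_eq]
    rw [sub_sub_sub_cancel_right] at h2
    unfold action at *
    linarith
  · filter_upwards with i
    have h1 := H.action_le x₀ (z' i) (t' i)
    have h2 := H.le_lag_sub (z - x₀) t (z' i - x₀) (t' i)
    rw [ho.hopfLax_eq]
    rw [sub_sub_sub_cancel_right] at h2
    unfold action at *
    linarith

/-- The time at which a point is absorbed. -/
noncomputable def deathTime (f h X Y : ℝ → ℝ) (K s : ℝ) : ℝ := sSup {t | Survives f h X Y K s t}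

theorem Dies.deathTime_eq (hd : Dies f h X Y K s t) : deathTime f h X Y K s = t :=
  IsGreatest.csSup_eq ⟨hd.1, fun t' ht' => not_lt.1 fun hlt => hd.2 t' hlt ht'⟩

namespace Folding

/-- Survival until shortly before `t` and absorption until shortly after `t` are both open
conditions on the parameter. -/
theorem eventually_dies (F : Folding f h X Y K E) (hd : Dies f h X Y K s t) {ε : ℝ} (hε : 0 < ε) :
    ∀ᶠ s' in 𝓝 s, ∃ t', Dies f h X Y K s' t' ∧ |t' - t| < ε := by
  obtain ⟨a, h1, h2⟩ := _root_.exists_between (max_lt hd.1.1 (sub_lt_self t hε))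
  obtain ⟨b, h3, h4⟩ := _root_.exists_between (lt_add_of_pos_right t hε)
  have ha : 0 < a := (le_max_left _ _).trans_lt h1
  have hb : 0 < b := hd.1.1.trans h3
  have e1 : ∀ᶠ s' in 𝓝 s, ¬ Survives f h X Y K s' b :=
    ((by fun_prop : Continuous fun s : ℝ => (s, b)).tendsto s).eventually
      (F.eventually_not_survives hb (hd.2 b h3))
  filter_upwards [e1, F.eventually_survives ha h2 hd.1] with s' hs1 hs2
  obtain ⟨τ, hτ⟩ := F.exists_dies hs2 hs1 hb
  have h5 : a ≤ τ := not_lt.1 fun hlt => hτ.2 a hlt hs2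
  have h6 : τ < b := not_le.1 fun hle => hs1 (F.survives_of_le hτ.1 hb hle)
  have h7 := (le_max_right _ _).trans_lt h1
  exact ⟨τ, hτ, abs_lt.2 ⟨by linarith, by linarith⟩⟩

theorem tendsto_deathTime (F : Folding f h X Y K E) (hd : Dies f h X Y K s t) :
    Tendsto (deathTime f h X Y K) (𝓝 s) (𝓝 t) := by
  refine Metric.tendsto_nhds.2 fun ε hε => ?_
  filter_upwards [F.eventually_dies hd hε] with s' ⟨t', ht', hlt⟩
  rwa [ht'.deathTime_eq]

theorem isOpt_of_mem (hs : s ∈ optSet f h X Y K t z) : IsOpt f h K (X s) z t := hs.1 ▸ hs.2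

theorem slopeOf_eq (F : Folding f h X Y K E) (ht : 0 < t) (hs : s ∈ optSet f h X Y K t z) :
    slopeOf f K (z - X s) t = Y s := by
  rw [← hs.1]
  exact F.admissible.slopeOf_char' (F.param.mem_initialCurve s) ht

theorem snd_ne (F : Folding f h X Y K E) (hs : s ∈ optSet f h X Y K t z)
    (hs' : s' ∈ optSet f h X Y K t z) (hne : s ≠ s') : Y s ≠ Y s' := fun he => by
  have h1 := hs.1.trans hs'.1.symm
  simp only [position, he, add_left_inj] at h1
  exact hne (F.param.eq_of_eq h1 he)

end Folding

/-- An interval of parameters of points that all survive for some time and are absorbed pairwise. -/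
structure PairingGap (f h X Y : ℝ → ℝ) (K : ℝ) (E : Finset ℝ) (J : Set ℝ) : Prop where
  isOpen : IsOpen J
  ordConnected : J.OrdConnected
  notMem : ∀ s ∈ J, s ∉ E
  survives : ∀ s ∈ J, ∃ t, Survives f h X Y K s t
  pair : ∀ s ∈ J, ∀ t, Dies f h X Y K s t →
    ∃ p, p ≠ s ∧ optSet f h X Y K t (position f X Y t s) = {s, p}

/-- The parameters in `J` of points that are absorbed. -/
def mortal (f h X Y : ℝ → ℝ) (K : ℝ) (J : Set ℝ) : Set ℝ := {s ∈ J | ∃ t, Dies f h X Y K s t}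

namespace PairingGap

variable {J : Set ℝ}

theorem not_isCenter (G : PairingGap f h X Y K E J) (hs : s ∈ J) : ¬ IsCenter f h X Y K s t := by
  intro hc
  obtain ⟨p, hp, he⟩ := G.pair s hs t hc.1
  exact hp (hc.2 p (by rw [he]; simp))

theorem survives_between (G : PairingGap f h X Y K E J) (F : Folding f h X Y K E) {r₁ r₂ : ℝ}
    (hr₁ : r₁ ∈ J) (hr₂ : r₂ ∈ J) (h1 : Survives f h X Y K r₁ t) (h2 : Survives f h X Y K r₂ t)
    (hs : s ∈ Icc r₁ r₂) : Survives f h X Y K s t := by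
  rcases hs.1.eq_or_lt with rfl | hl
  · exact h1
  rcases hs.2.eq_or_lt with rfl | hr
  · exact h2
  by_contra hd
  have hsub := G.ordConnected.out hr₁ hr₂
  obtain ⟨m, hm, t₀, hc⟩ := F.exists_isCenter h1 h2 ⟨hl, hr⟩ hd fun s hs => G.survives s (hsub hs)
  exact G.not_isCenter (hsub ⟨hm.1.le, hm.2.le⟩) hc

/-- Two parameters of the gap that meet would enclose a dead one and hence a centre; partners
therefore lie outside the gap. -/
theorem eq_of_mem_optSet (G : PairingGap f h X Y K E J) (F : Folding f h X Y K E) (ht : 0 < t)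
    (hs : s ∈ J) (hs' : s' ∈ J) (h1 : s ∈ optSet f h X Y K t z) (h2 : s' ∈ optSet f h X Y K t z) :
    s = s' := by
  have key : ∀ r₁ r₂, r₁ ∈ J → r₂ ∈ J → r₁ ∈ optSet f h X Y K t z → r₂ ∈ optSet f h X Y K t z →
      ¬ r₁ < r₂ := by
    intro r₁ r₂ hr₁ hr₂ m1 m2 hlt
    obtain ⟨q, hq, hqd⟩ := F.exists_dead_between ht m1 m2 hlt
    exact hqd (G.survives_between F hr₁ hr₂ ⟨ht, m1.2⟩ ⟨ht, m2.2⟩ ⟨hq.1.le, hq.2.le⟩)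
  exact le_antisymm (not_lt.1 (key s' s hs' hs h2 h1)) (not_lt.1 (key s s' hs hs' h1 h2))

theorem isOpen_mortal (G : PairingGap f h X Y K E J) (F : Folding f h X Y K E) :
    IsOpen (mortal f h X Y K J) := by
  rw [isOpen_iff_mem_nhds]
  rintro s ⟨hs, t, hd⟩
  filter_upwards [G.isOpen.mem_nhds hs, F.eventually_dies hd one_pos] with s' hs' ⟨t', ht', _⟩
  exact ⟨hs', t', ht'⟩

theorem exists_partner (G : PairingGap f h X Y K E J) : ∃ p : ℝ → ℝ, ∀ s ∈ J, ∀ t,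
    Dies f h X Y K s t → p s ≠ s ∧ optSet f h X Y K t (position f X Y t s) = {s, p s} := by
  have : ∀ s, ∃ p, s ∈ J → ∀ t, Dies f h X Y K s t →
      p ≠ s ∧ optSet f h X Y K t (position f X Y t s) = {s, p} := by
    intro s
    by_cases hs : s ∈ J ∧ ∃ t, Dies f h X Y K s t
    · obtain ⟨hs, t, ht⟩ := hs
      obtain ⟨p, hp⟩ := G.pair s hs t ht
      exact ⟨p, fun _ t' ht' => ht'.eq ht ▸ hp⟩
    · exact ⟨0, fun h t ht => absurd ⟨h, t, ht⟩ hs⟩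
  choose p hp using this
  exact ⟨p, hp⟩

/-- A limit of partners survives until `t` at the position of `s`, so it is `s` or `p s`. If it were
`s`, partners would eventually lie in `J`, where no two parameters meet. -/
theorem tendsto_partner (G : PairingGap f h X Y K E J) (F : Folding f h X Y K E) {p : ℝ → ℝ}
    (hp : ∀ s ∈ J, ∀ t, Dies f h X Y K s t →
      p s ≠ s ∧ optSet f h X Y K t (position f X Y t s) = {s, p s})
    (hs : s ∈ J) (hd : Dies f h X Y K s t) : Tendsto p (𝓝 s) (𝓝 (p s)) := by
  obtain ⟨C, hC0, -, hC⟩ := F.admissible.exists_flux_bound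
  have ht := hd.1.1
  obtain ⟨a, ha⟩ := F.param.exists_fst_eq (X s - 1 - 2 * C * (t + 1) - 1)
  obtain ⟨b, hb⟩ := F.param.exists_fst_eq (X s + 1 + 2 * C * (t + 1) + 1)
  have hev : ∀ᶠ s' in 𝓝 s, s' ∈ J ∧ Dies f h X Y K s' (deathTime f h X Y K s') := by
    filter_upwards [G.isOpen.mem_nhds hs, F.eventually_dies hd one_pos] with s' hs' ⟨t', ht', _⟩
    exact ⟨hs', ht'.deathTime_eq.symm ▸ ht'⟩
  have hpm : ∀ s' t', s' ∈ J → Dies f h X Y K s' t' →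
      p s' ∈ optSet f h X Y K t' (position f X Y t' s') := fun s' t' h1 h2 => by
    rw [(hp s' h1 t' h2).2]; simp
  have hbd : ∀ᶠ s' in 𝓝 s, |p s'| ≤ max |a| |b| := by
    have hXc := Metric.tendsto_nhds.1 (F.param.continuous_fst.tendsto s) 1 one_pos
    filter_upwards [G.isOpen.mem_nhds hs, F.eventually_dies hd one_pos, hXc]
      with s' hs' ⟨t', ht', hlt⟩ hX
    have h1 := abs_le.1 (F.abs_fst_sub_le hC ht'.1.1 (hpm s' t' hs' ht').1)
    rw [Real.dist_eq] at hX
    have h2 := abs_lt.1 hX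
    have h3 : C * t' ≤ C * (t + 1) := mul_le_mul_of_nonneg_left (by linarith [(abs_lt.1 hlt).2]) hC0
    have ha' : a ≤ p s' := (F.param.lt_of_fst_lt (by linarith)).le
    have hb' : p s' ≤ b := (F.param.lt_of_fst_lt (by linarith)).le
    exact _root_.abs_le.2 ⟨by linarith [neg_abs_le a, le_max_left |a| |b|],
      by linarith [le_abs_self b, le_max_right |a| |b|]⟩
  refine tendsto_of_unique_limit hbd fun g hg _ y' _ hlim => ?_
  have hT := (F.tendsto_deathTime hd).mono_left hg
  have hid : Tendsto (fun s' : ℝ => s') g (𝓝 s) := hg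
  have hsurv : Survives f h X Y K y' t := by
    refine F.survives_of_tendsto ht hlim hT (Eventually.frequently ?_)
    filter_upwards [hg hev] with s' hs'
    exact ⟨hs'.2.1.1, (hpm s' _ hs'.1 hs'.2).2⟩
  have hcont := F.param.continuous_position F.admissible
  have hpos : position f X Y t y' = position f X Y t s := by
    have l1 := (hcont.tendsto (y', t)).comp (hlim.prodMk_nhds hT)
    have l2 := (hcont.tendsto (s, t)).comp (hid.prodMk_nhds hT)
    refine tendsto_nhds_unique l1 (l2.congr' ?_)
    filter_upwards [hg hev] with s' hs'
    exact (hpm s' _ hs'.1 hs'.2).1.symm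
  have hmem : y' ∈ optSet f h X Y K t (position f X Y t s) := ⟨hpos, hsurv.2⟩
  rw [(hp s hs t hd).2] at hmem
  rcases hmem with rfl | he
  · obtain ⟨s', h1, h2⟩ := ((hev.filter_mono hg).and (hlim.eventually (G.isOpen.mem_nhds hs))).exists
    exact absurd (G.eq_of_mem_optSet F h1.2.1.1 h2 h1.1 (hpm s' _ h1.1 h1.2)
      (Folding.mem_optSet h1.2.1)) (hp s' h1.1 _ h1.2).1
  · exact he

/-- The Hopf–Lax function has one expansion with slope `Y s` and one with slope `Y (p s)` along the
same points. Their difference is a linear relation between the increments of the parameter and of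
the death time; the coefficient of the latter is nonzero by strict concavity. -/
theorem hasDerivAt_deathTime (G : PairingGap f h X Y K E J) (F : Folding f h X Y K E) {p : ℝ → ℝ}
    (hp : ∀ s ∈ J, ∀ t, Dies f h X Y K s t →
      p s ≠ s ∧ optSet f h X Y K t (position f X Y t s) = {s, p s})
    (hs : s ∈ J) (hd : Dies f h X Y K s t) :
    (Y s - Y (p s)) * deriv f (Y s) - (f (Y s) - f (Y (p s))) ≠ 0 ∧
    HasDerivAt (deathTime f h X Y K) (-((Y s - Y (p s)) * positionDeriv f X Y t s) /
      ((Y s - Y (p s)) * deriv f (Y s) - (f (Y s) - f (Y (p s))))) s := by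
  have ht := hd.1.1
  have hTs := hd.deathTime_eq
  have hm := Folding.mem_optSet hd.1
  have hpm : p s ∈ optSet f h X Y K t (position f X Y t s) := by
    rw [(hp s hs t hd).2]; simp
  have hne := F.snd_ne hm hpm (hp s hs t hd).1.symm
  have hB : (Y s - Y (p s)) * deriv f (Y s) - (f (Y s) - f (Y (p s))) ≠ 0 := by
    have := F.admissible.lt_tangent hne.symm
    exact ne_of_lt (by linarith)
  refine ⟨hB, hasDerivAt_of_isLittleO hB ?_⟩
  have hT := F.tendsto_deathTime hd
  have hq : Tendsto (fun s' => (s', deathTime f h X Y K s')) (𝓝 s) (𝓝 (s, t)) :=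
    tendsto_id.prodMk_nhds hT
  have hz := ((F.param.continuous_position F.admissible).tendsto (s, t)).comp hq
  have hev : ∀ᶠ s' in 𝓝 s, s' ∈ J ∧ Dies f h X Y K s' (deathTime f h X Y K s') := by
    filter_upwards [G.isOpen.mem_nhds hs, F.eventually_dies hd one_pos] with s' hs' ⟨t', ht', _⟩
    exact ⟨hs', ht'.deathTime_eq.symm ▸ ht'⟩
  have o1 := F.admissible.isLittleO_hopfLax ht (Folding.isOpt_of_mem hm)
    (F.param.continuous_fst.tendsto s) hz hT (hev.mono fun s' hs' => hs'.2.1.2)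
  have o2 := F.admissible.isLittleO_hopfLax ht (Folding.isOpt_of_mem hpm)
    ((F.param.continuous_fst.tendsto (p s)).comp (G.tendsto_partner F hp hs hd)) hz hT
    (hev.mono fun s' hs' => by
      refine Folding.isOpt_of_mem (s := p s') (Y := Y) ?_
      change p s' ∈ optSet f h X Y K _ (position f X Y _ s')
      rw [(hp s' hs'.1 _ hs'.2).2]; simp)
  have o3 := ((hasFDerivAt_iff_isLittleO.1
    (F.param.hasFDerivAt_position F.admissible (t := t) (G.notMem s hs))).comp_tendsto hq)
  have hO : (fun s' => (position f X Y (deathTime f h X Y K s') s' - position f X Y t s,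
      deathTime f h X Y K s' - t)) =O[𝓝 s] fun s' => (s' - s, deathTime f h X Y K s' - t) := by
    refine Asymptotics.IsBigO.prod_left ?_ (Asymptotics.isBigO_snd_prod (f' := fun s' => s' - s))
    exact ((F.param.hasFDerivAt_position F.admissible (t := t)
      (G.notMem s hs)).isBigO_sub).comp_tendsto hq
  rw [F.slopeOf_eq ht hm] at o1
  rw [F.slopeOf_eq ht hpm] at o2
  have o4 := ((o2.sub o1).trans_isBigO hO).sub (o3.const_mul_left (Y s - Y (p s)))
  rw [hTs]
  refine o4.congr_left fun s' => ?_
  simp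
  ring

theorem contDiffOn_deathTime (G : PairingGap f h X Y K E J) (F : Folding f h X Y K E) :
    ContDiffOn ℝ 1 (deathTime f h X Y K) (mortal f h X Y K J) := by
  obtain ⟨p, hp⟩ := G.exists_partner
  have hopen := G.isOpen_mortal F
  have hd : ∀ s ∈ mortal f h X Y K J, Dies f h X Y K s (deathTime f h X Y K s) := by
    rintro s ⟨-, t, ht⟩
    exact ht.deathTime_eq.symm ▸ ht
  have hder := fun s (hs : s ∈ mortal f h X Y K J) => G.hasDerivAt_deathTime F hp hs.1 (hd s hs)
  have hT : ContinuousOn (deathTime f h X Y K) (mortal f h X Y K J) :=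
    fun s hs => (hder s hs).2.continuousAt.continuousWithinAt
  have hpc : ContinuousOn p (mortal f h X Y K J) :=
    fun s hs => (G.tendsto_partner F hp hs.1 (hd s hs)).mono_left nhdsWithin_le_nhds
  have hY : ContinuousOn Y (mortal f h X Y K J) := F.param.continuous_snd.continuousOn
  have hYp : ContinuousOn (fun s => Y (p s)) (mortal f h X Y K J) :=
    F.param.continuous_snd.comp_continuousOn hpc
  have hX' : ContinuousOn (deriv X) (mortal f h X Y K J) := fun s hs =>
    ((F.param.contDiffOn fun s hs => G.notMem s hs.1).1.continuousOn_deriv_of_isOpen hopen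
      le_rfl) s hs
  have hY' : ContinuousOn (deriv Y) (mortal f h X Y K J) := fun s hs =>
    ((F.param.contDiffOn fun s hs => G.notMem s hs.1).2.continuousOn_deriv_of_isOpen hopen
      le_rfl) s hs
  have hf0 : Continuous f := F.admissible.continuous
  have hf1 : Continuous (deriv f) := F.admissible.continuous_deriv
  have hf2 : Continuous (deriv (deriv f)) := F.admissible.contDiff_deriv.continuous_deriv le_rfl
  rw [show (1 : WithTop ℕ∞) = 0 + 1 from rfl, contDiffOn_succ_iff_deriv_of_isOpen hopen]
  refine ⟨fun s hs => (hder s hs).2.differentiableAt.differentiableWithinAt, by simp,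
    contDiffOn_zero.2 ?_⟩
  refine ContinuousOn.congr (f := fun s => -((Y s - Y (p s)) *
    (deriv X s + deriv (deriv f) (Y s) * deriv Y s * deathTime f h X Y K s)) /
      ((Y s - Y (p s)) * deriv f (Y s) - (f (Y s) - f (Y (p s))))) ?_
    fun s hs => (hder s hs).2.deriv
  refine ContinuousOn.div ?_ ?_ fun s hs => (hder s hs).1
  · exact ((hY.sub hYp).mul (hX'.add (((hf2.comp_continuousOn hY).mul hY').mul hT))).neg
  · exact ((hY.sub hYp).mul (hf1.comp_continuousOn hY)).sub
      ((hf0.comp_continuousOn hY).sub (hf0.comp_continuousOn hYp))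

theorem contDiffOn_surfacePoint (G : PairingGap f h X Y K E J) (F : Folding f h X Y K E) :
    ContDiffOn ℝ 1 (fun s => surfacePoint f X Y s (deathTime f h X Y K s))
      (mortal f h X Y K J) := by
  obtain ⟨hX, hY⟩ := F.param.contDiffOn fun s (hs : s ∈ mortal f h X Y K J) => G.notMem s hs.1
  have hT := G.contDiffOn_deathTime F
  exact (hX.add ((F.admissible.contDiff_deriv.comp_contDiffOn hY).mul hT)).prodMk (hT.prodMk hY)

end PairingGap

end EqualArea

/-! ### Assembling the boundary curves; membership in `Υ` -/

namespace EqualArea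
open Function

variable {f h X Y : ℝ → ℝ} {K s s' t t' z : ℝ} {E : Finset ℝ} {u : ℝ → ℝ → ℝ} {J : Set ℝ}

/-- The requirements on the curves that make up the boundary of the graph of a function in
the class `Υ`. -/
def IsSlicedCurve (A : Set (ℝ × ℝ × ℝ)) : Prop :=
  IsC1Curve A ∧
    ∀ t₀ : ℝ, ((fun p : ℝ × ℝ × ℝ => (p.1, p.2.1)) '' A ∩ {q | q.2 = t₀}).Finite

theorem isSlicedCurve_singleton (p : ℝ × ℝ × ℝ) : IsSlicedCurve {p} :=
  ⟨⟨{0}, fun _ => p, ordConnected_singleton, singleton_nonempty _, contDiffOn_const, by simp⟩,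
    fun t₀ => ((finite_singleton p).image _).subset inter_subset_left⟩

/-- Finitely many leftover points are added as constant curves. -/
theorem exists_slicedCurves {B : Set (ℝ × ℝ × ℝ)} {𝒞 : Set (Set (ℝ × ℝ × ℝ))} (hfin : 𝒞.Finite)
    (h𝒞 : ∀ A ∈ 𝒞, IsSlicedCurve A ∧ A ⊆ B) (hB : (B \ ⋃₀ 𝒞).Finite) :
    ∃ 𝒞' : Set (Set (ℝ × ℝ × ℝ)), 𝒞'.Finite ∧ (∀ A ∈ 𝒞', IsSlicedCurve A) ∧ B = ⋃₀ 𝒞' := by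
  refine ⟨𝒞 ∪ singleton '' (B \ ⋃₀ 𝒞), hfin.union (hB.image _), ?_, ?_⟩
  · rintro A (hA | ⟨p, -, rfl⟩)
    · exact (h𝒞 A hA).1
    · exact isSlicedCurve_singleton p
  · rw [sUnion_union, sUnion_image, biUnion_of_singleton, union_sdiff_self]
    exact (union_eq_self_of_subset_left (sUnion_subset fun A hA => (h𝒞 A hA).2)).symm

/-- The complement of a finite set of reals is a finite union of open intervals. -/
theorem exists_gaps {D : Set ℝ} (hD : D.Finite) : ∃ 𝒥 : Set (Set ℝ), 𝒥.Finite ∧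
    (∀ J ∈ 𝒥, IsOpen J ∧ J.OrdConnected ∧ Disjoint J D) ∧ Dᶜ ⊆ ⋃₀ 𝒥 := by
  induction D, hD using Set.Finite.induction_on with
  | empty => exact ⟨{univ}, finite_singleton _, by simp [ordConnected_univ], by simp⟩
  | @insert a D _ _ ih =>
    obtain ⟨𝒥, hfin, hJ, hc⟩ := ih
    refine ⟨(· ∩ Iio a) '' 𝒥 ∪ (· ∩ Ioi a) '' 𝒥, (hfin.image _).union (hfin.image _), ?_, ?_⟩
    · rintro _ (⟨J, h, rfl⟩ | ⟨J, h, rfl⟩)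
      · refine ⟨(hJ J h).1.inter isOpen_Iio, (hJ J h).2.1.inter ordConnected_Iio, ?_⟩
        rw [Set.disjoint_insert_right]
        exact ⟨fun ha => lt_irrefl a ha.2, (hJ J h).2.2.mono_left inter_subset_left⟩
      · refine ⟨(hJ J h).1.inter isOpen_Ioi, (hJ J h).2.1.inter ordConnected_Ioi, ?_⟩
        rw [Set.disjoint_insert_right]
        exact ⟨fun ha => lt_irrefl a ha.2, (hJ J h).2.2.mono_left inter_subset_left⟩
    · intro x hx
      simp only [mem_compl_iff, mem_insert_iff, not_or] at hx
      obtain ⟨J, h, hxJ⟩ := hc hx.2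
      rcases lt_or_gt_of_ne hx.1 with hlt | hlt
      · exact ⟨_, Or.inl ⟨J, h, rfl⟩, hxJ, hlt⟩
      · exact ⟨_, Or.inr ⟨J, h, rfl⟩, hxJ, hlt⟩

namespace Folding

theorem fst_eq_of_gap (F : Folding f h X Y K E) (hJ : J.OrdConnected) (hE : ∀ s ∈ J, s ∉ E)
    (hs : s ∈ J) (hd : ¬ ContDiffAt ℝ 1 h (X s)) (hs' : s' ∈ J) : X s' = X s := by
  obtain ⟨α, hα, β, hβ, hl⟩ := F.param.levels _ hd
  have h1 := (hl s).1 rfl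
  refine (hl s').2 ⟨?_, ?_⟩
  · by_contra! hlt
    exact hE α (hJ.out hs' hs ⟨hlt.le, h1.1⟩) hα
  · by_contra! hlt
    exact hE β (hJ.out hs hs' ⟨h1.2, hlt.le⟩) hβ

/-- Off `E` only points on an upward jump fail to survive for any time. A gap that touches such a
jump lies inside it, so one survivor in the gap excludes this. -/
theorem survives_of_gap (F : Folding f h X Y K E) (hJ : J.OrdConnected) (hE : ∀ s ∈ J, s ∉ E)
    (hs : s ∈ J) (hsv : Survives f h X Y K s t) (hs' : s' ∈ J) :
    ∃ t, Survives f h X Y K s' t := by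
  rcases F.short_time (hE s' hs') with ⟨t', -, ht'⟩ | hlr
  · exact ⟨t', ht'.self_of_nhds⟩
  · have hd : ¬ ContDiffAt ℝ 1 h (X s') := fun hd => by
      rw [Admissible.leftLim_eq_of_continuousAt hd.continuousAt,
        Admissible.rightLim_eq_of_continuousAt hd.continuousAt] at hlr
      exact lt_irrefl _ hlr
    rw [← F.fst_eq_of_gap hJ hE hs' hd hs] at hlr
    exact absurd hsv (F.not_survives_of_jump hlr)

end Folding

/-- No absorption in the gap happens at an open end of a shock path, so it is neither the start of a
shock nor a collision of three: exactly two parameters meet. -/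
theorem ShockPaths.pairingGap {n : ℕ} {I : Fin n → Set ℝ} {σ : Fin n → ℝ → ℝ}
    (P : ShockPaths u I σ) (F : Folding f h X Y K E) (hu : IsOptField f h K u) (hJo : IsOpen J)
    (hJ : J.OrdConnected) (hE : ∀ s ∈ J, s ∉ E)
    (hI : ∀ s ∈ J, ∀ t, Dies f h X Y K s t → t ∉ openEnds I)
    (hs : s ∈ J) (hsv : Survives f h X Y K s t) : PairingGap f h X Y K E J where
  isOpen := hJo
  ordConnected := hJ
  notMem := hE
  survives := fun _ hs' => F.survives_of_gap hJ hE hs hsv hs'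
  pair := by
    intro s hs t hd
    have hmem := Folding.mem_optSet hd.1
    have hnc : ¬ IsCenter f h X Y K s t := fun hc =>
      hI s hs t hd (P.mem_openEnds_of_isCenter F hu hc)
    have hp : ∃ p ∈ optSet f h X Y K t (position f X Y t s), p ≠ s := by
      by_contra! hall
      exact hnc ⟨hd, hall⟩
    obtain ⟨p, hpm, hps⟩ := hp
    refine ⟨p, hps, Set.Subset.antisymm (fun q hq => ?_) (by rintro q (rfl | rfl) <;> assumption)⟩
    by_contra hne
    simp only [mem_insert_iff, mem_singleton_iff, not_or] at hne
    have tri : ∀ {a b c : ℝ}, a ∈ optSet f h X Y K t (position f X Y t s) →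
        b ∈ optSet f h X Y K t (position f X Y t s) →
        c ∈ optSet f h X Y K t (position f X Y t s) → a < b → ¬ b < c :=
      fun ha hb hc h1 h2 => hI s hs t hd (P.mem_openEnds_of_triple F hu hd.1.1 ha hb hc h1 h2)
    rcases lt_or_gt_of_ne hps with h1 | h1 <;> rcases lt_or_gt_of_ne hne.1 with h2 | h2 <;>
      rcases lt_or_gt_of_ne hne.2 with h3 | h3
    · exact tri hq hpm hmem h3 h1
    · exact tri hpm hq hmem h3 h2
    · exact lt_asymm h1 (h2.trans h3)
    · exact tri hpm hmem hq h1 h2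
    · exact tri hq hmem hpm h2 h1
    · exact lt_asymm h1 (h3.trans h2)
    · exact tri hmem hq hpm h2 h3
    · exact tri hmem hpm hq h1 h3

namespace PairingGap

/-- The parameters of the absorbed points in a gap form at most two intervals. -/
theorem exists_mortal_eq (G : PairingGap f h X Y K E J) (F : Folding f h X Y K E) :
    ∃ L R : Set ℝ, L.OrdConnected ∧ R.OrdConnected ∧ mortal f h X Y K J = L ∪ R := by
  have hsub : mortal f h X Y K J ⊆ J := fun s hs => hs.1
  refine ⟨{s ∈ mortal f h X Y K J | ∀ q ∈ J \ mortal f h X Y K J, s < q},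
    {s ∈ mortal f h X Y K J | ∀ q ∈ J \ mortal f h X Y K J, q < s}, ?_, ?_, ?_⟩
  · refine ordConnected_def.2 fun a ha b hb x hx => ?_
    have hlt : ∀ q ∈ J \ mortal f h X Y K J, x < q := fun q hq => hx.2.trans_lt (hb.2 q hq)
    refine ⟨?_, hlt⟩
    by_contra hxm
    exact lt_irrefl x (hlt x ⟨G.ordConnected.out ha.1.1 hb.1.1 hx, hxm⟩)
  · refine ordConnected_def.2 fun a ha b hb x hx => ?_
    have hlt : ∀ q ∈ J \ mortal f h X Y K J, q < x := fun q hq => (ha.2 q hq).trans_le hx.1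
    refine ⟨?_, hlt⟩
    by_contra hxm
    exact lt_irrefl x (hlt x ⟨G.ordConnected.out ha.1.1 hb.1.1 hx, hxm⟩)
  · refine Set.Subset.antisymm (fun s hs => ?_) (union_subset (fun s hs => hs.1) fun s hs => hs.1)
    by_contra hn
    have h1 : ∃ q ∈ J \ mortal f h X Y K J, q ≤ s := by
      by_contra! hall
      exact hn (Or.inl ⟨hs, hall⟩)
    have h2 : ∃ q ∈ J \ mortal f h X Y K J, s ≤ q := by
      by_contra! hall
      exact hn (Or.inr ⟨hs, hall⟩)
    obtain ⟨q₁, hq₁, hle₁⟩ := h1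
    obtain ⟨q₂, hq₂, hle₂⟩ := h2
    obtain ⟨t, hd⟩ := hs.2
    have hpos : 0 < t + 1 := by linarith [hd.1.1]
    -- Parameters of the gap that are never absorbed survive past any time, and whatever lies
    -- between two of them survives too.
    have him : ∀ q ∈ J \ mortal f h X Y K J, Survives f h X Y K q (t + 1) := fun q hq => by
      by_contra hns
      obtain ⟨τ, hτ⟩ := G.survives q hq.1
      exact hq.2 ⟨hq.1, F.exists_dies hτ hns hpos⟩
    exact hd.2 (t + 1) (lt_add_one t)
      (G.survives_between F hq₁.1 hq₂.1 (him q₁ hq₁) (him q₂ hq₂) ⟨hle₁, hle₂⟩)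

end PairingGap

namespace ShockPaths

variable {n : ℕ} {I : Fin n → Set ℝ} {σ : Fin n → ℝ → ℝ}

theorem isSlicedCurve (P : ShockPaths u I σ) (F : Folding f h X Y K E) (hu : IsOptField f h K u)
    (G : PairingGap f h X Y K E J) {L : Set ℝ} (hL : L.OrdConnected) (hne : L.Nonempty)
    (hsub : L ⊆ mortal f h X Y K J) :
    IsSlicedCurve ((fun s => surfacePoint f X Y s (deathTime f h X Y K s)) '' L) := by
  refine ⟨⟨L, _, hL, hne, (G.contDiffOn_surfacePoint F).mono hsub, rfl⟩, fun t₀ => ?_⟩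
  refine ((P.finite_dies F hu t₀).image fun s => (position f X Y t₀ s, t₀)).subset ?_
  rintro _ ⟨⟨_, ⟨s, hs, rfl⟩, rfl⟩, he⟩
  obtain ⟨t, ht⟩ := (hsub hs).2
  have he : deathTime f h X Y K s = t₀ := he
  rw [ht.deathTime_eq] at he
  subst he
  refine ⟨s, ht, ?_⟩
  simp only [ht.deathTime_eq, surfacePoint]

/-- The absorption points of a gap form at most two arcs of `s ↦ surfacePoint f X Y s (deathTime f h
X Y K s)`. A gap over a downward jump also contributes its segment at time zero, which projects to a
single point. -/
theorem exists_gap_curves (P : ShockPaths u I σ) (F : Folding f h X Y K E)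
    (hu : IsOptField f h K u) (h0 : ∀ x, u x 0 = h x) (hJo : IsOpen J)
    (hJ : J.OrdConnected) (hE : ∀ s ∈ J, s ∉ E)
    (hI : ∀ s ∈ J, ∀ t, Dies f h X Y K s t → t ∉ openEnds I) :
    ∃ 𝒞 : Set (Set (ℝ × ℝ × ℝ)), 𝒞.Finite ∧
      (∀ A ∈ 𝒞, IsSlicedCurve A ∧ A ⊆ graphBoundary f h u) ∧
      (∀ s ∈ J, ∀ t, Dies f h X Y K s t → surfacePoint f X Y s t ∈ ⋃₀ 𝒞) ∧
      ∀ s ∈ J, ¬ ContDiffAt ℝ 1 h (X s) → ¬ leftLim h (X s) < rightLim h (X s) →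
        surfacePoint f X Y s 0 ∈ ⋃₀ 𝒞 := by
  have hdeath : ∃ 𝒞 : Set (Set (ℝ × ℝ × ℝ)), 𝒞.Finite ∧
      (∀ A ∈ 𝒞, IsSlicedCurve A ∧ A ⊆ graphBoundary f h u) ∧
      ∀ s ∈ J, ∀ t, Dies f h X Y K s t → surfacePoint f X Y s t ∈ ⋃₀ 𝒞 := by
    by_cases hex : ∃ s ∈ J, ∃ t, Dies f h X Y K s t
    · obtain ⟨s₀, hs₀, t₀, hd₀⟩ := hex
      have G := P.pairingGap F hu hJo hJ hE hI hs₀ hd₀.1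
      obtain ⟨L, R, hL, hR, he⟩ := G.exists_mortal_eq F
      have hgood : ∀ M : Set ℝ, M.OrdConnected → M ⊆ mortal f h X Y K J → M.Nonempty →
          IsSlicedCurve ((fun s => surfacePoint f X Y s (deathTime f h X Y K s)) '' M) ∧
          (fun s => surfacePoint f X Y s (deathTime f h X Y K s)) '' M ⊆ graphBoundary f h u := by
        refine fun M hM hsub hne => ⟨P.isSlicedCurve F hu G hM hne hsub, ?_⟩
        rintro _ ⟨s, hs, rfl⟩
        obtain ⟨t, ht⟩ := (hsub hs).2
        simp only [ht.deathTime_eq]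
        exact F.mem_boundary_of_dies hu h0 ht
      refine ⟨(fun M => (fun s => surfacePoint f X Y s (deathTime f h X Y K s)) '' M) ''
        {M | (M = L ∨ M = R) ∧ M.Nonempty},
        ((Set.toFinite {L, R}).subset fun M hM => hM.1).image _, ?_, ?_⟩
      · rintro _ ⟨M, ⟨rfl | rfl, hne⟩, rfl⟩
        · exact hgood _ hL (he ▸ subset_union_left) hne
        · exact hgood _ hR (he ▸ subset_union_right) hne
      · intro s hs t hd
        have hm : s ∈ L ∪ R := he ▸ ⟨hs, t, hd⟩
        rcases hm with hm | hm
        · exact ⟨_, ⟨L, ⟨Or.inl rfl, s, hm⟩, rfl⟩, s, hm, by simp only [hd.deathTime_eq]⟩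
        · exact ⟨_, ⟨R, ⟨Or.inr rfl, s, hm⟩, rfl⟩, s, hm, by simp only [hd.deathTime_eq]⟩
    · exact ⟨∅, finite_empty, by simp, fun s hs t hd => absurd ⟨s, hs, t, hd⟩ hex⟩
  obtain ⟨𝒞, hfin, h𝒞, hcov⟩ := hdeath
  by_cases hex : ∃ s ∈ J, ¬ ContDiffAt ℝ 1 h (X s) ∧ ¬ leftLim h (X s) < rightLim h (X s)
  · obtain ⟨s₀, hs₀, hd₀, hl₀⟩ := hex
    have hXc := fun s (hs : s ∈ J) => F.fst_eq_of_gap hJ hE hs₀ hd₀ hs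
    refine ⟨insert ((fun s => surfacePoint f X Y s 0) '' J) 𝒞, hfin.insert _, ?_,
      fun s hs t hd => sUnion_mono (subset_insert _ _) (hcov s hs t hd),
      fun s hs _ _ => ⟨_, mem_insert _ _, s, hs, rfl⟩⟩
    rintro A (rfl | hA)
    · refine ⟨⟨⟨J, _, hJ, ⟨s₀, hs₀⟩, ?_, rfl⟩, fun t₀ => ?_⟩, ?_⟩
      · obtain ⟨hX, hY⟩ := F.param.contDiffOn hE
        exact (hX.add ((F.admissible.contDiff_deriv.comp_contDiffOn hY).mul
          contDiffOn_const)).prodMk (contDiffOn_const.prodMk hY)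
      · refine (finite_singleton (X s₀, (0 : ℝ))).subset ?_
        rintro _ ⟨⟨_, ⟨s, hs, rfl⟩, rfl⟩, -⟩
        simp [surfacePoint, position, hXc s hs]
      · rintro _ ⟨s, hs, rfl⟩
        exact F.mem_boundary_zero hu h0 (hE s hs) (hXc s hs ▸ hd₀) (hXc s hs ▸ hl₀)
    · exact h𝒞 A hA
  · exact ⟨𝒞, hfin, h𝒞, hcov, fun s hs h1 h2 => absurd ⟨s, hs, h1, h2⟩ hex⟩

/-- Removing `E` and the parameters absorbed at open ends of shock paths takes away finitely many
parameters, so there are finitely many gaps, and the boundary points not covered by the curves of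
the gaps are finite in number. -/
theorem exists_curves (P : ShockPaths u I σ) (F : Folding f h X Y K E)
    (hu : IsOptField f h K u) (h0 : ∀ x, u x 0 = h x) :
    ∃ 𝒞 : Set (Set (ℝ × ℝ × ℝ)), 𝒞.Finite ∧ (∀ A ∈ 𝒞, IsSlicedCurve A) ∧
      graphBoundary f h u = ⋃₀ 𝒞 := by
  set D : Set ℝ := E ∪ ⋃ t ∈ openEnds I, {s | Dies f h X Y K s t} with hDdef
  have hD : D.Finite := E.finite_toSet.union
    (P.finite_openEnds.biUnion fun t _ => P.finite_dies F hu t)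
  obtain ⟨𝒥, h𝒥, hJ, hc⟩ := exists_gaps hD
  have hcurves : ∀ J : Set ℝ, ∃ 𝒞 : Set (Set (ℝ × ℝ × ℝ)), J ∈ 𝒥 → 𝒞.Finite ∧
      (∀ A ∈ 𝒞, IsSlicedCurve A ∧ A ⊆ graphBoundary f h u) ∧
      (∀ s ∈ J, ∀ t, Dies f h X Y K s t → surfacePoint f X Y s t ∈ ⋃₀ 𝒞) ∧
      ∀ s ∈ J, ¬ ContDiffAt ℝ 1 h (X s) → ¬ leftLim h (X s) < rightLim h (X s) →
        surfacePoint f X Y s 0 ∈ ⋃₀ 𝒞 := by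
    intro J
    by_cases hmem : J ∈ 𝒥
    · obtain ⟨h1, h2, h3⟩ := hJ J hmem
      have hn := fun s (hs : s ∈ J) => Set.disjoint_left.1 h3 hs
      obtain ⟨𝒞, h𝒞⟩ := P.exists_gap_curves F hu h0 h1 h2
        (fun s hs hE => hn s hs (Or.inl hE))
        (fun s hs t hd ht => hn s hs (Or.inr (mem_biUnion ht hd)))
      exact ⟨𝒞, fun _ => h𝒞⟩
    · exact ⟨∅, fun h => absurd h hmem⟩
  choose 𝒞 h𝒞 using hcurves
  refine exists_slicedCurves (𝒞 := ⋃ J ∈ 𝒥, 𝒞 J) (h𝒥.biUnion fun J hJ => (h𝒞 J hJ).1) ?_ ?_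
  · intro A hA
    obtain ⟨J, hJ, hA⟩ := mem_iUnion₂.1 hA
    exact (h𝒞 J hJ).2.1 A hA
  have hmono : ∀ J ∈ 𝒥, ⋃₀ 𝒞 J ⊆ ⋃₀ ⋃ J ∈ 𝒥, 𝒞 J := fun J hJ =>
    sUnion_mono (subset_biUnion_of_mem (u := 𝒞) hJ)
  have hS : {ξ | ¬ ContDiffAt ℝ 1 h ξ}.Finite := by
    obtain ⟨S, hS, -⟩ := F.admissible.piecewise
    exact S.finite_toSet.subset fun ξ hξ => by_contra fun hn => hξ (hS ξ hn)
  refine (((hD.image fun s => surfacePoint f X Y s (deathTime f h X Y K s)).union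
    (hD.image fun s => surfacePoint f X Y s 0)).union
    (hS.image fun ξ => (ξ, (0 : ℝ), h ξ))).subset ?_
  rintro p ⟨hp, hpn⟩
  have hp0 : 0 ≤ p.2.1 := ((mem_graphBoundary_iff (F.graphOf_subset hu h0)).1 hp).1.1
  rcases hp0.eq_or_lt with hz | hpos
  · rcases F.exists_of_mem_boundary_zero hu h0 hp hz.symm with ⟨s, ⟨-, h1, h2⟩, he⟩ | ⟨s, hs, he⟩ | h2
    · refine Or.inl (Or.inr ⟨s, ?_, he.symm⟩)
      by_contra hsD
      obtain ⟨J, hJ, hsJ⟩ := hc hsD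
      exact hpn (hmono J hJ (he ▸ (h𝒞 J hJ).2.2.2 s hsJ h1 h2))
    · exact Or.inl (Or.inr ⟨s, Or.inl hs, he⟩)
    · exact Or.inr h2
  · obtain ⟨s, hd, he⟩ := F.exists_dies_of_mem_boundary hu h0 hp hpos
    refine Or.inl (Or.inl ⟨s, ?_, by simp only [hd.deathTime_eq]; exact he.symm⟩)
    by_contra hsD
    obtain ⟨J, hJ, hsJ⟩ := hc hsD
    have := (h𝒞 J hJ).2.2.1 s hsJ _ hd
    rw [← he] at this
    exact hpn (hmono J hJ this)

end ShockPaths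

namespace Folding

/-- The total integral is the difference of the Hopf–Lax function at far right and far left, where
it equals `∫ h` and 0. -/
theorem boundedProfile (F : Folding f h X Y K E) (hu : IsOptField f h K u) (ht : 0 < t) :
    ∃ R, BoundedProfile (fun x => u x t) K R ∧ ∫ x, u x t = ∫ x, h x := by
  obtain ⟨R, hR, h1, h2, h3⟩ := F.admissible.exists_hopfLax_far t
  have hb : BoundedProfile (fun x => u x t) K R := by
    refine ⟨F.measurable hu ht, hu.abs_le F.admissible ht, fun x hx => ?_⟩
    obtain ⟨X', hX', he⟩ := hu t ht x
    exact he.trans (h3 t ht le_rfl x X' hx hX')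
  refine ⟨R, hb, ?_⟩
  rw [← intervalIntegral.integral_eq_integral_of_support_subset (a := -R) (b := R),
    F.integral_eq hu ht, h1 t ht le_rfl _ le_rfl, h2 t ht le_rfl _ le_rfl, sub_zero]
  intro x hx
  have := abs_lt.1 (not_le.1 fun hle => hx (hb.support x hle))
  exact ⟨this.1, this.2.le⟩

theorem memUpsilon (F : Folding f h X Y K E) (hu : IsEqualAreaSolution f h u)
    (hs : FinitelyManyShocks u) : MemUpsilon f h u := by
  have ho := hu.isOptField F.admissible
  obtain ⟨n, I, σ, P⟩ := hs.exists_shockPaths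
  obtain ⟨𝒞, h1, h2, h3⟩ := P.exists_curves F ho hu.initial
  have h0 : (fun x => u x 0) = h := funext hu.initial
  refine ⟨hu.initial, F.graphOf_subset ho hu.initial, ⟨𝒞, h1, h2, h3⟩, fun t ht => ?_, ?_⟩
  · rcases ht.eq_or_lt with rfl | ht
    · exact h0 ▸ F.admissible.integrable
    · obtain ⟨R, hb, -⟩ := F.boundedProfile ho ht
      exact hb.integrable
  · refine (continuousOn_const (c := ∫ x, h x)).congr fun t ht => ?_
    rcases (mem_Ici.1 ht).eq_or_lt with rfl | ht
    · simp only [h0]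
    · exact (F.boundedProfile ho ht).choose_spec.2

end Folding

end EqualArea

/-! ### The theorem -/

theorem mainTheorem1 (f h : ℝ → ℝ) (hf : ContDiff ℝ 2 f) (hconc : StrictConcaveOn ℝ univ f)
    (hh : EqualArea.PiecewiseC1 h) (hsupp : HasCompactSupport h)
    (hext : ∀ t : ℝ, 0 ≤ t → {ξ : ℝ | IsLocalExtr (fun ζ : ℝ => ζ + deriv f (h ζ) * t) ξ}.Finite) :
    (∃ u : ℝ → ℝ → ℝ, EqualArea.IsEqualAreaSolution f h u) ∧
    ∀ u : ℝ → ℝ → ℝ, EqualArea.IsEqualAreaSolution f h u →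
      EqualArea.SolvesIntegralLaw f u ∧
      EqualArea.JumpsUpward u ∧
      (EqualArea.FinitelyManyShocks u → EqualArea.MemUpsilon f h u) ∧
      ∀ v : ℝ → ℝ → ℝ, EqualArea.MemUpsilon f h v → EqualArea.SolvesIntegralLaw f v →
        EqualArea.JumpsUpward v →
        ∀ t : ℝ, 0 ≤ t → (fun x => v x t) =ᵐ[volume] fun x => u x t := by
  obtain ⟨K, H⟩ := EqualArea.exists_admissible hf hconc hh hsupp
  obtain ⟨X, Y, E, P⟩ := EqualArea.exists_regularParam hh
  have F : EqualArea.Folding f h X Y K E := ⟨H, P, hext⟩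
  refine ⟨F.exists_isEqualAreaSolution, fun u hu => ?_⟩
  have ho := hu.isOptField H
  refine ⟨F.solvesIntegralLaw ho, ho.jumpsUpward H, F.memUpsilon hu, fun v hv hl hj t ht => ?_⟩
  rcases ht.eq_or_lt with rfl | ht
  · exact Filter.Eventually.of_forall fun x => (hv.initial x).trans (hu.initial x).symm
  · exact hv.ae_eq_optField hl hj F ho ht
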